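/- **Setting.** There are $K\ge 1$ nodes, a feature space $\mathcal X$, and a finite label space $\mathcal Y$. Node $k$ has a training distribution $P_k$ on $\mathcal X\times\mathcal Y$ (population or empirical) with label marginal $p_k^{\rm tr}(y)>0$ for all $y$, and finitely many unlabelled test points $x_{k,1},\dots,x_{k,n_k}$. Hypotheses $h_w$, $w\in\mathbb R^d$, are evaluated by a loss $\ell\ge 0$ such that $(x,y)\mapsto\ell(h_w(x),y)$ is measurable and $P_k$-integrable for all $w,k$. For a predictor $f$ with strictly positive softmax output $f(x)\in\mathbb R^{\mathcal Y}$, a VRLS ratio $r_{k,f}$ of node $k$ is any maximiser of $\frac1{n_k}\sum_j\log\big(f(x_{k,j})^\top r\big)$ over $r\ge 0$ with $\sum_y p_k^{\rm tr}(y)r(y)=1$. Given predictors $f_1,\dots,f_K$ from a fixed class and corresponding VRLS ratios $r_{1,f_1},\dots,r_{K,f_K}$, the aggregated ratio of node $k$ is $$r_k(y)=\frac{\frac1K\sum_{j=1}^K p_j^{\rm tr}(y)\,r_{j,f_j}(y)}{p_k^{\rm tr}(y)},$$ and $r_{\max}$ is the supremum of $r_k(y)$ over $k$, $y$, all choices of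 predictors in the class and all corresponding VRLS ratios. For the predictors and ratios actually used, the IW-ERM objective is $F(w)=\frac1K\sum_{k}\mathbb E_{(x,y)\sim P_k}[r_k(y)\,\ell(h_w(x),y)]$, and the stochastic gradient of node $k$ at $w$ on a sample $z=(x,y)\sim P_k$ is $g_k(w;z)=r_k(y)\nabla_w\ell(h_w(x),y)$. **Algorithm.** Parameters: $\tau\ge1$ local steps per round, step sizes $\eta_t\ge 0$, momentum parameters $\alpha_t\in[0,1]$ with $\alpha_0=1$, second-moment parameters $\beta_{2,t}\in[0,1]$, and $\rho>0$. All nodes start at $x_0^k=x_{-1}^k=w_0$ with $m_{-1}^k=0$, $v_{-1}^k=0$ and the shared vector $a=0$. In local step $t=0,1,2,\dots$ node $k$ draws one sample $z_t^k\sim P_k$ (all samples are independent) and sets $$m_t^k=g_k(x_t^k;z_t^k)+(1-\alpha_t)\big(m_{t-1}^k-g_k(x_{t-1}^k;z_t^k)\big),\quad v_t^k=\beta_{2,t}v_{t-1}^k+(1-\beta_{2,t})\,g_k(x_t^k;z_t^k)^2,\quad x_{t+1}^k=x_t^k-\eta_tA^{-1}m_t^k,$$ where squares are coordinatewise and $A=\operatorname{diag}(\sqrt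 a+\rho)$, so that $\lambda_{\min}(A)\ge\rho$. After each step with $\tau\mid t+1$ the nodes communicate: $x_{t+1}^k$, $m_t^k$, $v_t^k$ are replaced by their averages over the nodes, and $a$ is set to the averaged $v_t$. Let $w_t=\frac1K\sum_k x_t^k$ be the model after $t$ stochastic gradients per node; $R$ rounds give $T=\tau R$ stochastic gradients per node. **Assumptions.** (1) For every $(x,y)$ the map $w\mapsto\ell(h_w(x),y)$ is differentiable with $\beta$-Lipschitz gradient of norm at most $G$. (2) For all $k$ and $w$, $\mathbb E\,g_k(w;z)=\nabla F(w)$ and $\mathbb E\|g_k(w;z)-\nabla F(w)\|^2\le\sigma^2$. (3) $\beta,\rho>0$ and $F(w_0)-\inf F\le\Delta$. **Theorem.** There is a constant $C>0$ depending only on $\beta,G,\sigma,\Delta,\rho$ such that for all $K\ge1$, all $\varepsilon>0$ with $K\varepsilon\le 1$, and every value of $r_{\max}$ there are $\tau,R\ge1$ and sequences $(\eta_t),(\alpha_t)$, depending only on $\beta,G,\sigma,\Delta,\rho,K,\varepsilon,r_{\max}$, such that for every problem as above with this $r_{\max}$, every $w_0$, and every sequence $(\beta_{2,t})$ in $[0,1]$,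 $$T=\tau R\le C\,\frac{r_{\max}}{K\varepsilon^3},\qquad R\le C\,\frac{r_{\max}}{\varepsilon^2},\qquad \frac1R\sum_{j=1}^R\mathbb E\|\nabla F(w_{\tau j})\|\le\varepsilon .$$ In particular there is $R'\in\{1,\dots,R\}$ such that the run with $R'$ rounds, i.e. $T'=\tau R'$ stochastic gradients per node, ends at a model with $\mathbb E\|\nabla F(w_{T'})\|\le\varepsilon$. -/

import Mathlib

open MeasureTheory ProbabilityTheory
open scoped BigOperators

noncomputable section

/-- Parameter vectors `w ∈ ℝ^d` with the Euclidean norm. -/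
abbrev Vec (d : ℕ) : Type := EuclideanSpace ℝ (Fin d)

/-- A multi-node label-shift learning problem with `K` nodes, feature space `X`, finite label
space `Y`, prediction space `O`, and predictors for the ratio estimation parametrised by `Θ`.

`trainDist k` is the distribution from which the labelled training samples of node `k` are drawn.
It may be the population distribution or the empirical distribution of a finite training set. -/
structure LabelShiftProblem (K d : ℕ) (X Y O Θ : Type*)
    [Fintype Y] [MeasurableSpace X] [MeasurableSpace Y] where
  trainDist : Fin K → Measure (X × Y)
  trainDist_prob : ∀ k, IsProbabilityMeasure (trainDist k)
  /-- every label has positive probability at every node -/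
  label_pos : ∀ k y, 0 < (trainDist k).real {z | z.2 = y}
  /-- unlabelled test data of each node -/
  numTest : Fin K → ℕ
  numTest_pos : ∀ k, 0 < numTest k
  testPoint : (k : Fin K) → Fin (numTest k) → X
  /-- predictors `f_θ` with softmax output: a positive probability vector over the labels -/
  predictor : Θ → X → Y → ℝ
  predictor_pos : ∀ θ x y, 0 < predictor θ x y
  predictor_sum : ∀ θ x, ∑ y, predictor θ x y = 1
  /-- the hypotheses `h_w` -/
  hyp : Vec d → X → O
  /-- the loss `ℓ ≥ 0` -/
  loss : O → Y → ℝ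
  loss_nonneg : ∀ o y, 0 ≤ loss o y
  loss_measurable : ∀ w, Measurable fun z : X × Y => loss (hyp w z.1) z.2
  loss_integrable : ∀ w k, Integrable (fun z : X × Y => loss (hyp w z.1) z.2) (trainDist k)

namespace LabelShiftProblem

variable {K d : ℕ} {X Y O Θ : Type*} [Fintype Y] [MeasurableSpace X] [MeasurableSpace Y]

/-- Training label marginal `p_k^tr(y)`. -/
def trainMarginal (P : LabelShiftProblem K d X Y O Θ) (k : Fin K) (y : Y) : ℝ :=
  (P.trainDist k).real {z | z.2 = y}

/-- Admissible ratio vectors of node `k`: `r ≥ 0` and `∑_y p_k^tr(y) r(y) = 1`. -/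
def feasibleRatios (P : LabelShiftProblem K d X Y O Θ) (k : Fin K) : Set (Y → ℝ) :=
  {r | (∀ y, 0 ≤ r y) ∧ ∑ y, P.trainMarginal k y * r y = 1}

/-- The maximum-likelihood objective `𝔼_te[log (f_θ(x)ᵀ r)]` over the test data of node `k`. -/
def ratioObjective (P : LabelShiftProblem K d X Y O Θ) (k : Fin K) (θ : Θ) (r : Y → ℝ) : ℝ :=
  (1 / (P.numTest k : ℝ)) *
    ∑ j, Real.log (∑ y, P.predictor θ (P.testPoint k j) y * r y)

/-- `r` is a VRLS ratio `r_f` of node `k` for the predictor `f = f_θ`: it maximises the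
likelihood objective among the admissible ratio vectors. -/
def IsVRLSRatio (P : LabelShiftProblem K d X Y O Θ) (k : Fin K) (θ : Θ) (r : Y → ℝ) : Prop :=
  r ∈ P.feasibleRatios k ∧ IsMaxOn (P.ratioObjective k θ) (P.feasibleRatios k) r

/-- Aggregated ratio at node `k`: the average over the nodes `j` of the estimated test label
marginals `p_j^te(y) = p_j^tr(y) r_j(y)`, divided by `p_k^tr(y)`. -/
def aggregatedRatio (P : LabelShiftProblem K d X Y O Θ) (r : Fin K → Y → ℝ)
    (k : Fin K) (y : Y) : ℝ :=
  ((1 / (K : ℝ)) * ∑ j, P.trainMarginal j y * r j y) / P.trainMarginal k y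

/-- `r_max`: the largest aggregated ratio, over nodes, labels, and all predictors. -/
def rMax (P : LabelShiftProblem K d X Y O Θ) : ℝ :=
  sSup {a | ∃ (θ : Fin K → Θ) (r : Fin K → Y → ℝ) (k : Fin K) (y : Y),
    (∀ j, P.IsVRLSRatio j (θ j) (r j)) ∧ a = P.aggregatedRatio r k y}

/-- The loss `w ↦ ℓ(h_w(x), y)` of one labelled sample `z = (x, y)`. -/
def sampleLoss (P : LabelShiftProblem K d X Y O Θ) (z : X × Y) (w : Vec d) : ℝ :=
  P.loss (P.hyp w z.1) z.2

/-- The IW-ERM objective: the average over the nodes of the importance-weighted training loss,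
where `r` are the ratios estimated by the nodes. -/
def iwRisk (P : LabelShiftProblem K d X Y O Θ) (r : Fin K → Y → ℝ) (w : Vec d) : ℝ :=
  (1 / (K : ℝ)) *
    ∑ k, ∫ z, P.aggregatedRatio r k z.2 * P.sampleLoss z w ∂(P.trainDist k)

/-- The stochastic gradient of node `k` at `w` on the sample `z = (x, y)`: the gradient in `w` of
the importance-weighted loss of that sample. -/
def stochGrad (P : LabelShiftProblem K d X Y O Θ) (r : Fin K → Y → ℝ)
    (k : Fin K) (z : X × Y) (w : Vec d) : Vec d :=
  P.aggregatedRatio r k z.2 • gradient (P.sampleLoss z) w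

/-- The assumptions on loss and stochastic gradients: `ℓ ∘ h_w` is `β`-smooth with gradients
bounded by `G`, and the stochastic gradients are unbiased with variance at most `σ²`. -/
structure SmoothBoundedNoise (P : LabelShiftProblem K d X Y O Θ) (r : Fin K → Y → ℝ)
    (β G σ : ℝ) : Prop where
  differentiable : ∀ z, Differentiable ℝ (P.sampleLoss z)
  smooth : ∀ z w w', ‖gradient (P.sampleLoss z) w - gradient (P.sampleLoss z) w'‖ ≤ β * ‖w - w'‖
  bounded_gradient : ∀ z w, ‖gradient (P.sampleLoss z) w‖ ≤ G
  unbiased : ∀ k w, ∫ z, P.stochGrad r k z w ∂(P.trainDist k) = gradient (P.iwRisk r) w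
  variance : ∀ k w,
    ∫ z, ‖P.stochGrad r k z w - gradient (P.iwRisk r) w‖ ^ 2 ∂(P.trainDist k) ≤ σ ^ 2

end LabelShiftProblem

/-- The adaptive matrix `A = diag(√a + ρ)` built from a vector `a` of second-moment estimates. -/
def adaptiveMatrix {d : ℕ} (ρ : ℝ) (a : Fin d → ℝ) : Matrix (Fin d) (Fin d) ℝ :=
  Matrix.diagonal fun i => √(a i) + ρ

/-- The adaptive matrix is bounded below by `ρ I`. -/
theorem adaptiveMatrix_sub_posSemidef {d : ℕ} (ρ : ℝ) (a : Fin d → ℝ) :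
    (adaptiveMatrix ρ a - ρ • (1 : Matrix (Fin d) (Fin d) ℝ)).PosSemidef := by
  have h : adaptiveMatrix ρ a - ρ • (1 : Matrix (Fin d) (Fin d) ℝ)
      = Matrix.diagonal fun i => √(a i) := by
    ext i j
    by_cases hij : i = j <;> simp [adaptiveMatrix, hij, Matrix.diagonal]
  rw [h]
  exact Matrix.PosSemidef.diagonal fun i => Real.sqrt_nonneg _

/-- What a node stores: current and previous iterate, momentum (gradient estimator),
coordinatewise second-moment estimate. -/
structure NodeState (d : ℕ) where
  x : Vec d
  xPrev : Vec d
  m : Vec d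
  v : Fin d → ℝ

/-- The nodes, together with the vector `a` that defines the adaptive matrix shared by all nodes
since the last communication. -/
structure FedState (K d : ℕ) where
  node : Fin K → NodeState d
  a : Fin d → ℝ

/-- One local update with one stochastic gradient sample, `g` being the stochastic gradient map
of that sample:
`m⁺ = g(x) + (1 - α) (m - g(xPrev))`, `v⁺ = β₂ v + (1 - β₂) g(x)²`, `x⁺ = x - η A⁻¹ m⁺`. -/
def localStep {d : ℕ} (ρ η α β₂ : ℝ) (a : Fin d → ℝ) (g : Vec d → Vec d) (s : NodeState d) :
    NodeState d where
  x := s.x - η • WithLp.toLp 2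
    ((adaptiveMatrix ρ a)⁻¹.mulVec (g s.x + (1 - α) • (s.m - g s.xPrev)).ofLp)
  xPrev := s.x
  m := g s.x + (1 - α) • (s.m - g s.xPrev)
  v := fun i => β₂ * s.v i + (1 - β₂) * (g s.x i) ^ 2

/-- One communication: the server averages iterates, momenta and second-moment estimates, sends
the averages back, and the averaged second-moment estimate defines the new adaptive matrix. -/
def communicate {K d : ℕ} (s : Fin K → NodeState d) : FedState K d where
  node := fun k =>
    { x := (1 / (K : ℝ)) • ∑ j, (s j).x
      xPrev := (s k).xPrev
      m := (1 / (K : ℝ)) • ∑ j, (s j).m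
      v := fun i => (1 / (K : ℝ)) * ∑ j, (s j).v i }
  a := fun i => (1 / (K : ℝ)) * ∑ j, (s j).v i

/-- The adaptive federated method after `t` local updates per node, started from `w₀`, with a
communication after every `τ` local updates. `g t k` is the stochastic gradient map of the
sample drawn by node `k` for its local update number `t`, so exactly one sample per node is used
per local update. -/
def fedRun {K d : ℕ} (ρ : ℝ) (τ : ℕ) (η α β₂ : ℕ → ℝ) (w₀ : Vec d)
    (g : ℕ → Fin K → Vec d → Vec d) : ℕ → FedState K d
  | 0 => { node := fun _ => { x := w₀, xPrev := w₀, m := 0, v := 0 }, a := 0 }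
  | t + 1 =>
    let s := fedRun ρ τ η α β₂ w₀ g t
    let s' : Fin K → NodeState d :=
      fun k => localStep ρ (η t) (α t) (β₂ t) s.a (g t k) (s.node k)
    if τ ∣ t + 1 then communicate s' else { node := s', a := s.a }

/-- The global model: the average of the iterates of the nodes. -/
def FedState.model {K d : ℕ} (s : FedState K d) : Vec d :=
  (1 / (K : ℝ)) • ∑ k, (s.node k).x

/-- The model `w_t` of IW-ERM with local adaptive updates after `t` stochastic gradients per node,
along the realisation `ξ` of the samples (`ξ t k` is sample number `t` of node `k`). -/
def LabelShiftProblem.iwModel {K d : ℕ} {X Y O Θ : Type*} [Fintype Y] [MeasurableSpace X]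
    [MeasurableSpace Y] (P : LabelShiftProblem K d X Y O Θ) (r : Fin K → Y → ℝ)
    (ρ : ℝ) (τ : ℕ) (η α β₂ : ℕ → ℝ) (w₀ : Vec d) (ξ : ℕ → Fin K → X × Y) (t : ℕ) : Vec d :=
  (fedRun ρ τ η α β₂ w₀ (fun n k => P.stochGrad r k (ξ n k)) t).model

/-- The samples `ξ t k` are mutually independent, and those of node `k` have law `trainDist k`. -/
structure IsSampleStream {K d : ℕ} {X Y O Θ Ω : Type*} [Fintype Y] [MeasurableSpace X]
    [MeasurableSpace Y] [MeasurableSpace Ω] (P : LabelShiftProblem K d X Y O Θ)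
    (Pr : Measure Ω) (ξ : ℕ → Fin K → Ω → X × Y) : Prop where
  measurable : ∀ t k, Measurable (ξ t k)
  law : ∀ t k, Pr.map (ξ t k) = P.trainDist k
  indep : iIndepFun (fun p : ℕ × Fin K => ξ p.1 p.2) Pr

end

/-! The first point is that the aggregated ratio $r_k$ has mean one under $P_k$
(`integral_aggregatedRatio`). Weighting by $r_k$ is therefore free in first-moment bounds: $\nabla
F$ is still $\beta$-Lipschitz and bounded by $G$. Second moments cost one factor $r_{\max}$, since
$r_k^2\le r_{\max}r_k$; hence the stochastic gradients are mean-square Lipschitz with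
$L=\beta\sqrt{r_{\max}}$. `LabelShiftProblem.fedProcess` packages this, and the rest is an analysis
of variance-reduced momentum with local steps for the abstract `FedProcess`.

The momentum error splits into $(1-\alpha)$ times the old error plus fresh noise (`newM_sub`). The
noise is orthogonal to the past and between nodes, so averaging divides its second moment by $K$
(`integral_nodeMean_noise_sq`, `errSq_succ`). Its size is $\alpha^2\sigma^2$ plus $L^2$ times the
squared last move, up to factors 2 (`integral_noiseAt_sq_le`). The spread of the nodes arises only
within a round, because all stochastic gradients have the same mean $\nabla F$. These facts form the
deterministic `RoundRecursion`. With $\eta=\rho/(8L\tau)$ the spreads can be absorbed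
(`sum_bounds`), and with $\alpha=1/(K\tau^2)$ the momentum error caused by movement is paid for by
the negative squared-step term of the descent inequality `descent_precond` (`sum_descent_le`).

The schedule has two phases. For $R_0$ rounds the step size is zero and $\alpha_t=1/(t+1)$, so the
averaged momentum becomes a mean of $K\tau R_0$ samples at $w_0$ (`errSq_initial`); the main phase
starts from this small error. With $\tau\sim 1/(K\varepsilon)$, $R_0\sim1/\varepsilon$ and
$R\sim\sqrt{r_{\max}}/\varepsilon^2$, the average of the preconditioned squared gradient is of order
$\varepsilon^2$ (`sum_precond_gradient_le`, `exists_round_numbers`).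

The preconditioner has no deterministic upper bound uniform in the problem, but its trace has
bounded expectation (`integral_sum_a_le`). A weighted arithmetic-geometric inequality then turns the
preconditioned bound into one on $\mathbb E\|\nabla F\|$ (`norm_le_precondForm`), and the gradient
changes little enough within a round to pass from all steps to the communicated models
(`sum_gradient_le`). -/

/-! ### Mean, mean square and spread over the nodes -/

section NodeStatistics

set_option linter.unusedSectionVars false

variable {E F : Type*} [NormedAddCommGroup E] [InnerProductSpace ℝ E]
  [NormedAddCommGroup F] [InnerProductSpace ℝ F] {K : ℕ}

/-- The average over the nodes. -/
noncomputable def nodeMean (f : Fin K → E) : E := (1 / (K : ℝ)) • ∑ k, f k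

/-- The mean square over the nodes. -/
noncomputable def nodeSq (f : Fin K → E) : ℝ := (1 / (K : ℝ)) * ∑ k, ‖f k‖ ^ 2

/-- The mean squared deviation from the average over the nodes. -/
noncomputable def nodeVar (f : Fin K → E) : ℝ := nodeSq fun k => f k - nodeMean f

theorem nodeMean_add (f g : Fin K → E) :
    nodeMean (fun k => f k + g k) = nodeMean f + nodeMean g := by
  simp [nodeMean, Finset.sum_add_distrib]

theorem nodeMean_sub (f g : Fin K → E) :
    nodeMean (fun k => f k - g k) = nodeMean f - nodeMean g := by
  simp [nodeMean, smul_sub]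

theorem nodeMean_smul (c : ℝ) (f : Fin K → E) :
    nodeMean (fun k => c • f k) = c • nodeMean f := by
  simp only [nodeMean, ← Finset.smul_sum]
  rw [smul_comm]

theorem nodeMean_const (hK : 0 < K) (c : E) : nodeMean (fun _ : Fin K => c) = c := by
  have : (K : ℝ) ≠ 0 := by positivity
  simp only [nodeMean, Finset.sum_const, Finset.card_univ, Fintype.card_fin, one_div]
  rw [← Nat.cast_smul_eq_nsmul ℝ, smul_smul, inv_mul_cancel₀ this, one_smul]

theorem nodeMean_map (φ : E →ₗ[ℝ] F) (f : Fin K → E) :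
    nodeMean (fun k => φ (f k)) = φ (nodeMean f) := by
  simp [nodeMean]

theorem nodeSq_nonneg (f : Fin K → E) : 0 ≤ nodeSq f := by
  unfold nodeSq; positivity

theorem nodeVar_nonneg (f : Fin K → E) : 0 ≤ nodeVar f := nodeSq_nonneg _

theorem sum_sub_nodeMean (f : Fin K → E) : ∑ k, (f k - nodeMean f) = 0 := by
  rcases Nat.eq_zero_or_pos K with rfl | hK
  · simp
  have hK' : (K : ℝ) ≠ 0 := by positivity
  rw [Finset.sum_sub_distrib, Finset.sum_const, Finset.card_univ, Fintype.card_fin,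
    ← Nat.cast_smul_eq_nsmul ℝ, nodeMean, smul_smul, mul_one_div_cancel hK', one_smul, sub_self]

/-- Bias-variance decomposition: the cross term vanishes because deviations from the mean sum to
zero. -/
theorem nodeSq_sub_const (hK : 0 < K) (f : Fin K → E) (c : E) :
    nodeSq (fun k => f k - c) = nodeVar f + ‖nodeMean f - c‖ ^ 2 := by
  have hK' : (K : ℝ) ≠ 0 := by positivity
  have h : ∀ k, ‖f k - c‖ ^ 2 = ‖f k - nodeMean f‖ ^ 2
      + 2 * inner ℝ (f k - nodeMean f) (nodeMean f - c) + ‖nodeMean f - c‖ ^ 2 := by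
    intro k
    rw [← norm_add_sq_real, sub_add_sub_cancel]
  simp only [nodeSq, nodeVar]
  rw [Finset.sum_congr rfl fun k _ => h k, Finset.sum_add_distrib, Finset.sum_add_distrib,
    ← Finset.mul_sum, ← sum_inner, sum_sub_nodeMean]
  simp
  field_simp

theorem nodeSq_eq (hK : 0 < K) (f : Fin K → E) : nodeSq f = nodeVar f + ‖nodeMean f‖ ^ 2 := by
  simpa using nodeSq_sub_const hK f 0

theorem nodeVar_le_nodeSq_sub (hK : 0 < K) (f : Fin K → E) (c : E) :
    nodeVar f ≤ nodeSq fun k => f k - c := by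
  rw [nodeSq_sub_const hK]; nlinarith [sq_nonneg ‖nodeMean f - c‖]

theorem nodeVar_le_nodeSq (hK : 0 < K) (f : Fin K → E) : nodeVar f ≤ nodeSq f := by
  simpa using nodeVar_le_nodeSq_sub hK f 0

theorem norm_nodeMean_sq_le_nodeSq (hK : 0 < K) (f : Fin K → E) : ‖nodeMean f‖ ^ 2 ≤ nodeSq f := by
  rw [nodeSq_eq hK]; linarith [nodeVar_nonneg f]

theorem nodeVar_const (hK : 0 < K) (c : E) : nodeVar (fun _ : Fin K => c) = 0 := by
  simp [nodeVar, nodeMean_const hK, nodeSq]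

theorem norm_add_sq_le_young (x y : E) {l : ℝ} (hl : 0 < l) :
    ‖x + y‖ ^ 2 ≤ (1 + l) * ‖x‖ ^ 2 + (1 + 1 / l) * ‖y‖ ^ 2 := by
  have h1 : ‖x + y‖ ^ 2 ≤ (‖x‖ + ‖y‖) ^ 2 := by
    gcongr; exact norm_add_le x y
  have h2 : 2 * ‖x‖ * ‖y‖ ≤ l * ‖x‖ ^ 2 + 1 / l * ‖y‖ ^ 2 := by
    have h3 : l * ‖x‖ ^ 2 + 1 / l * ‖y‖ ^ 2 - 2 * ‖x‖ * ‖y‖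
        = (1 / l) * (l * ‖x‖ - ‖y‖) ^ 2 := by
      field_simp; ring
    have h4 : 0 ≤ (1 / l) * (l * ‖x‖ - ‖y‖) ^ 2 := by positivity
    linarith
  nlinarith

theorem nodeSq_add_le (f g : Fin K → E) {l : ℝ} (hl : 0 < l) :
    nodeSq (fun k => f k + g k) ≤ (1 + l) * nodeSq f + (1 + 1 / l) * nodeSq g := by
  have h := Finset.sum_le_sum fun k (_ : k ∈ Finset.univ) => norm_add_sq_le_young (f k) (g k) hl
  rw [Finset.sum_add_distrib, ← Finset.mul_sum, ← Finset.mul_sum] at h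
  have := mul_le_mul_of_nonneg_left h (by positivity : 0 ≤ 1 / (K : ℝ))
  simp only [nodeSq]
  linarith

theorem nodeVar_add_le (f g : Fin K → E) {l : ℝ} (hl : 0 < l) :
    nodeVar (fun k => f k + g k) ≤ (1 + l) * nodeVar f + (1 + 1 / l) * nodeVar g := by
  simp only [nodeVar, nodeMean_add, add_sub_add_comm]
  exact nodeSq_add_le _ _ hl

theorem nodeSq_mono {f : Fin K → E} {g : Fin K → F} {c : ℝ} (h : ∀ k, ‖f k‖ ≤ c * ‖g k‖) :
    nodeSq f ≤ c ^ 2 * nodeSq g := by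
  have h1 : ∑ k, ‖f k‖ ^ 2 ≤ ∑ k, c ^ 2 * ‖g k‖ ^ 2 := by
    refine Finset.sum_le_sum fun k _ => ?_
    rw [← mul_pow]
    exact pow_le_pow_left₀ (norm_nonneg _) (h k) 2
  rw [← Finset.mul_sum] at h1
  have := mul_le_mul_of_nonneg_left h1 (by positivity : 0 ≤ 1 / (K : ℝ))
  simp only [nodeSq]
  linarith

theorem nodeSq_comp_sub_le {φ : E → F} {c : ℝ} (hφ : ∀ x y, ‖φ x - φ y‖ ≤ c * ‖x - y‖)
    (f : Fin K → E) :
    nodeSq (fun k => φ (f k) - φ (nodeMean f)) ≤ c ^ 2 * nodeVar f :=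
  nodeSq_mono fun k => hφ (f k) (nodeMean f)

theorem nodeVar_comp_le (hK : 0 < K) {φ : E → F} {c : ℝ}
    (hφ : ∀ x y, ‖φ x - φ y‖ ≤ c * ‖x - y‖) (f : Fin K → E) :
    nodeVar (fun k => φ (f k)) ≤ c ^ 2 * nodeVar f :=
  (nodeVar_le_nodeSq_sub hK _ (φ (nodeMean f))).trans (nodeSq_comp_sub_le hφ f)

theorem norm_nodeMean_comp_sub_sq_le (hK : 0 < K) {φ : E → F} {c : ℝ}
    (hφ : ∀ x y, ‖φ x - φ y‖ ≤ c * ‖x - y‖) (f : Fin K → E) :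
    ‖nodeMean (fun k => φ (f k)) - φ (nodeMean f)‖ ^ 2 ≤ c ^ 2 * nodeVar f := by
  refine le_trans ?_ (nodeSq_comp_sub_le hφ f)
  have := norm_nodeMean_sq_le_nodeSq hK fun k => φ (f k) - φ (nodeMean f)
  rwa [nodeMean_sub, nodeMean_const hK] at this

theorem sum_inner_sub_nodeMean (f g : Fin K → E) :
    ∑ k, inner ℝ (f k - nodeMean f) (g k - nodeMean g)
      = ∑ k, inner ℝ (f k - nodeMean f) (g k) := by
  simp only [inner_sub_right _ (g _), Finset.sum_sub_distrib]
  rw [← sum_inner, sum_sub_nodeMean]; simp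

/-- Since the deviations of `f` sum to zero, `g` need not be centred in the cross term. With `g` the
noise, each inner product then pairs a past quantity with the fresh noise of a single node and has
mean zero. -/
theorem nodeVar_smul_add_le (hK : 0 < K) (c : ℝ) (f g : Fin K → E) :
    nodeVar (fun k => c • f k + g k) ≤ c ^ 2 * nodeVar f
      + 2 * c * ((1 / (K : ℝ)) * ∑ k, inner ℝ (f k - nodeMean f) (g k)) + nodeSq g := by
  have h1 : ∀ k, ‖c • f k + g k - nodeMean (fun k => c • f k + g k)‖ ^ 2
      = c ^ 2 * ‖f k - nodeMean f‖ ^ 2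
        + 2 * c * inner ℝ (f k - nodeMean f) (g k - nodeMean g) + ‖g k - nodeMean g‖ ^ 2 := by
    intro k
    rw [nodeMean_add, nodeMean_smul, add_sub_add_comm, ← smul_sub, norm_add_sq_real, norm_smul,
      mul_pow, Real.norm_eq_abs, sq_abs, real_inner_smul_left]
    ring
  have h2 : nodeVar (fun k => c • f k + g k) = c ^ 2 * nodeVar f
      + 2 * c * ((1 / (K : ℝ)) * ∑ k, inner ℝ (f k - nodeMean f) (g k)) + nodeVar g := by
    rw [← sum_inner_sub_nodeMean]
    conv_lhs => rw [nodeVar, nodeSq]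
    rw [Finset.sum_congr rfl fun k _ => h1 k, Finset.sum_add_distrib, Finset.sum_add_distrib,
      ← Finset.mul_sum, ← Finset.mul_sum]
    simp only [nodeVar, nodeSq]
    ring
  linarith [nodeVar_le_nodeSq hK g]

end NodeStatistics

/-! ### The adaptive matrix and its quadratic form -/

section Preconditioner

variable {d : ℕ}

/-- Multiplication by the inverse of the adaptive matrix `diag(√a + ρ)`. -/
noncomputable def precond (ρ : ℝ) (a : Fin d → ℝ) : Vec d →ₗ[ℝ] Vec d where
  toFun v := WithLp.toLp 2 fun i => (√(a i) + ρ)⁻¹ * v i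
  map_add' u v := by ext i; simp [mul_add]
  map_smul' c v := by ext i; simp; ring

@[simp]
theorem precond_apply (ρ : ℝ) (a : Fin d → ℝ) (v : Vec d) (i : Fin d) :
    precond ρ a v i = (√(a i) + ρ)⁻¹ * v i := rfl

/-- The quadratic form of the inverse of the adaptive matrix. -/
noncomputable def precondForm (ρ : ℝ) (a : Fin d → ℝ) (v : Vec d) : ℝ :=
  ∑ i, (√(a i) + ρ)⁻¹ * v i ^ 2

variable {ρ : ℝ}

theorem inv_adaptiveMatrix_mulVec (hρ : 0 < ρ) (a : Fin d → ℝ) (v : Vec d) :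
    WithLp.toLp 2 ((adaptiveMatrix ρ a)⁻¹.mulVec v.ofLp) = precond ρ a v := by
  have hpos : ∀ i, √(a i) + ρ ≠ 0 := fun i => by positivity
  have h : (adaptiveMatrix ρ a)⁻¹ = Matrix.diagonal fun i => (√(a i) + ρ)⁻¹ := by
    refine Matrix.inv_eq_left_inv ?_
    rw [adaptiveMatrix, Matrix.diagonal_mul_diagonal, ← Matrix.diagonal_one]
    congr 1; funext i; exact inv_mul_cancel₀ (hpos i)
  ext i
  simp [h, Matrix.mulVec_diagonal]

theorem norm_precond_le (hρ : 0 < ρ) (a : Fin d → ℝ) (v : Vec d) :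
    ‖precond ρ a v‖ ≤ ρ⁻¹ * ‖v‖ := by
  refine abs_le_of_sq_le_sq' ?_ (by positivity) |>.2
  rw [mul_pow, EuclideanSpace.real_norm_sq_eq, EuclideanSpace.real_norm_sq_eq, Finset.mul_sum]
  refine Finset.sum_le_sum fun i _ => ?_
  rw [precond_apply, mul_pow]
  gcongr
  linarith [Real.sqrt_nonneg (a i)]

theorem norm_precond_sub_le (hρ : 0 < ρ) (a : Fin d → ℝ) (u v : Vec d) :
    ‖precond ρ a u - precond ρ a v‖ ≤ ρ⁻¹ * ‖u - v‖ := by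
  rw [← map_sub]; exact norm_precond_le hρ a _

theorem precondForm_nonneg (hρ : 0 < ρ) (a : Fin d → ℝ) (v : Vec d) : 0 ≤ precondForm ρ a v := by
  unfold precondForm; positivity

theorem precondForm_le (hρ : 0 < ρ) (a : Fin d → ℝ) (v : Vec d) :
    precondForm ρ a v ≤ ρ⁻¹ * ‖v‖ ^ 2 := by
  rw [precondForm, EuclideanSpace.real_norm_sq_eq, Finset.mul_sum]
  refine Finset.sum_le_sum fun i _ => ?_
  gcongr
  linarith [Real.sqrt_nonneg (a i)]

theorem mul_norm_precond_sq_le (hρ : 0 < ρ) (a : Fin d → ℝ) (v : Vec d) :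
    ρ * ‖precond ρ a v‖ ^ 2 ≤ precondForm ρ a v := by
  rw [precondForm, EuclideanSpace.real_norm_sq_eq, Finset.mul_sum]
  refine Finset.sum_le_sum fun i _ => ?_
  have h : 0 < √(a i) + ρ := by positivity
  have h' : ρ * (√(a i) + ρ)⁻¹ ≤ 1 := by
    rw [← div_eq_mul_inv, div_le_one h]; linarith [Real.sqrt_nonneg (a i)]
  rw [precond_apply]
  calc ρ * ((√(a i) + ρ)⁻¹ * v i) ^ 2
      = (ρ * (√(a i) + ρ)⁻¹) * ((√(a i) + ρ)⁻¹ * v i ^ 2) := by ring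
    _ ≤ 1 * ((√(a i) + ρ)⁻¹ * v i ^ 2) := by gcongr
    _ = _ := one_mul _

/-- Polarisation in the metric $A^{-1}$. It makes the descent inequality contain the true gradient,
the estimate and the estimation error separately, without any upper bound on $A$. -/
theorem inner_precond (a : Fin d → ℝ) (u v : Vec d) :
    2 * inner ℝ u (precond ρ a v)
      = precondForm ρ a u + precondForm ρ a v - precondForm ρ a (v - u) := by
  simp only [precondForm, PiLp.inner_apply, precond_apply, ← Finset.sum_add_distrib,
    ← Finset.sum_sub_distrib, Finset.mul_sum]
  refine Finset.sum_congr rfl fun i _ => ?_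
  simp
  ring

/-- The largest entry of $A$ is bounded through $\sqrt{a_i}\le(1+a_i)/2$ by an affine function of
the trace of `a`. This form survives taking expectations and does not depend on the dimension. -/
theorem norm_sq_le_mul_precondForm (hρ : 0 < ρ) (a : Fin d → ℝ) (ha : ∀ i, 0 ≤ a i) (v : Vec d) :
    ‖v‖ ^ 2 ≤ (ρ + (1 + ∑ i, a i) / 2) * precondForm ρ a v := by
  rw [precondForm, EuclideanSpace.real_norm_sq_eq, Finset.mul_sum]
  refine Finset.sum_le_sum fun i _ => ?_
  have h : 0 < √(a i) + ρ := by positivity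
  have h1 : a i ≤ ∑ i, a i := Finset.single_le_sum (fun j _ => ha j) (Finset.mem_univ i)
  have h2 : √(a i) ≤ (1 + a i) / 2 := by
    nlinarith [Real.sq_sqrt (ha i), sq_nonneg (√(a i) - 1)]
  have h3 : 1 ≤ (ρ + (1 + ∑ i, a i) / 2) * (√(a i) + ρ)⁻¹ := by
    rw [← div_eq_mul_inv, one_le_div h]; linarith
  nlinarith [sq_nonneg (v i)]

/-- The size of $A$ and the quadratic form are dependent random variables. Splitting their product
with a deterministic weight `δ` allows the two expectations to be taken separately. -/
theorem norm_le_precondForm (hρ : 0 < ρ) (a : Fin d → ℝ) (ha : ∀ i, 0 ≤ a i) (v : Vec d)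
    {δ : ℝ} (hδ : 0 < δ) :
    ‖v‖ ≤ 1 / 2 * (δ * (ρ + (1 + ∑ i, a i) / 2) + precondForm ρ a v / δ) := by
  set l := ρ + (1 + ∑ i, a i) / 2
  have hl : 0 < l := by
    have : 0 ≤ ∑ i, a i := Finset.sum_nonneg fun i _ => ha i
    positivity
  have h := norm_sq_le_mul_precondForm hρ a ha v
  have hf := precondForm_nonneg hρ a v
  refine abs_le_of_sq_le_sq' ?_ (by positivity) |>.2
  refine h.trans ?_
  have : l * precondForm ρ a v = (δ * l) * (precondForm ρ a v / δ) := by field_simp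
  rw [this]
  nlinarith [sq_nonneg (δ * l - precondForm ρ a v / δ)]

end Preconditioner

/-! ### Descent inequalities for a smooth objective -/

section Descent

variable {d : ℕ} {F : Vec d → ℝ} {F' : Vec d → Vec d}

/-- The mean value theorem on the segment suffices; it loses the usual factor 1/2 in front of `β`,
which is harmless here. -/
theorem descent_of_lipschitz_gradient {β : ℝ} (hβ : 0 ≤ β) (hF : ∀ w, HasGradientAt F (F' w) w)
    (hlip : ∀ u v, ‖F' u - F' v‖ ≤ β * ‖u - v‖) (u h : Vec d) :
    F (u + h) ≤ F u + inner ℝ (F' u) h + β * ‖h‖ ^ 2 := by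
  have hd : ∀ s : ℝ, HasDerivAt (fun s : ℝ => F (u + s • h)) (inner ℝ (F' (u + s • h)) h) s := by
    intro s
    have h1 : HasDerivAt (fun s : ℝ => u + s • h) h s := by
      simpa using ((hasDerivAt_id s).smul_const h).const_add u
    have h2 := (hF (u + s • h)).hasFDerivAt.comp_hasDerivAt s h1
    simpa [Function.comp_def] using h2
  obtain ⟨c, hc, hc'⟩ := exists_hasDerivAt_eq_slope (fun s : ℝ => F (u + s • h)) _
    (zero_lt_one) (fun s _ => (hd s).continuousAt.continuousWithinAt) fun s _ => hd s
  simp only [one_smul, zero_smul, add_zero, sub_zero, div_one] at hc'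
  have h2 : inner ℝ (F' (u + c • h)) h - inner ℝ (F' u) h ≤ β * ‖h‖ ^ 2 := by
    rw [← inner_sub_left]
    refine (real_inner_le_norm _ _).trans ?_
    have h3 := hlip (u + c • h) u
    rw [add_sub_cancel_left, norm_smul, Real.norm_eq_abs, abs_of_pos hc.1] at h3
    have h4 : β * (c * ‖h‖) ≤ β * ‖h‖ := by
      gcongr; nlinarith [hc.2, norm_nonneg h]
    nlinarith [norm_nonneg h]
  linarith

/-- One preconditioned step along a gradient estimate `m`. -/
theorem descent_precond {β ρ η : ℝ} (hβ : 0 ≤ β) (hρ : 0 < ρ) (hη : 0 ≤ η) (hηβ : 4 * β * η ≤ ρ)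
    (hF : ∀ w, HasGradientAt F (F' w) w) (hlip : ∀ u v, ‖F' u - F' v‖ ≤ β * ‖u - v‖)
    (a : Fin d → ℝ) (u m : Vec d) :
    F (u - η • precond ρ a m) ≤ F u - η / 2 * precondForm ρ a (F' u)
      - η * ρ / 4 * ‖precond ρ a m‖ ^ 2 + η / (2 * ρ) * ‖m - F' u‖ ^ 2 := by
  have h := descent_of_lipschitz_gradient hβ hF hlip u (-(η • precond ρ a m))
  rw [← sub_eq_add_neg, inner_neg_right, real_inner_smul_right, norm_neg, norm_smul, mul_pow,
    Real.norm_eq_abs, sq_abs] at h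
  have h1 := inner_precond (ρ := ρ) a (F' u) m
  have h2 := mul_le_mul_of_nonneg_left (precondForm_le hρ a (m - F' u)) hη
  have h3 := mul_le_mul_of_nonneg_left (mul_norm_precond_sq_le hρ a m) hη
  -- The polarised form supplies `-η * ρ / 2` times the squared direction. The curvature term uses
  -- half of it; the other half is kept to pay for the momentum error later.
  have h4 : β * (η ^ 2 * ‖precond ρ a m‖ ^ 2) ≤ η * ρ / 4 * ‖precond ρ a m‖ ^ 2 := by
    have : β * η ^ 2 ≤ η * ρ / 4 := by nlinarith
    nlinarith [sq_nonneg ‖precond ρ a m‖]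
  have h5 : η / (2 * ρ) * ‖m - F' u‖ ^ 2 = η * (ρ⁻¹ * ‖m - F' u‖ ^ 2) / 2 := by
    field_simp
  rw [h5]
  nlinarith

end Descent

/-! ### Bounded functions adapted to a σ-algebra -/

section BddMeasurable

/-- A bounded function that is measurable with respect to the σ-algebra `m`. -/
def BddMeasurable {Ω E : Type*} [NormedAddCommGroup E] [MeasurableSpace E]
    (m : MeasurableSpace Ω) (f : Ω → E) : Prop :=
  Measurable[m] f ∧ ∃ C, ∀ ω, ‖f ω‖ ≤ C

namespace BddMeasurable

variable {Ω : Type*} {m m' : MeasurableSpace Ω}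
  {E F E' : Type*} [NormedAddCommGroup E] [MeasurableSpace E] [BorelSpace E] [NormedSpace ℝ E]
  [FiniteDimensional ℝ E]
  [NormedAddCommGroup F] [MeasurableSpace F] [BorelSpace F] [NormedSpace ℝ F]
  [FiniteDimensional ℝ F]
  [NormedAddCommGroup E'] [MeasurableSpace E'] [BorelSpace E']

set_option linter.unusedSectionVars false

theorem mono {f : Ω → E} (hf : BddMeasurable m f) (h : m ≤ m') : BddMeasurable m' f :=
  ⟨hf.1.mono h le_rfl, hf.2⟩

theorem const (c : E) : BddMeasurable m fun _ : Ω => c :=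
  ⟨measurable_const, ‖c‖, fun _ => le_rfl⟩

/-- The range of `f` lies in a closed ball, which is compact in finite dimension, so a continuous
`φ` is bounded on it. -/
theorem comp {f : Ω → E} (hf : BddMeasurable m f) {φ : E → E'} (hφ : Continuous φ) :
    BddMeasurable m fun ω => φ (f ω) := by
  refine ⟨hφ.measurable.comp hf.1, ?_⟩
  obtain ⟨C, hC⟩ := hf.2
  have : ProperSpace E := FiniteDimensional.proper ℝ E
  obtain ⟨C', hC'⟩ := (isCompact_closedBall (0 : E) C).exists_bound_of_continuousOn
    hφ.continuousOn
  exact ⟨C', fun ω => hC' _ (by simpa using hC ω)⟩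

theorem prodMk {f : Ω → E} {g : Ω → F} (hf : BddMeasurable m f) (hg : BddMeasurable m g) :
    BddMeasurable m fun ω => (f ω, g ω) := by
  refine ⟨hf.1.prodMk hg.1, ?_⟩
  obtain ⟨C, hC⟩ := hf.2
  obtain ⟨C', hC'⟩ := hg.2
  exact ⟨max C C', fun ω => max_le_max (hC ω) (hC' ω)⟩

theorem comp₂ {f : Ω → E} {g : Ω → F} (hf : BddMeasurable m f) (hg : BddMeasurable m g)
    {φ : E × F → E'} (hφ : Continuous φ) : BddMeasurable m fun ω => φ (f ω, g ω) := by
  have := FiniteDimensional.proper ℝ E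
  have := FiniteDimensional.proper ℝ F
  exact (hf.prodMk hg).comp hφ

theorem add {f g : Ω → E} (hf : BddMeasurable m f) (hg : BddMeasurable m g) :
    BddMeasurable m fun ω => f ω + g ω := hf.comp₂ hg continuous_add

theorem sub {f g : Ω → E} (hf : BddMeasurable m f) (hg : BddMeasurable m g) :
    BddMeasurable m fun ω => f ω - g ω := hf.comp₂ hg continuous_sub

theorem const_smul {f : Ω → E} (hf : BddMeasurable m f) (c : ℝ) :
    BddMeasurable m fun ω => c • f ω := hf.comp (continuous_const_smul c)

theorem const_mul {f : Ω → ℝ} (hf : BddMeasurable m f) (c : ℝ) :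
    BddMeasurable m fun ω => c * f ω := hf.const_smul c

theorem norm {f : Ω → E} (hf : BddMeasurable m f) : BddMeasurable m fun ω => ‖f ω‖ :=
  hf.comp continuous_norm

theorem norm_sq {f : Ω → E} (hf : BddMeasurable m f) : BddMeasurable m fun ω => ‖f ω‖ ^ 2 :=
  hf.comp (continuous_norm.pow 2)

theorem sum {ι : Type*} {s : Finset ι} {f : ι → Ω → E} (hf : ∀ i ∈ s, BddMeasurable m (f i)) :
    BddMeasurable m fun ω => ∑ i ∈ s, f i ω := by
  classical
  induction s using Finset.induction_on with
  | empty => simpa using const (m := m) (0 : E)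
  | insert i s hi ih =>
    simp only [Finset.sum_insert hi]
    exact (hf i (Finset.mem_insert_self _ _)).add
      (ih fun j hj => hf j (Finset.mem_insert_of_mem hj))

theorem inner {E : Type*} [NormedAddCommGroup E] [InnerProductSpace ℝ E] [MeasurableSpace E]
    [BorelSpace E] [FiniteDimensional ℝ E] {f g : Ω → E} (hf : BddMeasurable m f)
    (hg : BddMeasurable m g) : BddMeasurable m fun ω => (Inner.inner ℝ (f ω) (g ω) : ℝ) :=
  hf.comp₂ hg (φ := fun p : E × E => (Inner.inner ℝ p.1 p.2 : ℝ)) continuous_inner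

theorem pi {ι : Type*} [Fintype ι] {f : ι → Ω → ℝ} (hf : ∀ i, BddMeasurable m (f i)) :
    BddMeasurable m fun ω i => f i ω := by
  refine ⟨measurable_pi_iff.2 fun i => (hf i).1, ?_⟩
  choose C hC using fun i => (hf i).2
  refine ⟨∑ i, |C i|, fun ω => (pi_norm_le_iff_of_nonneg (by positivity)).2 fun i => ?_⟩
  refine (hC i ω).trans ((le_abs_self _).trans ?_)
  exact Finset.single_le_sum (f := fun i => |C i|) (fun j _ => abs_nonneg _) (Finset.mem_univ i)

theorem integrable {mΩ : MeasurableSpace Ω} {μ : Measure Ω} [IsFiniteMeasure μ] {f : Ω → E}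
    (hf : BddMeasurable m f) (hm : m ≤ mΩ) : Integrable f μ := by
  obtain ⟨C, hC⟩ := hf.2
  have := FiniteDimensional.proper ℝ E
  exact Integrable.of_bound (hf.1.mono hm le_rfl).aestronglyMeasurable C
    (Filter.Eventually.of_forall hC)

section Node

variable {K : ℕ} {E : Type*} [NormedAddCommGroup E] [InnerProductSpace ℝ E] [MeasurableSpace E]
    [BorelSpace E] [FiniteDimensional ℝ E] {f : Fin K → Ω → E}

theorem nodeMean (hf : ∀ k, BddMeasurable m (f k)) :
    BddMeasurable m fun ω => nodeMean fun k => f k ω :=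
  (sum fun k _ => hf k).const_smul _

theorem nodeSq (hf : ∀ k, BddMeasurable m (f k)) :
    BddMeasurable m fun ω => nodeSq fun k => f k ω :=
  (sum fun k _ => (hf k).norm_sq).const_mul _

theorem nodeVar (hf : ∀ k, BddMeasurable m (f k)) :
    BddMeasurable m fun ω => nodeVar fun k => f k ω :=
  nodeSq fun k => (hf k).sub (nodeMean hf)

end Node

end BddMeasurable

end BddMeasurable

/-! ### Independence of a fresh sample from earlier samples -/

section Independence

variable {Ω 𝒵 ι : Type*} [MeasurableSpace 𝒵]

/-- The σ-algebra generated by the samples with index in `S`. -/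
abbrev sampleSigma (ξ : ι → Ω → 𝒵) (S : Set ι) : MeasurableSpace Ω :=
  ⨆ i ∈ S, MeasurableSpace.comap (ξ i) inferInstance

theorem sampleSigma_mono (ξ : ι → Ω → 𝒵) {S T : Set ι} (h : S ⊆ T) :
    sampleSigma ξ S ≤ sampleSigma ξ T := biSup_mono h

theorem measurable_sampleSigma (ξ : ι → Ω → 𝒵) {S : Set ι} {i : ι} (hi : i ∈ S) :
    Measurable[sampleSigma ξ S] (ξ i) :=
  Measurable.of_comap_le (le_biSup (fun i => MeasurableSpace.comap (ξ i) inferInstance) hi)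

variable [mΩ : MeasurableSpace Ω] {Pr : Measure Ω}

theorem sampleSigma_le {ξ : ι → Ω → 𝒵} (hξ : ∀ i, Measurable (ξ i)) (S : Set ι) :
    sampleSigma ξ S ≤ mΩ := iSup₂_le fun i _ => (hξ i).comap_le

/-- Samples indexed by disjoint sets generate independent σ-algebras. Arbitrary `S` is allowed
because orthogonality between nodes needs the past enlarged by one sample of the current step. -/
theorem indepFun_of_measurable_sampleSigma {ξ : ι → Ω → 𝒵} (hξ : ∀ i, Measurable (ξ i))
    (hind : iIndepFun ξ Pr) {S : Set ι} {i : ι} (hi : i ∉ S) {E : Type*} [MeasurableSpace E]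
    {Z : Ω → E} (hZ : Measurable[sampleSigma ξ S] Z) : IndepFun Z (ξ i) Pr := by
  rw [IndepFun_iff_Indep]
  have h := indep_iSup_of_disjoint (fun i => (hξ i).comap_le) hind.iIndep
    (Set.disjoint_singleton_right.2 hi)
  refine indep_of_indep_of_le_left (indep_of_indep_of_le_right h ?_) hZ.comap_le
  exact le_biSup (fun i => MeasurableSpace.comap (ξ i) inferInstance) (Set.mem_singleton i)

/-- Integrate out an independent sample first. -/
theorem integral_freeze [IsProbabilityMeasure Pr] {E : Type*} [MeasurableSpace E]
    {Z : Ω → E} {X : Ω → 𝒵} {μ : Measure 𝒵} (hZ : Measurable Z) (hX : Measurable X)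
    (hμ : Pr.map X = μ) (hind : IndepFun Z X Pr) {f : E × 𝒵 → ℝ} (hf : Measurable f)
    (hint : Integrable (fun ω => f (Z ω, X ω)) Pr) :
    ∫ ω, f (Z ω, X ω) ∂Pr = ∫ ω, ∫ z, f (Z ω, z) ∂μ ∂Pr := by
  have hmap := (indepFun_iff_map_prod_eq_prod_map_map hZ.aemeasurable hX.aemeasurable).1 hind
  have hpair : Measurable fun ω => (Z ω, X ω) := hZ.prodMk hX
  have hZp := Measure.isProbabilityMeasure_map (μ := Pr) hZ.aemeasurable
  have hXp := Measure.isProbabilityMeasure_map (μ := Pr) hX.aemeasurable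
  have h1 := integral_map (μ := Pr) hpair.aemeasurable (f := f) hf.aestronglyMeasurable
  have h2 : Integrable f ((Pr.map Z).prod (Pr.map X)) := by
    rw [← hmap]
    exact (integrable_map_measure hf.aestronglyMeasurable hpair.aemeasurable).2 hint
  rw [← h1, hmap, integral_prod _ h2, hμ]
  rw [hμ] at hXp
  exact integral_map hZ.aemeasurable
    (hf.stronglyMeasurable.integral_prod_right' (ν := μ)).aestronglyMeasurable

end Independence

/-! ### The abstract federated process -/

/-- A run of the adaptive federated method with independent samples and bounded, unbiased, mean
square Lipschitz stochastic gradients of a smooth objective. -/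
structure FedProcess (K d : ℕ) (𝒵 Ω : Type*) [MeasurableSpace 𝒵] [MeasurableSpace Ω] where
  ρ : ℝ
  τ : ℕ
  η : ℕ → ℝ
  α : ℕ → ℝ
  β₂ : ℕ → ℝ
  w₀ : Vec d
  g : Fin K → 𝒵 → Vec d → Vec d
  F : Vec d → ℝ
  F' : Vec d → Vec d
  μ : Fin K → Measure 𝒵
  Pr : Measure Ω
  ξ : ℕ → Fin K → Ω → 𝒵
  β : ℝ
  G : ℝ
  σ : ℝ
  L : ℝ
  K_pos : 0 < K
  ρ_pos : 0 < ρ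
  η_nonneg : ∀ t, 0 ≤ η t
  α_mem : ∀ t, α t ∈ Set.Icc (0 : ℝ) 1
  β₂_mem : ∀ t, β₂ t ∈ Set.Icc (0 : ℝ) 1
  β_nonneg : 0 ≤ β
  prob : IsProbabilityMeasure Pr
  prob_node : ∀ k, IsProbabilityMeasure (μ k)
  measurable_sample : ∀ t k, Measurable (ξ t k)
  law : ∀ t k, Pr.map (ξ t k) = μ k
  indep : iIndepFun (fun p : ℕ × Fin K => ξ p.1 p.2) Pr
  measurable_g : ∀ k, Measurable fun p : 𝒵 × Vec d => g k p.1 p.2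
  bounded_g : ∃ B, ∀ k z w, ‖g k z w‖ ≤ B
  hasGradient : ∀ w, HasGradientAt F (F' w) w
  lipschitz : ∀ u v, ‖F' u - F' v‖ ≤ β * ‖u - v‖
  norm_gradient_le : ∀ w, ‖F' w‖ ≤ G
  unbiased : ∀ k w, ∫ z, g k z w ∂μ k = F' w
  variance : ∀ k w, ∫ z, ‖g k z w - F' w‖ ^ 2 ∂μ k ≤ σ ^ 2
  meanSquareLipschitz : ∀ k u v, ∫ z, ‖g k z u - g k z v‖ ^ 2 ∂μ k ≤ L ^ 2 * ‖u - v‖ ^ 2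

namespace FedProcess

variable {K d : ℕ} {𝒵 Ω : Type*} [MeasurableSpace 𝒵] [mΩ : MeasurableSpace Ω]
  (P : FedProcess K d 𝒵 Ω)

/-- The state after `t` local updates. -/
noncomputable def state (t : ℕ) (ω : Ω) : FedState K d :=
  fedRun P.ρ P.τ P.η P.α P.β₂ P.w₀ (fun n k => P.g k (P.ξ n k ω)) t

/-- The iterate of node `k`. -/
noncomputable def x (t : ℕ) (k : Fin K) (ω : Ω) : Vec d := ((P.state t ω).node k).x

/-- The previous iterate of node `k`. -/
noncomputable def xPrev (t : ℕ) (k : Fin K) (ω : Ω) : Vec d := ((P.state t ω).node k).xPrev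

/-- The momentum of node `k`. -/
noncomputable def m (t : ℕ) (k : Fin K) (ω : Ω) : Vec d := ((P.state t ω).node k).m

/-- The second-moment estimate of node `k`. -/
noncomputable def v (t : ℕ) (k : Fin K) (ω : Ω) : Fin d → ℝ := ((P.state t ω).node k).v

/-- The vector defining the adaptive matrix. -/
noncomputable def a (t : ℕ) (ω : Ω) : Fin d → ℝ := (P.state t ω).a

/-- The stochastic gradient at the iterate of node `k`. -/
noncomputable def grad (t : ℕ) (k : Fin K) (ω : Ω) : Vec d := P.g k (P.ξ t k ω) (P.x t k ω)

/-- The momentum of node `k` after the local update, before communication. -/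
noncomputable def newM (t : ℕ) (k : Fin K) (ω : Ω) : Vec d :=
  P.grad t k ω + (1 - P.α t) • (P.m t k ω - P.g k (P.ξ t k ω) (P.xPrev t k ω))

/-- The second-moment estimate of node `k` after the local update, before communication. -/
noncomputable def newV (t : ℕ) (k : Fin K) (ω : Ω) : Fin d → ℝ := fun i =>
  P.β₂ t * P.v t k ω i + (1 - P.β₂ t) * (P.grad t k ω i) ^ 2

/-- The global model. -/
noncomputable def w (t : ℕ) (ω : Ω) : Vec d := nodeMean fun k => P.x t k ω

/-- The direction of the averaged update. -/
noncomputable def dir (t : ℕ) (ω : Ω) : Vec d :=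
  precond P.ρ (P.a t ω) (nodeMean fun k => P.newM t k ω)

/-- The error of the momentum of node `k`. -/
noncomputable def err (t : ℕ) (k : Fin K) (ω : Ω) : Vec d := P.m t k ω - P.F' (P.xPrev t k ω)

/-- The fresh noise in the momentum of node `k`. -/
noncomputable def noise (t : ℕ) (k : Fin K) (ω : Ω) : Vec d :=
  (P.grad t k ω - P.F' (P.x t k ω))
    - (1 - P.α t) • (P.g k (P.ξ t k ω) (P.xPrev t k ω) - P.F' (P.xPrev t k ω))

/-! ### Identities and inequalities along a single realisation -/

section Pathwise

variable (t : ℕ) (k : Fin K) (ω : Ω)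

theorem x_zero : P.x 0 k ω = P.w₀ := rfl
theorem xPrev_zero : P.xPrev 0 k ω = P.w₀ := rfl
theorem v_zero : P.v 0 k ω = 0 := rfl
theorem a_zero : P.a 0 ω = 0 := rfl

theorem local_x (s : FedState K d) (η α β₂ : ℝ) (g : Vec d → Vec d) :
    (localStep P.ρ η α β₂ s.a g (s.node k)).x
      = (s.node k).x - η • precond P.ρ s.a
        (g (s.node k).x + (1 - α) • ((s.node k).m - g (s.node k).xPrev)) := by
  rw [← inv_adaptiveMatrix_mulVec P.ρ_pos]; rfl

theorem x_succ (h : ¬ P.τ ∣ t + 1) :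
    P.x (t + 1) k ω = P.x t k ω - P.η t • precond P.ρ (P.a t ω) (P.newM t k ω) := by
  rw [x, state, fedRun, if_neg h]
  exact P.local_x k (P.state t ω) _ _ _ _

theorem x_succ_of_dvd (h : P.τ ∣ t + 1) :
    P.x (t + 1) k ω
      = nodeMean fun j => P.x t j ω - P.η t • precond P.ρ (P.a t ω) (P.newM t j ω) := by
  rw [x, state, fedRun, if_pos h, nodeMean]
  refine congrArg (fun y => (1 / (K : ℝ)) • y) (Finset.sum_congr rfl fun j _ => ?_)
  exact P.local_x j (P.state t ω) _ _ _ _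

theorem xPrev_succ : P.xPrev (t + 1) k ω = P.x t k ω := by
  by_cases h : P.τ ∣ t + 1
  · rw [xPrev, state, fedRun, if_pos h]; rfl
  · rw [xPrev, state, fedRun, if_neg h]; rfl

theorem m_succ (h : ¬ P.τ ∣ t + 1) : P.m (t + 1) k ω = P.newM t k ω := by
  rw [m, state, fedRun, if_neg h]; rfl

theorem m_succ_of_dvd (h : P.τ ∣ t + 1) :
    P.m (t + 1) k ω = nodeMean fun j => P.newM t j ω := by
  rw [m, state, fedRun, if_pos h]; rfl

theorem v_succ (h : ¬ P.τ ∣ t + 1) : P.v (t + 1) k ω = P.newV t k ω := by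
  rw [v, state, fedRun, if_neg h]; rfl

theorem v_succ_of_dvd (h : P.τ ∣ t + 1) :
    P.v (t + 1) k ω = fun i => (1 / (K : ℝ)) * ∑ j, P.newV t j ω i := by
  rw [v, state, fedRun, if_pos h]; rfl

theorem a_succ (h : ¬ P.τ ∣ t + 1) : P.a (t + 1) ω = P.a t ω := by
  rw [a, state, fedRun, if_neg h]; rfl

theorem a_succ_of_dvd (h : P.τ ∣ t + 1) :
    P.a (t + 1) ω = fun i => (1 / (K : ℝ)) * ∑ j, P.newV t j ω i := by
  rw [a, state, fedRun, if_pos h]; rfl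

theorem nodeMean_local_x :
    (nodeMean fun k => P.x t k ω - P.η t • precond P.ρ (P.a t ω) (P.newM t k ω))
      = P.w t ω - P.η t • P.dir t ω := by
  rw [nodeMean_sub, nodeMean_smul, nodeMean_map]; rfl

/-- The preconditioner is linear and common to all nodes, so it commutes with averaging, and
communication does not change the average. Hence the model makes one preconditioned step at every
local step. -/
theorem w_succ : P.w (t + 1) ω = P.w t ω - P.η t • P.dir t ω := by
  by_cases h : P.τ ∣ t + 1
  · rw [w]
    simp only [P.x_succ_of_dvd t _ ω h]
    rw [nodeMean_const P.K_pos, nodeMean_local_x]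
  · rw [w]
    simp only [P.x_succ t _ ω h]
    rw [nodeMean_local_x]

theorem x_eq_w_of_dvd (h : P.τ ∣ t) : P.x t k ω = P.w t ω := by
  rcases t with _ | t
  · rw [x_zero, w]
    simp only [x_zero]
    rw [nodeMean_const P.K_pos]
  · rw [w]
    simp only [P.x_succ_of_dvd t _ ω h]
    rw [nodeMean_const P.K_pos]

theorem nodeMean_m_succ :
    (nodeMean fun k => P.m (t + 1) k ω) = nodeMean fun k => P.newM t k ω := by
  by_cases h : P.τ ∣ t + 1
  · simp only [P.m_succ_of_dvd t _ ω h]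
    rw [nodeMean_const P.K_pos]
  · simp only [P.m_succ t _ ω h]

/-- Adding and subtracting the true gradient at both iterates separates a damped copy of the old
error from a term with conditional mean zero. -/
theorem newM_sub : P.newM t k ω - P.F' (P.x t k ω)
    = (1 - P.α t) • P.err t k ω + P.noise t k ω := by
  simp only [newM, err, noise, smul_sub]
  abel

theorem nodeMean_err_succ : (nodeMean fun k => P.err (t + 1) k ω)
    = (1 - P.α t) • (nodeMean fun k => P.err t k ω) + nodeMean fun k => P.noise t k ω := by
  rw [← nodeMean_smul, ← nodeMean_add]
  simp only [← newM_sub]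
  simp only [err, xPrev_succ]
  rw [nodeMean_sub, nodeMean_sub, nodeMean_m_succ]

theorem v_nonneg : ∀ t k ω i, 0 ≤ P.v t k ω i := by
  intro t
  induction t with
  | zero => intro k ω i; rw [v_zero]; exact le_rfl
  | succ t ih =>
    have hnew : ∀ k ω i, 0 ≤ P.newV t k ω i := fun k ω i => by
      have h1 := P.β₂_mem t
      exact add_nonneg (mul_nonneg h1.1 (ih k ω i))
        (mul_nonneg (by linarith [h1.2]) (sq_nonneg _))
    intro k ω i
    by_cases h : P.τ ∣ t + 1
    · rw [P.v_succ_of_dvd t k ω h]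
      exact mul_nonneg (by positivity) (Finset.sum_nonneg fun j _ => hnew j ω i)
    · rw [P.v_succ t k ω h]; exact hnew k ω i

theorem newV_nonneg (i : Fin d) : 0 ≤ P.newV t k ω i := by
  have h1 := P.β₂_mem t
  exact add_nonneg (mul_nonneg h1.1 (P.v_nonneg t k ω i))
    (mul_nonneg (by linarith [h1.2]) (sq_nonneg _))

theorem a_nonneg : ∀ t ω i, 0 ≤ P.a t ω i := by
  intro t
  induction t with
  | zero => intro ω i; rw [a_zero]; exact le_rfl
  | succ t ih =>
    intro ω i
    by_cases h : P.τ ∣ t + 1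
    · rw [P.a_succ_of_dvd t ω h]
      exact mul_nonneg (by positivity) (Finset.sum_nonneg fun j _ => P.newV_nonneg t j ω i)
    · rw [P.a_succ t ω h]; exact ih ω i

theorem sum_newV : ∑ i, P.newV t k ω i
    = P.β₂ t * ∑ i, P.v t k ω i + (1 - P.β₂ t) * ‖P.grad t k ω‖ ^ 2 := by
  simp only [newV]
  rw [Finset.sum_add_distrib, ← Finset.mul_sum, ← Finset.mul_sum, EuclideanSpace.real_norm_sq_eq]

theorem nodeVar_newM_le : (nodeVar fun k => P.newM t k ω)
    ≤ 2 * (nodeVar fun k => (1 - P.α t) • P.err t k ω + P.noise t k ω)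
      + 2 * P.β ^ 2 * nodeVar fun k => P.x t k ω := by
  have h1 : (fun k => P.newM t k ω)
      = fun k => ((1 - P.α t) • P.err t k ω + P.noise t k ω) + P.F' (P.x t k ω) := by
    funext k; rw [← newM_sub, sub_add_cancel]
  have h2 := nodeVar_add_le (fun k => (1 - P.α t) • P.err t k ω + P.noise t k ω)
    (fun k => P.F' (P.x t k ω)) one_pos
  have h3 := nodeVar_comp_le P.K_pos P.lipschitz (fun k => P.x t k ω)
  rw [h1]
  linarith

theorem nodeVar_err_succ (h : ¬ P.τ ∣ t + 1) : (nodeVar fun k => P.err (t + 1) k ω)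
    = nodeVar fun k => (1 - P.α t) • P.err t k ω + P.noise t k ω := by
  simp only [← newM_sub]
  simp only [err, xPrev_succ, P.m_succ t _ ω h]

/-- Communication makes the momenta equal but does not average `xPrev`, so the errors still differ
by the gradients at the old iterates. -/
theorem nodeVar_err_succ_of_dvd (h : P.τ ∣ t + 1) : (nodeVar fun k => P.err (t + 1) k ω)
    ≤ P.β ^ 2 * nodeVar fun k => P.x t k ω := by
  refine le_trans (le_of_eq ?_) (nodeVar_comp_le P.K_pos P.lipschitz (fun k => P.x t k ω))
  simp only [err, xPrev_succ, P.m_succ_of_dvd t _ ω h]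
  simp only [nodeVar]
  rw [nodeMean_sub, nodeMean_const P.K_pos]
  simp only [nodeSq, sub_sub_sub_cancel_left]
  simp only [norm_sub_rev]

theorem nodeSq_local_step_le :
    (nodeSq fun k => P.η t • precond P.ρ (P.a t ω) (P.newM t k ω))
      ≤ P.η t ^ 2 * ‖P.dir t ω‖ ^ 2
        + (P.η t / P.ρ) ^ 2 * nodeVar fun k => P.newM t k ω := by
  rw [nodeSq_eq P.K_pos, nodeMean_smul, nodeMean_map, norm_smul, mul_pow, Real.norm_eq_abs, sq_abs,
    add_comm]
  refine add_le_add le_rfl ?_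
  refine nodeVar_comp_le (φ := fun y => P.η t • precond P.ρ (P.a t ω) y) P.K_pos ?_ _
  intro u v
  rw [← smul_sub, norm_smul, Real.norm_eq_abs, abs_of_nonneg (P.η_nonneg t), div_eq_mul_inv,
    mul_assoc]
  exact mul_le_mul_of_nonneg_left (norm_precond_sub_le P.ρ_pos _ u v) (P.η_nonneg t)

theorem nodeSq_move_succ_le (h : ¬ P.τ ∣ t + 1) :
    (nodeSq fun k => P.x (t + 1) k ω - P.xPrev (t + 1) k ω)
      ≤ P.η t ^ 2 * ‖P.dir t ω‖ ^ 2
        + (P.η t / P.ρ) ^ 2 * nodeVar fun k => P.newM t k ω := by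
  refine le_trans (le_of_eq ?_) (P.nodeSq_local_step_le t ω)
  simp only [xPrev_succ, P.x_succ t _ ω h, sub_sub_cancel_left, nodeSq, norm_neg]

/-- At a communication each node jumps from its own iterate to the new average; bias-variance around
the old average separates the spread from the averaged step. -/
theorem nodeSq_move_succ_le_of_dvd (h : P.τ ∣ t + 1) :
    (nodeSq fun k => P.x (t + 1) k ω - P.xPrev (t + 1) k ω)
      ≤ P.η t ^ 2 * ‖P.dir t ω‖ ^ 2 + nodeVar fun k => P.x t k ω := by
  have h1 : (nodeSq fun k => P.x (t + 1) k ω - P.xPrev (t + 1) k ω)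
      = nodeSq fun k => P.x t k ω - (P.w t ω - P.η t • P.dir t ω) := by
    simp only [xPrev_succ, P.x_succ_of_dvd t _ ω h, nodeMean_local_x, nodeSq]
    simp only [norm_sub_rev]
  rw [h1, nodeSq_sub_const P.K_pos]
  have h2 : (nodeMean fun k => P.x t k ω) - (P.w t ω - P.η t • P.dir t ω) = P.η t • P.dir t ω :=
    sub_sub_cancel _ _
  rw [h2, norm_smul, mul_pow, Real.norm_eq_abs, sq_abs, add_comm]

theorem nodeVar_x_of_dvd (h : P.τ ∣ t) : (nodeVar fun k => P.x t k ω) = 0 := by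
  simp only [P.x_eq_w_of_dvd t _ ω h]
  exact nodeVar_const P.K_pos _

theorem nodeVar_x_succ_le (h : ¬ P.τ ∣ t + 1) {l : ℝ} (hl : 0 < l) :
    (nodeVar fun k => P.x (t + 1) k ω) ≤ (1 + l) * (nodeVar fun k => P.x t k ω)
      + (1 + 1 / l) * ((P.η t / P.ρ) ^ 2 * nodeVar fun k => P.newM t k ω) := by
  simp only [P.x_succ t _ ω h, sub_eq_add_neg]
  refine (nodeVar_add_le _ _ hl).trans (add_le_add le_rfl ?_)
  refine mul_le_mul_of_nonneg_left ?_ (by positivity)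
  refine nodeVar_comp_le (φ := fun y => -(P.η t • precond P.ρ (P.a t ω) y)) P.K_pos ?_ _
  intro u v
  rw [neg_sub_neg, norm_sub_rev, ← smul_sub, norm_smul, Real.norm_eq_abs,
    abs_of_nonneg (P.η_nonneg t), div_eq_mul_inv, mul_assoc]
  exact mul_le_mul_of_nonneg_left (norm_precond_sub_le P.ρ_pos _ u v) (P.η_nonneg t)

/-- The averaged error compares the momentum with the mean of the node gradients, whereas descent
needs the gradient at the mean iterate. By smoothness the difference is controlled by the spread of
the iterates. -/
theorem norm_nodeMean_newM_sub_sq_le :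
    ‖(nodeMean fun k => P.newM t k ω) - P.F' (P.w t ω)‖ ^ 2
      ≤ 2 * ‖nodeMean fun k => P.err (t + 1) k ω‖ ^ 2
        + 2 * (P.β ^ 2 * nodeVar fun k => P.x t k ω) := by
  have h1 : (nodeMean fun k => P.err (t + 1) k ω)
      = (nodeMean fun k => P.newM t k ω) - nodeMean fun k => P.F' (P.x t k ω) := by
    simp only [err, xPrev_succ]
    rw [nodeMean_sub, nodeMean_m_succ]
  have h2 := norm_add_sq_le_young (nodeMean fun k => P.err (t + 1) k ω)
    ((nodeMean fun k => P.F' (P.x t k ω)) - P.F' (P.w t ω)) one_pos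
  have h3 := norm_nodeMean_comp_sub_sq_le P.K_pos P.lipschitz (fun k => P.x t k ω)
  rw [h1, sub_add_sub_cancel, ← h1] at h2
  refine h2.trans ?_
  have h4 : ‖(nodeMean fun k => P.F' (P.x t k ω)) - P.F' (P.w t ω)‖ ^ 2
    ≤ P.β ^ 2 * nodeVar fun k => P.x t k ω := h3
  linarith

theorem F_w_succ_le (hη : 4 * P.β * P.η t ≤ P.ρ) :
    P.F (P.w (t + 1) ω) ≤ P.F (P.w t ω)
      - P.η t / 2 * precondForm P.ρ (P.a t ω) (P.F' (P.w t ω))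
      - P.η t * P.ρ / 4 * ‖P.dir t ω‖ ^ 2
      + P.η t / P.ρ * (‖nodeMean fun k => P.err (t + 1) k ω‖ ^ 2
        + P.β ^ 2 * nodeVar fun k => P.x t k ω) := by
  rw [w_succ]
  have h1 := descent_precond P.β_nonneg P.ρ_pos (P.η_nonneg t) hη P.hasGradient P.lipschitz
    (P.a t ω) (P.w t ω) (nodeMean fun k => P.newM t k ω)
  have h0 : 0 ≤ P.η t / (2 * P.ρ) := div_nonneg (P.η_nonneg t) (by linarith [P.ρ_pos])
  have h2 := mul_le_mul_of_nonneg_left (P.norm_nodeMean_newM_sub_sq_le t ω) h0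
  refine h1.trans ?_
  have h3 : P.η t / (2 * P.ρ) * (2 * ‖nodeMean fun k => P.err (t + 1) k ω‖ ^ 2
        + 2 * (P.β ^ 2 * nodeVar fun k => P.x t k ω))
      = P.η t / P.ρ * (‖nodeMean fun k => P.err (t + 1) k ω‖ ^ 2
        + P.β ^ 2 * nodeVar fun k => P.x t k ω) := by
    have := P.ρ_pos.ne'
    field_simp
  rw [← h3]
  exact add_le_add le_rfl h2

theorem norm_gradient_succ_le : ‖P.F' (P.w (t + 1) ω)‖
    ≤ ‖P.F' (P.w t ω)‖ + P.β * P.η t * ‖P.dir t ω‖ := by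
  have h1 := P.lipschitz (P.w (t + 1) ω) (P.w t ω)
  have h2 : P.w (t + 1) ω - P.w t ω = -(P.η t • P.dir t ω) := by rw [w_succ]; abel
  rw [h2, norm_neg, norm_smul, Real.norm_eq_abs, abs_of_nonneg (P.η_nonneg t), ← mul_assoc] at h1
  have h3 := norm_le_norm_add_norm_sub' (P.F' (P.w (t + 1) ω)) (P.F' (P.w t ω))
  linarith

end Pathwise

end FedProcess

/-! ### Adaptedness and integrability of the process -/

theorem continuous_precond {d : ℕ} {ρ : ℝ} (hρ : 0 < ρ) :
    Continuous fun p : (Fin d → ℝ) × Vec d => precond ρ p.1 p.2 := by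
  refine (PiLp.continuous_toLp 2 _).comp (continuous_pi fun i => ?_)
  have h : ∀ p : (Fin d → ℝ) × Vec d, √(p.1 i) + ρ ≠ 0 := fun p => by positivity
  have h2 : Continuous fun p : (Fin d → ℝ) × Vec d => p.2 i := by fun_prop
  refine Continuous.mul (Continuous.inv₀ ?_ h) h2
  fun_prop

theorem continuous_precondForm {d : ℕ} {ρ : ℝ} (hρ : 0 < ρ) :
    Continuous fun p : (Fin d → ℝ) × Vec d => precondForm ρ p.1 p.2 := by
  refine continuous_finsetSum _ fun i _ => ?_
  have h : ∀ p : (Fin d → ℝ) × Vec d, √(p.1 i) + ρ ≠ 0 := fun p => by positivity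
  have h2 : Continuous fun p : (Fin d → ℝ) × Vec d => p.2 i ^ 2 := by fun_prop
  refine Continuous.mul (Continuous.inv₀ ?_ h) h2
  fun_prop

theorem integral_norm_sub_integral_sq {𝒵 E : Type*} [MeasurableSpace 𝒵] {μ : Measure 𝒵}
    [IsProbabilityMeasure μ] [NormedAddCommGroup E] [InnerProductSpace ℝ E] [CompleteSpace E]
    {f : 𝒵 → E} (hf : Integrable f μ) (hf2 : Integrable (fun z => ‖f z‖ ^ 2) μ) :
    ∫ z, ‖f z - ∫ z, f z ∂μ‖ ^ 2 ∂μ = ∫ z, ‖f z‖ ^ 2 ∂μ - ‖∫ z, f z ∂μ‖ ^ 2 := by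
  set c := ∫ z, f z ∂μ with hc
  have h1 : ∀ z, ‖f z - c‖ ^ 2 = ‖f z‖ ^ 2 - 2 * inner ℝ c (f z) + ‖c‖ ^ 2 := fun z => by
    rw [norm_sub_sq_real, real_inner_comm]
  have h2 : Integrable (fun z => 2 * (inner ℝ c (f z) : ℝ)) μ := (hf.const_inner c).const_mul 2
  simp only [h1]
  have h3 : Integrable (fun z => ‖f z‖ ^ 2 - 2 * (inner ℝ c (f z) : ℝ)) μ := hf2.sub h2
  rw [integral_add h3 (integrable_const _), integral_sub hf2 h2, integral_const_mul,
    integral_inner hf, ← hc, real_inner_self_eq_norm_sq]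
  simp
  ring

namespace FedProcess

variable {K d : ℕ} {𝒵 Ω : Type*} [MeasurableSpace 𝒵] [mΩ : MeasurableSpace Ω]
  (P : FedProcess K d 𝒵 Ω)

instance : IsProbabilityMeasure P.Pr := P.prob
instance (k : Fin K) : IsProbabilityMeasure (P.μ k) := P.prob_node k

/-- The σ-algebra of a set of samples. -/
abbrev sigma (S : Set (ℕ × Fin K)) : MeasurableSpace Ω :=
  sampleSigma (fun p : ℕ × Fin K => P.ξ p.1 p.2) S

/-- The σ-algebra of the samples of the first `t` local updates. -/
abbrev past (t : ℕ) : MeasurableSpace Ω := P.sigma {p | p.1 < t}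

theorem sigma_le (S : Set (ℕ × Fin K)) : P.sigma S ≤ mΩ :=
  sampleSigma_le (ξ := fun p : ℕ × Fin K => P.ξ p.1 p.2) (fun p => P.measurable_sample p.1 p.2) S

theorem continuous_F' : Continuous P.F' :=
  (LipschitzWith.of_dist_le_mul (K := ⟨P.β, P.β_nonneg⟩) fun u v => by
    rw [dist_eq_norm, dist_eq_norm]; exact P.lipschitz u v).continuous

theorem continuous_F : Continuous P.F :=
  continuous_iff_continuousAt.2 fun w => (P.hasGradient w).continuousAt

theorem bdd_g {S : Set (ℕ × Fin K)} {t : ℕ} {k : Fin K} (hξ : Measurable[P.sigma S] (P.ξ t k))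
    {Z : Ω → Vec d} (hZ : BddMeasurable (P.sigma S) Z) :
    BddMeasurable (P.sigma S) fun ω => P.g k (P.ξ t k ω) (Z ω) := by
  obtain ⟨B, hB⟩ := P.bounded_g
  exact ⟨(P.measurable_g k).comp (hξ.prodMk hZ.1), B, fun ω => hB _ _ _⟩

theorem bdd_state_succ_aux {t : ℕ} {S : Set (ℕ × Fin K)}
    (hx : ∀ k, BddMeasurable (P.sigma S) (P.x t k)) (hp : ∀ k, BddMeasurable (P.sigma S) (P.xPrev t k))
    (hm : ∀ k, BddMeasurable (P.sigma S) (P.m t k)) (hv : ∀ k, BddMeasurable (P.sigma S) (P.v t k))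
    {k : Fin K} (hξ : Measurable[P.sigma S] (P.ξ t k)) :
    BddMeasurable (P.sigma S) (P.grad t k) ∧ BddMeasurable (P.sigma S) (P.newM t k) ∧ BddMeasurable (P.sigma S) (P.newV t k) := by
  have hg : BddMeasurable (P.sigma S) (P.grad t k) := P.bdd_g hξ (hx k)
  refine ⟨hg, hg.add (((hm k).sub (P.bdd_g hξ (hp k))).const_smul _), ?_⟩
  refine BddMeasurable.pi fun i => ?_
  have h1 : BddMeasurable (P.sigma S) fun ω => P.v t k ω i := (hv k).comp (continuous_apply i)
  have h2 : BddMeasurable (P.sigma S) fun ω => (P.grad t k ω i) ^ 2 :=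
    hg.comp (φ := fun y : Vec d => (y i) ^ 2) (by fun_prop)
  exact (h1.const_mul _).add (h2.const_mul _)

theorem bdd_precond {S : Set (ℕ × Fin K)} {a : Ω → Fin d → ℝ} {y : Ω → Vec d}
    (ha : BddMeasurable (P.sigma S) a) (hy : BddMeasurable (P.sigma S) y) :
    BddMeasurable (P.sigma S) fun ω => precond P.ρ (a ω) (y ω) :=
  ha.comp₂ hy (continuous_precond P.ρ_pos)

theorem measurable_past_succ (t : ℕ) (k : Fin K) : Measurable[P.past (t + 1)] (P.ξ t k) :=
  measurable_sampleSigma (fun p : ℕ × Fin K => P.ξ p.1 p.2) (i := (t, k)) (Nat.lt_succ_self t)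

theorem past_mono (t : ℕ) : P.past t ≤ P.past (t + 1) :=
  sampleSigma_mono _ fun _ hp => Nat.lt_succ_of_lt hp

/-- Bounded stochastic gradients keep every state bounded at each fixed time, by a constant that may
grow with `t`. This constant enters no rate; it only makes all expectations exist, while adaptedness
gives independence of the next samples. -/
theorem bdd_state (t : ℕ) :
    (∀ k, BddMeasurable (P.past t) (P.x t k)) ∧ (∀ k, BddMeasurable (P.past t) (P.xPrev t k)) ∧
    (∀ k, BddMeasurable (P.past t) (P.m t k)) ∧ (∀ k, BddMeasurable (P.past t) (P.v t k)) ∧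
    BddMeasurable (P.past t) (P.a t) := by
  induction t with
  | zero =>
    exact ⟨fun _ => .const _, fun _ => .const _, fun _ => .const _, fun _ => .const _, .const _⟩
  | succ t ih =>
    obtain ⟨hx, hp, hm, hv, ha⟩ := ih
    replace hx := fun k => (hx k).mono (P.past_mono t)
    replace hp := fun k => (hp k).mono (P.past_mono t)
    replace hm := fun k => (hm k).mono (P.past_mono t)
    replace hv := fun k => (hv k).mono (P.past_mono t)
    replace ha := ha.mono (P.past_mono t)
    have hnew := fun k => P.bdd_state_succ_aux hx hp hm hv (P.measurable_past_succ t k)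
    have hloc : ∀ k, BddMeasurable (P.past (t + 1))
        fun ω => P.x t k ω - P.η t • precond P.ρ (P.a t ω) (P.newM t k ω) := fun k =>
      (hx k).sub ((P.bdd_precond ha (hnew k).2.1).const_smul _)
    have hav : BddMeasurable (P.past (t + 1))
        fun ω i => (1 / (K : ℝ)) * ∑ j, P.newV t j ω i :=
      BddMeasurable.pi fun i => (BddMeasurable.sum fun j _ =>
        (hnew j).2.2.comp (continuous_apply i)).const_mul _
    refine ⟨fun k => ?_, fun k => ?_, fun k => ?_, fun k => ?_, ?_⟩
    · by_cases h : P.τ ∣ t + 1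
      · rw [funext fun ω => P.x_succ_of_dvd t k ω h]; exact BddMeasurable.nodeMean hloc
      · rw [funext fun ω => P.x_succ t k ω h]; exact hloc k
    · rw [funext fun ω => P.xPrev_succ t k ω]; exact hx k
    · by_cases h : P.τ ∣ t + 1
      · rw [funext fun ω => P.m_succ_of_dvd t k ω h]
        exact BddMeasurable.nodeMean fun k => (hnew k).2.1
      · rw [funext fun ω => P.m_succ t k ω h]; exact (hnew k).2.1
    · by_cases h : P.τ ∣ t + 1
      · rw [funext fun ω => P.v_succ_of_dvd t k ω h]; exact hav
      · rw [funext fun ω => P.v_succ t k ω h]; exact (hnew k).2.2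
    · by_cases h : P.τ ∣ t + 1
      · rw [funext fun ω => P.a_succ_of_dvd t ω h]; exact hav
      · rw [funext fun ω => P.a_succ t ω h]; exact ha

section Bdd

variable (t : ℕ) (k : Fin K)

theorem bdd_x : BddMeasurable (P.past t) (P.x t k) := (P.bdd_state t).1 k
theorem bdd_xPrev : BddMeasurable (P.past t) (P.xPrev t k) := (P.bdd_state t).2.1 k
theorem bdd_m : BddMeasurable (P.past t) (P.m t k) := (P.bdd_state t).2.2.1 k
theorem bdd_v : BddMeasurable (P.past t) (P.v t k) := (P.bdd_state t).2.2.2.1 k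
theorem bdd_a : BddMeasurable (P.past t) (P.a t) := (P.bdd_state t).2.2.2.2
theorem bdd_w : BddMeasurable (P.past t) (P.w t) := BddMeasurable.nodeMean (P.bdd_x t)

theorem bdd_err : BddMeasurable (P.past t) (P.err t k) :=
  (P.bdd_m t k).sub ((P.bdd_xPrev t k).comp P.continuous_F')

theorem bdd_new : BddMeasurable (P.past (t + 1)) (P.grad t k) ∧
    BddMeasurable (P.past (t + 1)) (P.newM t k) ∧ BddMeasurable (P.past (t + 1)) (P.newV t k) :=
  P.bdd_state_succ_aux (fun k => (P.bdd_x t k).mono (P.past_mono t))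
    (fun k => (P.bdd_xPrev t k).mono (P.past_mono t)) (fun k => (P.bdd_m t k).mono (P.past_mono t))
    (fun k => (P.bdd_v t k).mono (P.past_mono t)) (P.measurable_past_succ t k)

theorem bdd_dir : BddMeasurable (P.past (t + 1)) (P.dir t) :=
  P.bdd_precond ((P.bdd_a t).mono (P.past_mono t))
    (BddMeasurable.nodeMean fun k => (P.bdd_new t k).2.1)

theorem bdd_noise {S : Set (ℕ × Fin K)} (hm : P.past t ≤ P.sigma S)
    (hξ : Measurable[P.sigma S] (P.ξ t k)) : BddMeasurable (P.sigma S) (P.noise t k) := by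
  have hx := (P.bdd_x t k).mono hm
  have hp := (P.bdd_xPrev t k).mono hm
  exact ((P.bdd_g hξ hx).sub (hx.comp P.continuous_F')).sub
    (((P.bdd_g hξ hp).sub (hp.comp P.continuous_F')).const_smul _)

theorem bdd_noise' : BddMeasurable (P.past (t + 1)) (P.noise t k) :=
  P.bdd_noise t k (P.past_mono t) (P.measurable_past_succ t k)

theorem bdd_gradient : BddMeasurable (P.past t) fun ω => P.F' (P.w t ω) :=
  (P.bdd_w t).comp P.continuous_F'

theorem bdd_form : BddMeasurable (P.past t)
    fun ω => precondForm P.ρ (P.a t ω) (P.F' (P.w t ω)) :=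
  (P.bdd_a t).comp₂ (P.bdd_gradient t) (continuous_precondForm P.ρ_pos)

end Bdd

theorem integrable_of_bdd {E : Type*} [NormedAddCommGroup E] [NormedSpace ℝ E]
    [FiniteDimensional ℝ E] [MeasurableSpace E] [BorelSpace E] {S : Set (ℕ × Fin K)} {f : Ω → E}
    (hf : BddMeasurable (P.sigma S) f) : Integrable f P.Pr :=
  hf.integrable (P.sigma_le S)

/-! ### Moments of one sample at frozen iterates -/

section Sample

variable (k : Fin K)

theorem integrable_g (u : Vec d) : Integrable (fun z => P.g k z u) (P.μ k) := by
  obtain ⟨B, hB⟩ := P.bounded_g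
  exact Integrable.of_bound
    ((P.measurable_g k).comp (measurable_id.prodMk measurable_const)).aestronglyMeasurable B
    (Filter.Eventually.of_forall fun z => hB k z u)

theorem integrable_norm_sq {f : 𝒵 → Vec d} (hf : Measurable f) {C : ℝ} (hC : ∀ z, ‖f z‖ ≤ C) :
    Integrable (fun z => ‖f z‖ ^ 2) (P.μ k) := by
  refine Integrable.of_bound (hf.norm.pow_const 2).aestronglyMeasurable (C ^ 2)
    (Filter.Eventually.of_forall fun z => ?_)
  rw [Real.norm_eq_abs, abs_of_nonneg (sq_nonneg _)]
  exact pow_le_pow_left₀ (norm_nonneg _) (hC z) 2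

theorem measurable_g_const (u : Vec d) : Measurable fun z => P.g k z u :=
  (P.measurable_g k).comp (measurable_id.prodMk measurable_const)

theorem integral_norm_g_sq_le (u : Vec d) :
    ∫ z, ‖P.g k z u‖ ^ 2 ∂P.μ k ≤ P.σ ^ 2 + P.G ^ 2 := by
  obtain ⟨B, hB⟩ := P.bounded_g
  have h := integral_norm_sub_integral_sq (P.integrable_g k u)
    (P.integrable_norm_sq k (P.measurable_g_const k u) fun z => hB k z u)
  rw [P.unbiased] at h
  have h1 := P.variance k u
  have h2 := pow_le_pow_left₀ (norm_nonneg _) (P.norm_gradient_le u) 2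
  linarith

/-- The noise of node `k` as a function of the iterates and the sample. -/
noncomputable def noiseAt (α : ℝ) (u v : Vec d) (z : 𝒵) : Vec d :=
  (P.g k z u - P.F' u) - (1 - α) • (P.g k z v - P.F' v)

theorem integrable_noiseAt (α : ℝ) (u v : Vec d) :
    Integrable (P.noiseAt k α u v) (P.μ k) :=
  ((P.integrable_g k u).sub (integrable_const _)).sub
    (((P.integrable_g k v).sub (integrable_const _)).smul (1 - α))

theorem integral_noiseAt (α : ℝ) (u v : Vec d) : ∫ z, P.noiseAt k α u v z ∂P.μ k = 0 := by
  have h : ∀ u, ∫ z, (P.g k z u - P.F' u) ∂P.μ k = 0 := fun u => by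
    rw [integral_sub (P.integrable_g k u) (integrable_const _), P.unbiased]; simp
  have h1 : ∀ u, Integrable (fun z => P.g k z u - P.F' u) (P.μ k) := fun u =>
    (P.integrable_g k u).sub (integrable_const _)
  simp only [noiseAt]
  have h2 : Integrable (fun z => (1 - α) • (P.g k z v - P.F' v)) (P.μ k) := (h1 v).smul (1 - α)
  rw [integral_sub (h1 u) h2, integral_smul, h, h]
  simp

/-- The noise is `α` times the centred gradient at `u` plus `1 - α` times the centred gradient
difference. The variance bound handles the first; for the second, centring only lowers the second
moment, so the mean-square Lipschitz bound applies. -/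
theorem integral_noiseAt_sq_le {α : ℝ} (hα : α ∈ Set.Icc (0 : ℝ) 1) (u v : Vec d) :
    ∫ z, ‖P.noiseAt k α u v z‖ ^ 2 ∂P.μ k ≤ 2 * α ^ 2 * P.σ ^ 2 + 2 * P.L ^ 2 * ‖u - v‖ ^ 2 := by
  obtain ⟨B, hB⟩ := P.bounded_g
  have hmu := P.measurable_g_const k u
  have hmv := P.measurable_g_const k v
  have i1 : Integrable (fun z => ‖P.g k z u - P.F' u‖ ^ 2) (P.μ k) :=
    P.integrable_norm_sq k (hmu.sub measurable_const) (C := B + ‖P.F' u‖) fun z =>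
      (norm_sub_le _ _).trans (add_le_add (hB k z u) le_rfl)
  have hd : Measurable fun z => P.g k z u - P.g k z v := hmu.sub hmv
  have hdB : ∀ z, ‖P.g k z u - P.g k z v‖ ≤ B + B := fun z =>
      (norm_sub_le _ _).trans (add_le_add (hB k z u) (hB k z v))
  have i2 : Integrable (fun z => ‖P.g k z u - P.g k z v - (P.F' u - P.F' v)‖ ^ 2) (P.μ k) :=
    P.integrable_norm_sq k (hd.sub measurable_const) (C := B + B + ‖P.F' u - P.F' v‖) fun z =>
      (norm_sub_le _ _).trans (add_le_add (hdB z) le_rfl)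
  have hdiff : ∫ z, ‖P.g k z u - P.g k z v - (P.F' u - P.F' v)‖ ^ 2 ∂P.μ k
      ≤ P.L ^ 2 * ‖u - v‖ ^ 2 := by
    have hI : ∫ z, (P.g k z u - P.g k z v) ∂P.μ k = P.F' u - P.F' v := by
      rw [integral_sub (P.integrable_g k u) (P.integrable_g k v), P.unbiased, P.unbiased]
    have h := integral_norm_sub_integral_sq ((P.integrable_g k u).sub (P.integrable_g k v))
      (P.integrable_norm_sq k hd hdB)
    simp only [Pi.sub_apply] at h
    rw [hI] at h
    linarith [P.meanSquareLipschitz k u v, sq_nonneg ‖P.F' u - P.F' v‖]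
  have hpt : ∀ z, ‖P.noiseAt k α u v z‖ ^ 2 ≤ 2 * α ^ 2 * ‖P.g k z u - P.F' u‖ ^ 2
      + 2 * (1 - α) ^ 2 * ‖P.g k z u - P.g k z v - (P.F' u - P.F' v)‖ ^ 2 := by
    intro z
    have h1 : P.noiseAt k α u v z = α • (P.g k z u - P.F' u)
        + (1 - α) • (P.g k z u - P.g k z v - (P.F' u - P.F' v)) := by
      simp only [noiseAt, smul_sub, sub_smul, one_smul]; abel
    have h2 := norm_add_sq_le_young (α • (P.g k z u - P.F' u))
      ((1 - α) • (P.g k z u - P.g k z v - (P.F' u - P.F' v))) one_pos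
    rw [← h1, norm_smul, norm_smul, mul_pow, mul_pow, Real.norm_eq_abs, Real.norm_eq_abs, sq_abs,
      sq_abs] at h2
    linarith
  have h3 := integral_mono_of_nonneg (μ := P.μ k) (Filter.Eventually.of_forall fun z => sq_nonneg _)
    ((i1.const_mul (2 * α ^ 2)).add (i2.const_mul (2 * (1 - α) ^ 2)))
    (Filter.Eventually.of_forall hpt)
  refine h3.trans ?_
  have h4 := integral_add (i1.const_mul (2 * α ^ 2)) (i2.const_mul (2 * (1 - α) ^ 2))
  rw [integral_const_mul, integral_const_mul] at h4
  refine h4.le.trans ?_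
  have h5 : (1 - α) ^ 2 ≤ 1 := by nlinarith [hα.1, hα.2]
  have h6 : 0 ≤ P.L ^ 2 * ‖u - v‖ ^ 2 := by positivity
  have h7 := mul_le_mul_of_nonneg_left (P.variance k u) (by positivity : 0 ≤ 2 * α ^ 2)
  have h8 := mul_le_mul_of_nonneg_left hdiff (by positivity : 0 ≤ 2 * (1 - α) ^ 2)
  nlinarith

end Sample

theorem indepFun_sample {S : Set (ℕ × Fin K)} {t : ℕ} {k : Fin K} (h : (t, k) ∉ S)
    {E : Type*} [MeasurableSpace E] {Z : Ω → E} (hZ : Measurable[P.sigma S] Z) :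
    IndepFun Z (P.ξ t k) P.Pr :=
  indepFun_of_measurable_sampleSigma (ξ := fun p : ℕ × Fin K => P.ξ p.1 p.2) (i := (t, k))
    (fun p => P.measurable_sample p.1 p.2) P.indep h hZ

theorem not_mem_past (t : ℕ) (k : Fin K) : (t, k) ∉ {p : ℕ × Fin K | p.1 < t} :=
  fun h => lt_irrefl t h

theorem measurable_noiseAt (k : Fin K) (α : ℝ) :
    Measurable fun q : (Vec d × Vec d) × 𝒵 => P.noiseAt k α q.1.1 q.1.2 q.2 := by
  have hF := P.continuous_F'.measurable
  have h1 : Measurable fun q : (Vec d × Vec d) × 𝒵 => P.g k q.2 q.1.1 :=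
    (P.measurable_g k).comp (measurable_snd.prodMk (measurable_fst.comp measurable_fst))
  have h2 : Measurable fun q : (Vec d × Vec d) × 𝒵 => P.g k q.2 q.1.2 :=
    (P.measurable_g k).comp (measurable_snd.prodMk (measurable_snd.comp measurable_fst))
  have h3 : Measurable fun q : (Vec d × Vec d) × 𝒵 => P.g k q.2 q.1.2 - P.F' q.1.2 :=
    h2.sub (hF.comp (measurable_snd.comp measurable_fst))
  exact (h1.sub (hF.comp (measurable_fst.comp measurable_fst))).sub (h3.const_smul (1 - α))

/-- The fresh noise is orthogonal to everything that does not depend on the fresh sample. -/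
theorem integral_inner_noise {S : Set (ℕ × Fin K)} {t : ℕ} {k : Fin K} (h : (t, k) ∉ S)
    (hS : P.past t ≤ P.sigma S) {Y : Ω → Vec d} (hY : BddMeasurable (P.sigma S) Y) :
    ∫ ω, inner ℝ (Y ω) (P.noise t k ω) ∂P.Pr = 0 := by
  have hZ : Measurable[P.sigma S] fun ω => (Y ω, P.x t k ω, P.xPrev t k ω) :=
    hY.1.prodMk (((P.bdd_x t k).1.mono hS le_rfl).prodMk ((P.bdd_xPrev t k).1.mono hS le_rfl))
  have hf : Measurable fun q : (Vec d × Vec d × Vec d) × 𝒵 =>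
      (inner ℝ q.1.1 (P.noiseAt k (P.α t) q.1.2.1 q.1.2.2 q.2) : ℝ) :=
    (measurable_fst.comp measurable_fst).inner ((P.measurable_noiseAt k (P.α t)).comp
      ((measurable_snd.comp measurable_fst).prodMk measurable_snd))
  have hint : Integrable (fun ω => (inner ℝ (Y ω) (P.noise t k ω) : ℝ)) P.Pr := by
    have h1 : BddMeasurable mΩ (P.noise t k) := (P.bdd_noise' t k).mono (P.sigma_le _)
    exact ((hY.mono (P.sigma_le _)).inner h1).integrable le_rfl
  have h1 := integral_freeze (hZ.mono (P.sigma_le S) le_rfl) (P.measurable_sample t k) (P.law t k)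
    (P.indepFun_sample h hZ) hf hint
  refine h1.trans ?_
  simp only [integral_inner (P.integrable_noiseAt k _ _ _), integral_noiseAt]
  simp

theorem integral_noise_sq_le (t : ℕ) (k : Fin K) :
    ∫ ω, ‖P.noise t k ω‖ ^ 2 ∂P.Pr ≤ 2 * P.α t ^ 2 * P.σ ^ 2
      + 2 * P.L ^ 2 * ∫ ω, ‖P.x t k ω - P.xPrev t k ω‖ ^ 2 ∂P.Pr := by
  have hZ : Measurable[P.past t] fun ω => (P.x t k ω, P.xPrev t k ω) :=
    (P.bdd_x t k).1.prodMk (P.bdd_xPrev t k).1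
  have hf : Measurable fun q : (Vec d × Vec d) × 𝒵 =>
      ‖P.noiseAt k (P.α t) q.1.1 q.1.2 q.2‖ ^ 2 :=
    (P.measurable_noiseAt k (P.α t)).norm.pow_const 2
  have h1 := integral_freeze (hZ.mono (P.sigma_le _) le_rfl) (P.measurable_sample t k) (P.law t k)
    (P.indepFun_sample (not_mem_past t k) hZ) hf
    (P.integrable_of_bdd (P.bdd_noise' t k).norm_sq)
  refine h1.le.trans ?_
  have hI : Integrable (fun ω => 2 * P.L ^ 2 * ‖P.x t k ω - P.xPrev t k ω‖ ^ 2) P.Pr :=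
    P.integrable_of_bdd (((P.bdd_x t k).sub (P.bdd_xPrev t k)).norm_sq.const_mul _)
  refine (integral_mono_of_nonneg (Filter.Eventually.of_forall fun ω =>
    integral_nonneg fun z => sq_nonneg _) ((integrable_const _).add hI)
    (Filter.Eventually.of_forall fun ω =>
      P.integral_noiseAt_sq_le k (P.α_mem t) (P.x t k ω) (P.xPrev t k ω))).trans ?_
  have h2 := integral_add (integrable_const (μ := P.Pr) (2 * P.α t ^ 2 * P.σ ^ 2)) hI
  refine h2.le.trans (le_of_eq ?_)
  simp [integral_const_mul]

theorem integral_grad_sq_le (t : ℕ) (k : Fin K) :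
    ∫ ω, ‖P.grad t k ω‖ ^ 2 ∂P.Pr ≤ P.σ ^ 2 + P.G ^ 2 := by
  have hZ := (P.bdd_x t k).1
  have hf : Measurable fun q : Vec d × 𝒵 => ‖P.g k q.2 q.1‖ ^ 2 :=
    ((P.measurable_g k).comp measurable_swap).norm.pow_const 2
  have h1 := integral_freeze (hZ.mono (P.sigma_le _) le_rfl) (P.measurable_sample t k) (P.law t k)
    (P.indepFun_sample (not_mem_past t k) hZ) hf
    (P.integrable_of_bdd (P.bdd_new t k).1.norm_sq)
  refine h1.le.trans ?_
  refine (integral_mono_of_nonneg (Filter.Eventually.of_forall fun ω =>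
    integral_nonneg fun z => sq_nonneg _) (integrable_const _)
    (Filter.Eventually.of_forall fun ω => P.integral_norm_g_sq_le k (P.x t k ω))).trans ?_
  simp

end FedProcess

/-! ### Deterministic recursions, summed over rounds -/

section RoundSums

/-- The sum of a sequence over round number `r`. -/
def roundSum (τ : ℕ) (f : ℕ → ℝ) (r : ℕ) : ℝ := ∑ j ∈ Finset.range τ, f (τ * r + j)

theorem sum_roundSum (τ R : ℕ) (f : ℕ → ℝ) :
    ∑ r ∈ Finset.range R, roundSum τ f r = ∑ t ∈ Finset.range (τ * R), f t := by
  induction R with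
  | zero => simp
  | succ R ih => rw [Finset.sum_range_succ, ih, Nat.mul_succ, Finset.sum_range_add, roundSum]

theorem roundSum_nonneg {τ : ℕ} {f : ℕ → ℝ} (hf : ∀ t, 0 ≤ f t) (r : ℕ) : 0 ≤ roundSum τ f r :=
  Finset.sum_nonneg fun _ _ => hf _

theorem sum_le_roundSum {τ : ℕ} {f : ℕ → ℝ} (hf : ∀ t, 0 ≤ f t) (r : ℕ) {j : ℕ} (hj : j ≤ τ) :
    ∑ i ∈ Finset.range j, f (τ * r + i) ≤ roundSum τ f r :=
  Finset.sum_le_sum_of_subset_of_nonneg (Finset.range_mono hj) fun _ _ _ => hf _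

end RoundSums

/-- The recursive inequalities between the error quantities of the local-update method with constant
step size `η` and constant momentum parameter `α`: `E` is the squared error of the averaged
momentum, `Q` the spread over the nodes of the momentum errors, `V` the noise, `S` the spread of
the iterates, `D` the spread of the momenta, `U` the squared length of the averaged update, `W` the
squared length of the individual updates. -/
structure RoundRecursion (τ : ℕ) (K β L σ ρ η α : ℝ) (E Q V S D U W : ℕ → ℝ) : Prop where
  E_nonneg : ∀ t, 0 ≤ E t
  V_nonneg : ∀ t, 0 ≤ V t
  S_nonneg : ∀ t, 0 ≤ S t
  D_nonneg : ∀ t, 0 ≤ D t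
  U_nonneg : ∀ t, 0 ≤ U t
  W_nonneg : ∀ t, 0 ≤ W t
  E_succ : ∀ t, E (t + 1) ≤ (1 - α) ^ 2 * E t + V t / K
  Q_succ : ∀ t, ¬ τ ∣ t + 1 → Q (t + 1) ≤ Q t + V t
  Q_succ_of_dvd : ∀ t, τ ∣ t + 1 → Q (t + 1) ≤ β ^ 2 * S t
  D_le : ∀ t, D t ≤ 2 * (Q t + V t) + 2 * β ^ 2 * S t
  V_le : ∀ t, V t ≤ 2 * α ^ 2 * σ ^ 2 + 2 * L ^ 2 * W t
  W_succ : ∀ t, ¬ τ ∣ t + 1 → W (t + 1) ≤ η ^ 2 * U t + (η / ρ) ^ 2 * D t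
  W_succ_of_dvd : ∀ t, τ ∣ t + 1 → W (t + 1) ≤ η ^ 2 * U t + (η / ρ) ^ 2 * D t + S t
  S_of_dvd : ∀ t, τ ∣ t → S t = 0
  S_succ : ∀ t, ¬ τ ∣ t + 1 → ∀ l : ℝ, 0 < l →
    S (t + 1) ≤ (1 + l) * S t + (1 + 1 / l) * ((η / ρ) ^ 2 * D t)
  Q_zero : Q 0 ≤ 0
  W_zero : W 0 ≤ 0

namespace RoundRecursion

variable {τ : ℕ} {K β L σ ρ η α : ℝ} {E Q V S D U W : ℕ → ℝ}

theorem not_dvd_of_lt {r j : ℕ} (hj : j + 1 < τ) : ¬ τ ∣ τ * r + j + 1 := by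
  intro h
  rw [add_assoc, Nat.dvd_add_right (dvd_mul_right _ _)] at h
  exact absurd (Nat.le_of_dvd (Nat.succ_pos _) h) (by omega)

/-- The spread starts at zero in every round. A weight in Young's inequality that varies with the
position makes its growth factor linear in `j` instead of exponential. -/
theorem S_le_aux (h : RoundRecursion τ K β L σ ρ η α E Q V S D U W) (r : ℕ) :
    ∀ j, j < τ → S (τ * r + j)
      ≤ (j + 1) * ((η / ρ) ^ 2 * ∑ i ∈ Finset.range j, D (τ * r + i)) := by
  intro j
  induction j with
  | zero => intro _; simp [h.S_of_dvd (τ * r) (dvd_mul_right _ _)]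
  | succ j ih =>
    intro hj
    have h1 := ih (by omega)
    -- With this weight `(1 + l) * (j + 1)` and `1 + 1 / l` both equal `j + 2`, so the induction
    -- closes exactly.
    have hl : (0 : ℝ) < 1 / (j + 1) := by positivity
    have h2 := h.S_succ (τ * r + j) (not_dvd_of_lt hj) _ hl
    rw [Finset.sum_range_succ]
    set X := (η / ρ) ^ 2 * ∑ i ∈ Finset.range j, D (τ * r + i)
    have h3 : (1 + 1 / ((j : ℝ) + 1)) * S (τ * r + j) ≤ (1 + 1 / (j + 1)) * ((j + 1) * X) := by
      gcongr
    have h4 : (1 + 1 / ((j : ℝ) + 1)) * ((j + 1) * X) = (j + 2) * X := by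
      field_simp; ring
    have h5 : 1 + 1 / (1 / ((j : ℝ) + 1)) = j + 2 := by
      field_simp; ring
    rw [h5] at h2
    push_cast
    rw [← add_assoc]
    calc S (τ * r + j + 1) ≤ (j + 2) * X + (j + 2) * ((η / ρ) ^ 2 * D (τ * r + j)) := by
          linarith
      _ = _ := by simp only [X]; ring

theorem S_le (h : RoundRecursion τ K β L σ ρ η α E Q V S D U W) (r : ℕ) {j : ℕ} (hj : j < τ) :
    S (τ * r + j) ≤ τ * (η / ρ) ^ 2 * roundSum τ D r := by
  refine (h.S_le_aux r j hj).trans ?_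
  rw [mul_assoc]
  have h1 : (j : ℝ) + 1 ≤ τ := by exact_mod_cast hj
  have h2 := sum_le_roundSum h.D_nonneg r hj.le
  have h3 : 0 ≤ ∑ i ∈ Finset.range j, D (τ * r + i) := Finset.sum_nonneg fun _ _ => h.D_nonneg _
  gcongr

theorem roundSum_S_le (h : RoundRecursion τ K β L σ ρ η α E Q V S D U W) (r : ℕ) :
    roundSum τ S r ≤ (τ * (η / ρ)) ^ 2 * roundSum τ D r := by
  have := Finset.sum_le_sum fun j (hj : j ∈ Finset.range τ) => h.S_le r (Finset.mem_range.1 hj)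
  rw [Finset.sum_const, Finset.card_range, nsmul_eq_mul] at this
  calc roundSum τ S r ≤ _ := this
    _ = _ := by ring

theorem Q_le (h : RoundRecursion τ K β L σ ρ η α E Q V S D U W) (r : ℕ) :
    ∀ j, j < τ → Q (τ * r + j) ≤ Q (τ * r) + ∑ i ∈ Finset.range j, V (τ * r + i) := by
  intro j
  induction j with
  | zero => simp
  | succ j ih =>
    intro hj
    rw [Finset.sum_range_succ]
    have := h.Q_succ (τ * r + j) (not_dvd_of_lt hj)
    rw [← add_assoc]
    linarith [ih (by omega)]

theorem Q_add_V_le (h : RoundRecursion τ K β L σ ρ η α E Q V S D U W) (r : ℕ) {j : ℕ}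
    (hj : j < τ) : Q (τ * r + j) + V (τ * r + j) ≤ Q (τ * r) + roundSum τ V r := by
  have h1 := h.Q_le r j hj
  have h2 := sum_le_roundSum h.V_nonneg r (Nat.succ_le_of_lt hj)
  rw [Nat.succ_eq_add_one, Finset.sum_range_succ] at h2
  linarith

/-- Momenta spread the iterates and spread iterates spread the momenta, so the sum of `D` bounds
itself. Its coefficient on the right becomes small once `η` is of order `1 / τ`. -/
theorem roundSum_D_le (h : RoundRecursion τ K β L σ ρ η α E Q V S D U W) (r : ℕ) :
    roundSum τ D r ≤ 2 * τ * (Q (τ * r) + roundSum τ V r)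
      + 2 * (β * (τ * (η / ρ))) ^ 2 * roundSum τ D r := by
  have h1 : ∀ j ∈ Finset.range τ, D (τ * r + j) ≤ 2 * (Q (τ * r) + roundSum τ V r)
      + 2 * β ^ 2 * S (τ * r + j) := fun j hj => by
    linarith [h.D_le (τ * r + j), h.Q_add_V_le r (Finset.mem_range.1 hj)]
  have h2 := Finset.sum_le_sum h1
  rw [Finset.sum_add_distrib, Finset.sum_const, Finset.card_range, nsmul_eq_mul,
    ← Finset.mul_sum] at h2
  have h3 := mul_le_mul_of_nonneg_left (h.roundSum_S_le r) (by positivity : 0 ≤ 2 * β ^ 2)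
  simp only [roundSum] at h2 h3 ⊢
  nlinarith

theorem last_index (hτ : 0 < τ) (r : ℕ) : τ * r + (τ - 1) + 1 = τ * (r + 1) := by
  rw [add_assoc, Nat.sub_add_cancel hτ, Nat.mul_succ]

theorem Q_round_succ_le (h : RoundRecursion τ K β L σ ρ η α E Q V S D U W) (hτ : 0 < τ) (r : ℕ) :
    Q (τ * (r + 1)) ≤ β ^ 2 * (τ * (η / ρ) ^ 2 * roundSum τ D r) := by
  have h1 := h.Q_succ_of_dvd (τ * r + (τ - 1)) (by rw [last_index hτ]; exact dvd_mul_right _ _)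
  rw [last_index hτ] at h1
  exact h1.trans (mul_le_mul_of_nonneg_left (h.S_le r (by omega)) (sq_nonneg β))

/-- The error spread at the start of a round is inherited from the round before, and the first round
inherits nothing by `Q_zero`; after an index shift the last round is surplus. -/
theorem sum_Q_le (h : RoundRecursion τ K β L σ ρ η α E Q V S D U W) (hτ : 0 < τ) (R : ℕ) :
    ∑ r ∈ Finset.range R, Q (τ * r)
      ≤ β ^ 2 * (τ * (η / ρ) ^ 2) * ∑ t ∈ Finset.range (τ * R), D t := by
  rw [← sum_roundSum, Finset.mul_sum]
  rcases R with _ | R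
  · simp
  rw [Finset.sum_range_succ', Finset.sum_range_succ]
  have h1 := Finset.sum_le_sum fun r (_ : r ∈ Finset.range R) => h.Q_round_succ_le hτ r
  have h2 : 0 ≤ β ^ 2 * (τ * (η / ρ) ^ 2) * roundSum τ D R := by
    have := roundSum_nonneg (τ := τ) h.D_nonneg R
    positivity
  simp only [mul_assoc] at h1 h2 ⊢
  linarith [h.Q_zero, (by rw [mul_zero] : Q (τ * 0) = Q 0)]

theorem sum_D_le (h : RoundRecursion τ K β L σ ρ η α E Q V S D U W) (hτ : 0 < τ) (R : ℕ) :
    ∑ t ∈ Finset.range (τ * R), D t ≤ 2 * τ * ∑ t ∈ Finset.range (τ * R), V t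
      + 4 * (β * (τ * (η / ρ))) ^ 2 * ∑ t ∈ Finset.range (τ * R), D t := by
  have h1 := Finset.sum_le_sum fun r (_ : r ∈ Finset.range R) => h.roundSum_D_le r
  rw [Finset.sum_add_distrib, ← Finset.mul_sum, ← Finset.mul_sum, Finset.sum_add_distrib,
    sum_roundSum, sum_roundSum] at h1
  have h2 := mul_le_mul_of_nonneg_left (h.sum_Q_le hτ R) (by positivity : (0 : ℝ) ≤ 2 * τ)
  nlinarith

/-- Only the last of the `τ` steps communicates, so the jump to the average costs one spread per
round rather than one per step. -/
theorem roundSum_W_succ_le (h : RoundRecursion τ K β L σ ρ η α E Q V S D U W) (hτ : 0 < τ)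
    (r : ℕ) :
    roundSum τ (fun t => W (t + 1)) r ≤ η ^ 2 * roundSum τ U r + (η / ρ) ^ 2 * roundSum τ D r
      + τ * (η / ρ) ^ 2 * roundSum τ D r := by
  obtain ⟨n, rfl⟩ : ∃ n, τ = n + 1 := ⟨τ - 1, by omega⟩
  have h1 : ∀ j ∈ Finset.range n, W ((n + 1) * r + j + 1)
      ≤ η ^ 2 * U ((n + 1) * r + j) + (η / ρ) ^ 2 * D ((n + 1) * r + j) := fun j hj =>
    h.W_succ _ (not_dvd_of_lt (by have := Finset.mem_range.1 hj; omega))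
  have h2 := Finset.sum_le_sum h1
  have h3 := h.W_succ_of_dvd ((n + 1) * r + n)
    (by rw [add_assoc, ← Nat.mul_succ]; exact dvd_mul_right _ _)
  have h4 := h.S_le r (Nat.lt_succ_self n)
  rw [Finset.sum_add_distrib, ← Finset.mul_sum, ← Finset.mul_sum] at h2
  have hU : roundSum (n + 1) U r = ∑ j ∈ Finset.range n, U ((n + 1) * r + j) + U ((n + 1) * r + n) :=
    Finset.sum_range_succ _ _
  have hD : roundSum (n + 1) D r = ∑ j ∈ Finset.range n, D ((n + 1) * r + j) + D ((n + 1) * r + n) :=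
    Finset.sum_range_succ _ _
  have hW : roundSum (n + 1) (fun t => W (t + 1)) r
      = ∑ j ∈ Finset.range n, W ((n + 1) * r + j + 1) + W ((n + 1) * r + n + 1) :=
    Finset.sum_range_succ _ _
  rw [hW]
  refine (add_le_add h2 (h3.trans (add_le_add_right h4 _))).trans (le_of_eq ?_)
  rw [hU, hD]; push_cast; ring

theorem sum_V_le (h : RoundRecursion τ K β L σ ρ η α E Q V S D U W) (hτ : 0 < τ) (R : ℕ) :
    ∑ t ∈ Finset.range (τ * R), V t ≤ 2 * (τ * R : ℕ) * α ^ 2 * σ ^ 2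
      + 2 * L ^ 2 * η ^ 2 * ∑ t ∈ Finset.range (τ * R), U t
      + 4 * τ * (L * (η / ρ)) ^ 2 * ∑ t ∈ Finset.range (τ * R), D t := by
  have h1 := Finset.sum_le_sum fun t (_ : t ∈ Finset.range (τ * R)) => h.V_le t
  rw [Finset.sum_add_distrib, Finset.sum_const, Finset.card_range, nsmul_eq_mul,
    ← Finset.mul_sum] at h1
  have h2 := Finset.sum_le_sum fun r (_ : r ∈ Finset.range R) => h.roundSum_W_succ_le hτ r
  rw [Finset.sum_add_distrib, Finset.sum_add_distrib, ← Finset.mul_sum, ← Finset.mul_sum,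
    ← Finset.mul_sum, sum_roundSum, sum_roundSum, sum_roundSum] at h2
  -- The noise at `t` involves the move made before `t`; the shift is allowed because there is no
  -- move before time zero.
  have h3 : ∑ t ∈ Finset.range (τ * R), W t ≤ ∑ t ∈ Finset.range (τ * R), W (t + 1) := by
    have h4 := Finset.sum_range_succ W (τ * R)
    have h5 := Finset.sum_range_succ' W (τ * R)
    linarith [h.W_zero, h.W_nonneg (τ * R)]
  have h6 : (1 : ℝ) ≤ τ := by exact_mod_cast hτ
  have hD : 0 ≤ ∑ t ∈ Finset.range (τ * R), D t := Finset.sum_nonneg fun t _ => h.D_nonneg t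
  have h7 : (η / ρ) ^ 2 * ∑ t ∈ Finset.range (τ * R), D t
      ≤ τ * (η / ρ) ^ 2 * ∑ t ∈ Finset.range (τ * R), D t := by
    rw [mul_assoc]
    exact le_mul_of_one_le_left (by positivity) h6
  have h8 := mul_le_mul_of_nonneg_left (h3.trans h2) (by positivity : 0 ≤ 2 * L ^ 2)
  have h9 := mul_le_mul_of_nonneg_left h7 (by positivity : 0 ≤ 2 * L ^ 2)
  refine h1.trans ?_
  nlinarith

/-- Weakening the contraction to `1 - α` makes the recursion telescope. The shifted sum is needed
because descent at step `t` uses the error after the update. -/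
theorem sum_E_succ_le (h : RoundRecursion τ K β L σ ρ η α E Q V S D U W) (hα : 0 ≤ α)
    (hα1 : α ≤ 1) (N : ℕ) :
    α * ∑ t ∈ Finset.range N, E (t + 1) ≤ E 0 + (∑ t ∈ Finset.range N, V t) / K := by
  have h1 : ∀ t, E (t + 1) ≤ (1 - α) * E t + V t / K := fun t => by
    refine (h.E_succ t).trans ?_
    have : (1 - α) ^ 2 ≤ 1 - α := by nlinarith
    nlinarith [h.E_nonneg t]
  have h2 : ∀ N, E N + α * ∑ t ∈ Finset.range N, E t
      ≤ E 0 + (∑ t ∈ Finset.range N, V t) / K := by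
    intro N
    induction N with
    | zero => simp
    | succ N ih =>
      rw [Finset.sum_range_succ, Finset.sum_range_succ, add_div]
      linarith [h1 N]
  have h3 := Finset.sum_range_succ E N
  have h4 := Finset.sum_range_succ' E N
  have h5 := h2 N
  have h6 : ∑ t ∈ Finset.range N, E (t + 1) = ∑ t ∈ Finset.range N, E t + E N - E 0 := by linarith
  rw [h6]
  nlinarith [h.E_nonneg N, h.E_nonneg 0]

/-- Consequences for the tuning `η = ρ / (8 L τ)`. -/
theorem sum_bounds (h : RoundRecursion τ K β L σ ρ η α E Q V S D U W) (hτ : 0 < τ)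
    (hβ : 0 ≤ β) (hβL : β ≤ L) (hL : 0 < L) (hρ : 0 < ρ)
    (hη : η = ρ / (8 * L * τ)) (R : ℕ) :
    ∑ t ∈ Finset.range (τ * R), D t ≤ 8 * τ * (τ * R : ℕ) * α ^ 2 * σ ^ 2
        + 8 * τ * L ^ 2 * η ^ 2 * ∑ t ∈ Finset.range (τ * R), U t ∧
      ∑ t ∈ Finset.range (τ * R), V t ≤ 4 * (τ * R : ℕ) * α ^ 2 * σ ^ 2
        + 4 * L ^ 2 * η ^ 2 * ∑ t ∈ Finset.range (τ * R), U t ∧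
      β ^ 2 * ∑ t ∈ Finset.range (τ * R), S t ≤ 1 / 64 * ∑ t ∈ Finset.range (τ * R), D t := by
  have hτ' : (0 : ℝ) < τ := by exact_mod_cast hτ
  -- This normalisation gives every feedback coefficient the value 1/16 at most: `D` is bounded by
  -- `2 * τ` times `V` plus a sixteenth of itself, and `τ` times `V` contains another sixteenth of
  -- `D`. The coupled pair can then be solved.
  have hk : L * (τ * (η / ρ)) = 1 / 8 := by rw [hη]; field_simp
  have hbk : (β * (τ * (η / ρ))) ^ 2 ≤ 1 / 64 := by
    have h0 : 0 ≤ τ * (η / ρ) := by rw [hη]; positivity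
    have : β * (τ * (η / ρ)) ≤ 1 / 8 := by rw [← hk]; gcongr
    nlinarith [mul_nonneg hβ h0]
  have h1 := h.sum_D_le hτ R
  have h2 := h.sum_V_le hτ R
  have h3 : ∑ t ∈ Finset.range (τ * R), S t
      ≤ (τ * (η / ρ)) ^ 2 * ∑ t ∈ Finset.range (τ * R), D t := by
    have := Finset.sum_le_sum fun r (_ : r ∈ Finset.range R) => h.roundSum_S_le r
    rwa [← Finset.mul_sum, sum_roundSum, sum_roundSum] at this
  have hD : 0 ≤ ∑ t ∈ Finset.range (τ * R), D t := Finset.sum_nonneg fun t _ => h.D_nonneg t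
  set SD := ∑ t ∈ Finset.range (τ * R), D t
  set SV := ∑ t ∈ Finset.range (τ * R), V t
  set SU := ∑ t ∈ Finset.range (τ * R), U t
  have h4 : 4 * (β * (τ * (η / ρ))) ^ 2 * SD ≤ 1 / 16 * SD := by nlinarith
  have h5 : (τ : ℝ) * (4 * τ * (L * (η / ρ)) ^ 2) = 1 / 16 := by
    calc (τ : ℝ) * (4 * τ * (L * (η / ρ)) ^ 2) = 4 * (L * (τ * (η / ρ))) ^ 2 := by ring
      _ = 1 / 16 := by rw [hk]; norm_num
  have h6 := mul_le_mul_of_nonneg_left h2 hτ'.le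
  have h7 : (τ : ℝ) * (4 * τ * (L * (η / ρ)) ^ 2 * SD) = 1 / 16 * SD := by rw [← mul_assoc, h5]
  have hD' : SD ≤ 8 * τ * (τ * R : ℕ) * α ^ 2 * σ ^ 2 + 8 * τ * L ^ 2 * η ^ 2 * SU := by
    nlinarith
  refine ⟨hD', ?_, ?_⟩
  · have h8 : (τ : ℝ) * SV ≤ τ * (4 * (τ * R : ℕ) * α ^ 2 * σ ^ 2 + 4 * L ^ 2 * η ^ 2 * SU) := by
      nlinarith
    exact le_of_mul_le_mul_left h8 hτ'
  · have h9 := mul_le_mul_of_nonneg_left h3 (sq_nonneg β)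
    have : β ^ 2 * ((τ * (η / ρ)) ^ 2 * SD) = (β * (τ * (η / ρ))) ^ 2 * SD := by ring
    rw [this] at h9
    exact h9.trans (mul_le_mul_of_nonneg_right hbk hD)

end RoundRecursion

/-! ### Summed descent for the chosen step size and momentum -/

namespace RoundRecursion

variable {τ : ℕ} {K β L σ ρ η α : ℝ} {E Q V S D U W : ℕ → ℝ}

/-- Movement enters the summed momentum error with coefficient `4 * L ^ 2 * η ^ 2 / (K * α)`. The
choice `K * α = 1 / τ ^ 2` makes it `ρ ^ 2 / 16`; with the drift's `ρ ^ 2 / 512` it uses at most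
half of the negative term in `U`. -/
theorem sum_descent_le (h : RoundRecursion τ K β L σ ρ η α E Q V S D U W) (hτ : 0 < τ)
    (hβ : 0 ≤ β) (hβL : β ≤ L) (hL : 0 < L) (hρ : 0 < ρ) (hK : 1 ≤ K)
    (hη : η = ρ / (8 * L * τ)) (hα : α = 1 / (K * τ ^ 2)) {H Φ : ℕ → ℝ} {Δ : ℝ}
    (hdesc : ∀ t, Φ (t + 1) ≤ Φ t - η / 2 * H t - η * ρ / 4 * U t
      + η / ρ * (E (t + 1) + β ^ 2 * S t))
    (hΔ : ∀ t, Φ 0 - Φ t ≤ Δ) (R : ℕ) :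
    η / 2 * ∑ t ∈ Finset.range (τ * R), H t + η * ρ / 8 * ∑ t ∈ Finset.range (τ * R), U t
      ≤ Δ + η / ρ * (E 0 / α + 4 * (τ * R : ℕ) * α * σ ^ 2 / K
        + τ * (τ * R : ℕ) * α ^ 2 * σ ^ 2 / 8) := by
  have hτ1 : (1 : ℝ) ≤ τ := by exact_mod_cast hτ
  have hτ' : (0 : ℝ) < τ := by linarith
  have hK' : 0 < K := by linarith
  have hα0 : 0 < α := by rw [hα]; positivity
  have hα1 : α ≤ 1 := by
    rw [hα, div_le_one (by positivity)]
    nlinarith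
  have hη0 : 0 < η := by rw [hη]; positivity
  obtain ⟨hD, hV, hS⟩ := h.sum_bounds hτ hβ hβL hL hρ hη R
  have hE := h.sum_E_succ_le hα0.le hα1 (τ * R)
  have hU0 : 0 ≤ ∑ t ∈ Finset.range (τ * R), U t := Finset.sum_nonneg fun t _ => h.U_nonneg t
  have htel : ∀ N, Φ N ≤ Φ 0 - η / 2 * ∑ t ∈ Finset.range N, H t
      - η * ρ / 4 * ∑ t ∈ Finset.range N, U t
      + η / ρ * (∑ t ∈ Finset.range N, E (t + 1) + β ^ 2 * ∑ t ∈ Finset.range N, S t) := by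
    intro N
    induction N with
    | zero => simp
    | succ N ih =>
      simp only [Finset.sum_range_succ]
      have := hdesc N
      nlinarith
  have h1 := htel (τ * R)
  have h2 := hΔ (τ * R)
  set N : ℝ := ((τ * R : ℕ) : ℝ)
  set SD := ∑ t ∈ Finset.range (τ * R), D t
  set SV := ∑ t ∈ Finset.range (τ * R), V t
  set SU := ∑ t ∈ Finset.range (τ * R), U t
  set SE := ∑ t ∈ Finset.range (τ * R), E (t + 1)
  set SS := ∑ t ∈ Finset.range (τ * R), S t
  have hk : L * η * τ = ρ / 8 := by rw [hη]; field_simp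
  have hKα : K * α = 1 / τ ^ 2 := by rw [hα]; field_simp
  have hE' : SE ≤ E 0 / α + 4 * N * α * σ ^ 2 / K + ρ ^ 2 / 16 * SU := by
    have e1 : SV / K ≤ (4 * N * α ^ 2 * σ ^ 2 + 4 * L ^ 2 * η ^ 2 * SU) / K := by gcongr
    have e2 : SE ≤ (E 0 + (4 * N * α ^ 2 * σ ^ 2 + 4 * L ^ 2 * η ^ 2 * SU) / K) / α := by
      rw [le_div_iff₀ hα0]; linarith
    refine e2.trans (le_of_eq ?_)
    have e3 : (E 0 + (4 * N * α ^ 2 * σ ^ 2 + 4 * L ^ 2 * η ^ 2 * SU) / K) / α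
        = E 0 / α + 4 * N * α * σ ^ 2 / K + 4 * (L ^ 2 * η ^ 2 / (K * α)) * SU := by
      field_simp; ring
    rw [e3, hKα]
    have e4 : L ^ 2 * η ^ 2 / (1 / (τ : ℝ) ^ 2) = (L * η * τ) ^ 2 := by field_simp
    rw [e4, hk]; ring
  have hS' : β ^ 2 * SS ≤ τ * N * α ^ 2 * σ ^ 2 / 8 + ρ ^ 2 / 512 * SU := by
    have e1 : τ * L ^ 2 * η ^ 2 ≤ ρ ^ 2 / 64 := by
      have : ρ ^ 2 / 64 = τ * (τ * L ^ 2 * η ^ 2) := by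
        calc ρ ^ 2 / 64 = (L * η * τ) ^ 2 := by rw [hk]; ring
          _ = _ := by ring
      rw [this]
      exact le_mul_of_one_le_left (by positivity) hτ1
    have e2 := mul_le_mul_of_nonneg_right e1 hU0
    linarith
  have h3 : η / ρ * (SE + β ^ 2 * SS) ≤ η / ρ * (E 0 / α + 4 * N * α * σ ^ 2 / K
      + τ * N * α ^ 2 * σ ^ 2 / 8) + η * ρ / 8 * SU := by
    have e0 : 0 ≤ η / ρ := by positivity
    have e1 := mul_le_mul_of_nonneg_left (add_le_add hE' hS') e0
    have e2 : η / ρ * (ρ ^ 2 / 8 * SU) = η * ρ / 8 * SU := by field_simp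
    have e3 : η / ρ * (ρ ^ 2 / 16 * SU + ρ ^ 2 / 512 * SU) ≤ η / ρ * (ρ ^ 2 / 8 * SU) := by
      apply mul_le_mul_of_nonneg_left _ e0
      nlinarith [mul_nonneg (sq_nonneg ρ) hU0]
    linarith
  linarith

/-- The scale `x` measures all three variance contributions. The inherited error gives `2 / (R₀ *
R)`, the persistent noise `4 / (K * τ) ^ 2`, the drift less than one such square; their total 7
doubles to 14 on division by `η / 2`. -/
theorem sum_precond_gradient_le (h : RoundRecursion τ K β L σ ρ η α E Q V S D U W) (hτ : 0 < τ)
    (hβ : 0 ≤ β) (hβL : β ≤ L) (hL : 0 < L) (hρ : 0 < ρ) (hK : 1 ≤ K)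
    (hη : η = ρ / (8 * L * τ)) (hα : α = 1 / (K * τ ^ 2)) {H Φ : ℕ → ℝ} {Δ x : ℝ}
    (hdesc : ∀ t, Φ (t + 1) ≤ Φ t - η / 2 * H t - η * ρ / 4 * U t
      + η / ρ * (E (t + 1) + β ^ 2 * S t))
    (hΔ : ∀ t, Φ 0 - Φ t ≤ Δ) {R₀ R : ℕ} (hR₀ : 0 < R₀) (hR : 0 < R)
    (hE0 : E 0 ≤ 2 * σ ^ 2 / (K * (τ * R₀ : ℕ)))
    (hxτ : 1 / (K * τ) ≤ x) (hx0 : 1 / (R₀ : ℝ) ≤ x) (hxR : 1 / (R : ℝ) ≤ x) :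
    ∑ t ∈ Finset.range (τ * R), H t + ρ / 4 * ∑ t ∈ Finset.range (τ * R), U t
      ≤ (τ * R : ℕ) * (16 * L * Δ / (ρ * R) + 14 * σ ^ 2 * x ^ 2 / ρ) := by
  have h1 := h.sum_descent_le hτ hβ hβL hL hρ hK hη hα hdesc hΔ R
  have hτ1 : (1 : ℝ) ≤ τ := by exact_mod_cast hτ
  have hτ' : (0 : ℝ) < τ := by linarith
  have hR' : (0 : ℝ) < R := by exact_mod_cast hR
  have hR₀' : (0 : ℝ) < R₀ := by exact_mod_cast hR₀
  have hK' : 0 < K := by linarith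
  have hα0 : 0 < α := by rw [hα]; positivity
  have hη0 : 0 < η := by rw [hη]; positivity
  set SU := ∑ t ∈ Finset.range (τ * R), U t
  set SH := ∑ t ∈ Finset.range (τ * R), H t
  push_cast at h1 hE0 ⊢
  have hx : 0 ≤ x := le_trans (by positivity) hx0
  have t1 : E 0 / α ≤ τ * R * (2 * σ ^ 2 * x ^ 2) := by
    have e1 : E 0 / α ≤ 2 * σ ^ 2 / (K * (τ * R₀)) / α := by gcongr
    have e2 : 2 * σ ^ 2 / (K * (τ * R₀)) / α = τ * R * (2 * σ ^ 2 * (1 / R₀ * (1 / R))) := by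
      rw [hα]; field_simp
    rw [e2] at e1
    refine e1.trans ?_
    rw [pow_two x]
    gcongr
  have t2 : 4 * (τ * R) * α * σ ^ 2 / K ≤ τ * R * (4 * σ ^ 2 * x ^ 2) := by
    have e2 : 4 * (τ * R) * α * σ ^ 2 / K = τ * R * (4 * σ ^ 2 * (1 / (K * τ)) ^ 2) := by
      rw [hα]; field_simp
    rw [e2]
    gcongr
  have t3 : τ * (τ * R) * α ^ 2 * σ ^ 2 / 8 ≤ τ * R * (σ ^ 2 * x ^ 2) := by
    have e2 : τ * (τ * R) * α ^ 2 * σ ^ 2 / 8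
        = τ * R * (σ ^ 2 * ((1 / (K * τ)) ^ 2 * (1 / (8 * τ)))) := by
      rw [hα]; field_simp
    rw [e2]
    have e3 : 1 / (8 * (τ : ℝ)) ≤ 1 := by rw [div_le_one (by positivity)]; linarith
    have e4 : (1 / (K * τ)) ^ 2 * (1 / (8 * (τ : ℝ))) ≤ x ^ 2 * 1 := by gcongr
    rw [mul_one] at e4
    gcongr
  have h2 : η / 2 * (SH + ρ / 4 * SU) ≤ η / 2 * (τ * R * (16 * L * Δ / (ρ * R)
      + 14 * σ ^ 2 * x ^ 2 / ρ)) := by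
    have e1 := mul_le_mul_of_nonneg_left (add_le_add (add_le_add t1 t2) t3)
      (by positivity : 0 ≤ η / ρ)
    have e2 : η / 2 * (τ * R * (16 * L * Δ / (ρ * R) + 14 * σ ^ 2 * x ^ 2 / ρ))
        = Δ * (8 * L * τ * η / ρ) + η / ρ * (τ * R * (7 * σ ^ 2 * x ^ 2)) := by
      field_simp; ring
    have e3 : 8 * L * τ * η / ρ = 1 := by rw [hη]; field_simp
    rw [e2, e3]
    linarith
  exact le_of_mul_le_mul_left h2 (by positivity)

end RoundRecursion

/-! ### From all local steps to communicated models -/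

/-- From preconditioned gradients at all steps to gradients at the communicated models. -/
theorem sum_gradient_le {τ : ℕ} (hτ : 0 < τ) {β ρ η Λ ε : ℝ} (hβ : 0 ≤ β) (hη : 0 ≤ η) (hρ : 0 < ρ)
    (hε : 0 < ε) (hΛ : ρ ≤ Λ) (hβη : β * η * τ ≤ ρ / 8) {B Z H U : ℕ → ℝ} (hZ0 : ∀ t, 0 ≤ Z t)
    (hU0 : ∀ t, 0 ≤ U t)
    (hB : ∀ t, B (t + 1) ≤ B t + β * η * Z t)
    (hBH : ∀ t, ∀ δ : ℝ, 0 < δ → B t ≤ 1 / 2 * (δ * Λ + H t / δ))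
    (hZU : ∀ t, ∀ δ : ℝ, 0 < δ → Z t ≤ 1 / 2 * (δ + U t / δ)) (R : ℕ)
    (hsum : ∑ t ∈ Finset.range (τ * R), H t + ρ / 4 * ∑ t ∈ Finset.range (τ * R), U t
      ≤ (τ * R : ℕ) * (1 / (16 * Λ) * ε ^ 2)) :
    ∑ r ∈ Finset.range R, B (τ * (r + 1)) ≤ R * (ε / 2) := by
  have hτ' : (0 : ℝ) < τ := by exact_mod_cast hτ
  have hΛ0 : 0 < Λ := by linarith
  -- Walking backwards from the end of the round compares the communicated model with each earlier
  -- step; averaging over these steps brings in the full sum of `B`.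
  have step : ∀ r j, j ≤ τ → B (τ * (r + 1)) ≤ B (τ * r + (τ - j))
      + β * η * ∑ i ∈ Finset.range j, Z (τ * r + (τ - j + i)) := by
    intro r j
    induction j with
    | zero => intro _; simp [Nat.mul_succ]
    | succ j ih =>
      intro hj
      refine (ih (by omega)).trans ?_
      rw [Finset.sum_range_succ']
      have e1 : τ - j = τ - (j + 1) + 1 := by omega
      have e2 := hB (τ * r + (τ - (j + 1)))
      have e3 : ∀ i, τ * r + (τ - (j + 1) + (i + 1)) = τ * r + (τ - j + i) := fun i => by omega
      simp only [e3, add_zero]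
      rw [add_assoc, ← e1] at e2
      linarith
  have round : ∀ r, τ * B (τ * (r + 1)) ≤ roundSum τ B r + τ * (β * η) * roundSum τ Z r := by
    intro r
    have h1 : ∀ j ∈ Finset.range τ, B (τ * (r + 1)) ≤ B (τ * r + j) + β * η * roundSum τ Z r := by
      intro j hj
      have hj' := Finset.mem_range.1 hj
      have h2 := step r (τ - j) (Nat.sub_le _ _)
      rw [Nat.sub_sub_self hj'.le] at h2
      refine h2.trans (add_le_add_right (mul_le_mul_of_nonneg_left ?_ (by positivity)) _)
      have h3 : ∑ i ∈ Finset.range (τ - j), Z (τ * r + (j + i))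
          = ∑ i ∈ Finset.Ico j τ, Z (τ * r + i) := by
        rw [Finset.sum_Ico_eq_sum_range]
      rw [h3, roundSum]
      refine Finset.sum_le_sum_of_subset_of_nonneg ?_ fun _ _ _ => hZ0 _
      intro i hi
      exact Finset.mem_range.2 (Finset.mem_Ico.1 hi).2
    have h4 := Finset.sum_le_sum h1
    rw [Finset.sum_const, Finset.card_range, nsmul_eq_mul, Finset.sum_add_distrib,
      Finset.sum_const, Finset.card_range, nsmul_eq_mul] at h4
    simp only [roundSum] at h4 ⊢
    linarith
  have h1 := Finset.sum_le_sum fun r (_ : r ∈ Finset.range R) => round r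
  rw [← Finset.mul_sum, Finset.sum_add_distrib, ← Finset.mul_sum, sum_roundSum, sum_roundSum] at h1
  -- The weights `ε / (4 * Λ)` and `ε / ρ` are chosen so that the constant parts cost `N * ε / 8`
  -- and `N * ε / 16`, and the quadratic parts fit under `2 * Λ / ε` times the left side of `hsum`,
  -- another `N * ε / 8`. The total stays below `N * ε / 2`.
  have h2 := Finset.sum_le_sum fun t (_ : t ∈ Finset.range (τ * R)) =>
    hBH t (ε / (4 * Λ)) (by positivity)
  have h3 := Finset.sum_le_sum fun t (_ : t ∈ Finset.range (τ * R)) =>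
    hZU t (ε / ρ) (by positivity)
  rw [← Finset.mul_sum, Finset.sum_add_distrib, Finset.sum_const, Finset.card_range, nsmul_eq_mul,
    ← Finset.sum_div] at h2 h3
  have hN : (0 : ℝ) ≤ (τ * R : ℕ) := by positivity
  have hNeq : ((τ * R : ℕ) : ℝ) = τ * R := by push_cast; rfl
  have hSZ : 0 ≤ ∑ t ∈ Finset.range (τ * R), Z t := Finset.sum_nonneg fun t _ => hZ0 t
  have hSU : 0 ≤ ∑ t ∈ Finset.range (τ * R), U t := Finset.sum_nonneg fun t _ => hU0 t
  set N : ℝ := ((τ * R : ℕ) : ℝ)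
  set SH := ∑ t ∈ Finset.range (τ * R), H t
  set SU := ∑ t ∈ Finset.range (τ * R), U t
  set SZ := ∑ t ∈ Finset.range (τ * R), Z t
  set SB := ∑ t ∈ Finset.range (τ * R), B t
  have h4 : τ * (β * η) * SZ ≤ ρ / 8 * SZ := mul_le_mul_of_nonneg_right (by linarith) hSZ
  have h5 : SB ≤ N * ε / 8 + 2 * Λ / ε * SH := by
    refine h2.trans (le_of_eq ?_); field_simp; ring
  have h6 : ρ / 8 * SZ ≤ N * ε / 16 + ρ ^ 2 / (16 * ε) * SU := by
    refine (mul_le_mul_of_nonneg_left h3 (by positivity)).trans (le_of_eq ?_); field_simp; ring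
  have h7 : ρ ^ 2 / (16 * ε) * SU ≤ 2 * Λ / ε * (ρ / 4 * SU) := by
    have : 2 * Λ / ε * (ρ / 4 * SU) = Λ * ρ / (2 * ε) * SU := by field_simp; ring
    rw [this]
    apply mul_le_mul_of_nonneg_right _ hSU
    rw [div_le_div_iff₀ (by positivity) (by positivity)]
    have : ρ * ρ ≤ Λ * ρ := by gcongr
    have h8 : 0 < Λ * ρ := by positivity
    nlinarith
  have h8 : 2 * Λ / ε * (SH + ρ / 4 * SU) ≤ N * ε / 8 := by
    refine (mul_le_mul_of_nonneg_left hsum (by positivity)).trans (le_of_eq ?_)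
    field_simp; ring
  have h9 : τ * ∑ r ∈ Finset.range R, B (τ * (r + 1)) ≤ τ * (R * (ε / 2)) := by
    have : (0:ℝ) ≤ N * ε := by positivity
    have e : τ * (R * (ε / 2)) = N * ε / 2 := by rw [hNeq]; ring
    rw [e]
    linarith
  exact le_of_mul_le_mul_left h9 hτ'

/-! ### Expected error quantities and their recursions -/

namespace FedProcess

variable {K d : ℕ} {𝒵 Ω : Type*} [MeasurableSpace 𝒵] [mΩ : MeasurableSpace Ω]
  (P : FedProcess K d 𝒵 Ω)

/-- The expected squared error of the averaged momentum. -/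
noncomputable def errSq (t : ℕ) : ℝ := ∫ ω, ‖nodeMean fun k => P.err t k ω‖ ^ 2 ∂P.Pr

/-- The expected spread of the momentum errors. -/
noncomputable def errVar (t : ℕ) : ℝ := ∫ ω, nodeVar fun k => P.err t k ω ∂P.Pr

/-- The expected squared noise. -/
noncomputable def noiseSq (t : ℕ) : ℝ := ∫ ω, nodeSq fun k => P.noise t k ω ∂P.Pr

/-- The expected spread of the iterates. -/
noncomputable def iterVar (t : ℕ) : ℝ := ∫ ω, nodeVar fun k => P.x t k ω ∂P.Pr

/-- The expected spread of the new momenta. -/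
noncomputable def momVar (t : ℕ) : ℝ := ∫ ω, nodeVar fun k => P.newM t k ω ∂P.Pr

/-- The expected squared length of the averaged update direction. -/
noncomputable def dirSq (t : ℕ) : ℝ := ∫ ω, ‖P.dir t ω‖ ^ 2 ∂P.Pr

/-- The expected squared length of the last moves of the nodes. -/
noncomputable def moveSq (t : ℕ) : ℝ := ∫ ω, nodeSq fun k => P.x t k ω - P.xPrev t k ω ∂P.Pr

/-- The expected preconditioned squared gradient at the model. -/
noncomputable def gradForm (t : ℕ) : ℝ :=
  ∫ ω, precondForm P.ρ (P.a t ω) (P.F' (P.w t ω)) ∂P.Pr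

section Integrable

variable (t : ℕ)

theorem integrable_errSq : Integrable (fun ω => ‖nodeMean fun k => P.err t k ω‖ ^ 2) P.Pr :=
  P.integrable_of_bdd (BddMeasurable.nodeMean (P.bdd_err t)).norm_sq

theorem integrable_errVar : Integrable (fun ω => nodeVar fun k => P.err t k ω) P.Pr :=
  P.integrable_of_bdd (BddMeasurable.nodeVar (P.bdd_err t))

theorem integrable_noiseSq : Integrable (fun ω => nodeSq fun k => P.noise t k ω) P.Pr :=
  P.integrable_of_bdd (BddMeasurable.nodeSq (P.bdd_noise' t))

theorem integrable_iterVar : Integrable (fun ω => nodeVar fun k => P.x t k ω) P.Pr :=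
  P.integrable_of_bdd (BddMeasurable.nodeVar (P.bdd_x t))

theorem integrable_momVar : Integrable (fun ω => nodeVar fun k => P.newM t k ω) P.Pr :=
  P.integrable_of_bdd (BddMeasurable.nodeVar fun k => (P.bdd_new t k).2.1)

theorem integrable_dirSq : Integrable (fun ω => ‖P.dir t ω‖ ^ 2) P.Pr :=
  P.integrable_of_bdd (P.bdd_dir t).norm_sq

theorem integrable_dir : Integrable (fun ω => ‖P.dir t ω‖) P.Pr :=
  P.integrable_of_bdd (P.bdd_dir t).norm

theorem integrable_moveSq :
    Integrable (fun ω => nodeSq fun k => P.x t k ω - P.xPrev t k ω) P.Pr :=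
  P.integrable_of_bdd (BddMeasurable.nodeSq fun k => (P.bdd_x t k).sub (P.bdd_xPrev t k))

theorem integrable_gradForm :
    Integrable (fun ω => precondForm P.ρ (P.a t ω) (P.F' (P.w t ω))) P.Pr :=
  P.integrable_of_bdd (P.bdd_form t)

theorem integrable_gradient : Integrable (fun ω => ‖P.F' (P.w t ω)‖) P.Pr :=
  P.integrable_of_bdd (P.bdd_gradient t).norm

theorem integrable_F : Integrable (fun ω => P.F (P.w t ω)) P.Pr :=
  P.integrable_of_bdd ((P.bdd_w t).comp P.continuous_F)

end Integrable

theorem integral_inner_noise_of_past {t : ℕ} {Y : Ω → Vec d} (hY : BddMeasurable (P.past t) Y)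
    (k : Fin K) : ∫ ω, inner ℝ (Y ω) (P.noise t k ω) ∂P.Pr = 0 :=
  P.integral_inner_noise (not_mem_past t k) le_rfl hY

theorem integrable_inner_noise {t : ℕ} {Y : Ω → Vec d} (hY : BddMeasurable (P.past t) Y)
    (k : Fin K) : Integrable (fun ω => (inner ℝ (Y ω) (P.noise t k ω) : ℝ)) P.Pr :=
  P.integrable_of_bdd ((hY.mono (P.past_mono t)).inner (P.bdd_noise' t k))

/-- Enlarging the past by the current sample of node `j` makes its noise measurable while the sample
of node `k` stays fresh, so orthogonality to the past applies. -/
theorem integral_inner_noise_noise (t : ℕ) {j k : Fin K} (hjk : j ≠ k) :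
    ∫ ω, inner ℝ (P.noise t j ω) (P.noise t k ω) ∂P.Pr = 0 := by
  have hsub : {p : ℕ × Fin K | p.1 < t} ⊆ {p | p.1 < t} ∪ {(t, j)} := Set.subset_union_left
  have hpast : P.past t ≤ P.sigma ({p | p.1 < t} ∪ {(t, j)}) := sampleSigma_mono _ hsub
  refine P.integral_inner_noise (S := {p | p.1 < t} ∪ {(t, j)}) ?_ hpast
    (P.bdd_noise t j hpast ?_)
  · rintro (h | h)
    · exact lt_irrefl t h
    · exact hjk (by simpa using (congrArg Prod.snd h).symm)
  · exact measurable_sampleSigma (fun p : ℕ × Fin K => P.ξ p.1 p.2) (i := (t, j))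
      (Set.mem_union_right _ rfl)

/-- Averaging over the nodes reduces the variance of the noise by the factor `K`. -/
theorem integral_nodeMean_noise_sq (t : ℕ) :
    ∫ ω, ‖nodeMean fun k => P.noise t k ω‖ ^ 2 ∂P.Pr = P.noiseSq t / K := by
  have h1 : ∀ ω, ‖nodeMean fun k => P.noise t k ω‖ ^ 2
      = (1 / (K : ℝ)) ^ 2 * ∑ j, ∑ k, (inner ℝ (P.noise t j ω) (P.noise t k ω) : ℝ) := by
    intro ω
    rw [nodeMean, norm_smul, mul_pow, Real.norm_eq_abs, sq_abs, ← real_inner_self_eq_norm_sq,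
      sum_inner]
    simp only [inner_sum]
  have hint : ∀ j k, Integrable (fun ω => (inner ℝ (P.noise t j ω) (P.noise t k ω) : ℝ)) P.Pr :=
    fun j k => P.integrable_of_bdd ((P.bdd_noise' t j).inner (P.bdd_noise' t k))
  simp only [h1]
  rw [integral_const_mul, integral_finsetSum _ fun j _ => integrable_finsetSum _ fun k _ => hint j k]
  have h2 : ∀ j, ∫ ω, ∑ k, (inner ℝ (P.noise t j ω) (P.noise t k ω) : ℝ) ∂P.Pr
      = ∫ ω, ‖P.noise t j ω‖ ^ 2 ∂P.Pr := by
    intro j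
    rw [integral_finsetSum _ fun k _ => hint j k, Finset.sum_eq_single j]
    · simp only [real_inner_self_eq_norm_sq]
    · intro k _ hk
      exact P.integral_inner_noise_noise t hk.symm
    · intro h; exact absurd (Finset.mem_univ j) h
  simp only [h2, noiseSq, nodeSq]
  rw [integral_const_mul, integral_finsetSum _ fun k _ =>
    P.integrable_of_bdd (P.bdd_noise' t k).norm_sq]
  ring

/-- The cross term between old averaged error and fresh noise has mean zero. Communication plays no
role here, since it preserves the average momentum. -/
theorem errSq_succ (t : ℕ) :
    P.errSq (t + 1) = (1 - P.α t) ^ 2 * P.errSq t + P.noiseSq t / K := by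
  rw [← integral_nodeMean_noise_sq, errSq]
  have hE : BddMeasurable (P.past t) fun ω => nodeMean fun k => P.err t k ω :=
    BddMeasurable.nodeMean (P.bdd_err t)
  have hN : BddMeasurable (P.past (t + 1)) fun ω => nodeMean fun k => P.noise t k ω :=
    BddMeasurable.nodeMean (P.bdd_noise' t)
  have h1 : ∀ ω, ‖nodeMean fun k => P.err (t + 1) k ω‖ ^ 2
      = (1 - P.α t) ^ 2 * ‖nodeMean fun k => P.err t k ω‖ ^ 2
        + 2 * (1 - P.α t) * ((1 / (K : ℝ)) *
          ∑ k, (inner ℝ (nodeMean fun k => P.err t k ω) (P.noise t k ω) : ℝ))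
        + ‖nodeMean fun k => P.noise t k ω‖ ^ 2 := by
    intro ω
    have h0 : (1 / (K : ℝ)) * ∑ k, (inner ℝ (nodeMean fun k => P.err t k ω) (P.noise t k ω) : ℝ)
        = inner ℝ (nodeMean fun k => P.err t k ω) (nodeMean fun k => P.noise t k ω) := by
      conv_rhs => rw [nodeMean.eq_1 fun k => P.noise t k ω, real_inner_smul_right, inner_sum]
    rw [nodeMean_err_succ, norm_add_sq_real, norm_smul, mul_pow, Real.norm_eq_abs, sq_abs,
      real_inner_smul_left, h0]
    ring
  have i1 : Integrable (fun ω => (1 - P.α t) ^ 2 * ‖nodeMean fun k => P.err t k ω‖ ^ 2) P.Pr :=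
    (P.integrable_errSq t).const_mul _
  have i2 : Integrable (fun ω => 2 * (1 - P.α t) * ((1 / (K : ℝ)) *
      ∑ k, (inner ℝ (nodeMean fun k => P.err t k ω) (P.noise t k ω) : ℝ))) P.Pr :=
    ((integrable_finsetSum _ fun k _ => P.integrable_inner_noise hE k).const_mul _).const_mul _
  have i3 : Integrable (fun ω => ‖nodeMean fun k => P.noise t k ω‖ ^ 2) P.Pr :=
    P.integrable_of_bdd hN.norm_sq
  have i12 : Integrable (fun ω => (1 - P.α t) ^ 2 * ‖nodeMean fun k => P.err t k ω‖ ^ 2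
      + 2 * (1 - P.α t) * ((1 / (K : ℝ)) *
        ∑ k, (inner ℝ (nodeMean fun k => P.err t k ω) (P.noise t k ω) : ℝ))) P.Pr := i1.add i2
  simp only [h1]
  rw [integral_add i12 i3, integral_add i1 i2, integral_const_mul, integral_const_mul,
    integral_const_mul, integral_finsetSum _ fun k _ => P.integrable_inner_noise hE k]
  simp only [P.integral_inner_noise_of_past hE]
  simp [errSq]

/-- The expected spread of the momentum errors before communication. -/
theorem integral_nodeVar_newErr_le (t : ℕ) :
    ∫ ω, nodeVar (fun k => (1 - P.α t) • P.err t k ω + P.noise t k ω) ∂P.Pr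
      ≤ P.errVar t + P.noiseSq t := by
  have hE : ∀ k, BddMeasurable (P.past t)
      fun ω => P.err t k ω - nodeMean fun k => P.err t k ω := fun k =>
    (P.bdd_err t k).sub (BddMeasurable.nodeMean (P.bdd_err t))
  have i1 : Integrable (fun ω => (1 - P.α t) ^ 2 * nodeVar fun k => P.err t k ω) P.Pr :=
    (P.integrable_errVar t).const_mul _
  have i2 : Integrable (fun ω => 2 * (1 - P.α t) * ((1 / (K : ℝ)) *
      ∑ k, (inner ℝ (P.err t k ω - nodeMean fun k => P.err t k ω) (P.noise t k ω) : ℝ))) P.Pr :=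
    ((integrable_finsetSum _ fun k _ => P.integrable_inner_noise (hE k) k).const_mul _).const_mul _
  have h1 := integral_mono_of_nonneg (μ := P.Pr)
    (Filter.Eventually.of_forall fun ω => nodeVar_nonneg _) ((i1.add i2).add (P.integrable_noiseSq t))
    (Filter.Eventually.of_forall fun ω => nodeVar_smul_add_le P.K_pos (1 - P.α t)
      (fun k => P.err t k ω) (fun k => P.noise t k ω))
  refine h1.trans ?_
  have h2 := integral_add (i1.add i2) (P.integrable_noiseSq t)
  refine h2.le.trans ?_
  have h3 := integral_add i1 i2
  rw [integral_const_mul, integral_const_mul, integral_const_mul,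
    integral_finsetSum _ fun k _ => P.integrable_inner_noise (hE k) k] at h3
  simp only [fun k => P.integral_inner_noise_of_past (hE k) k, Finset.sum_const_zero, mul_zero,
    add_zero] at h3
  refine (add_le_add h3.le le_rfl).trans (add_le_add ?_ le_rfl)
  -- The contraction can be given up: in the main phase `α` is so small that it is not needed over
  -- the `τ` steps of one round.
  have h4 : (1 - P.α t) ^ 2 ≤ 1 := by nlinarith [(P.α_mem t).1, (P.α_mem t).2]
  exact mul_le_of_le_one_left (integral_nonneg fun ω => nodeVar_nonneg _) h4

theorem errVar_succ (t : ℕ) (h : ¬ P.τ ∣ t + 1) :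
    P.errVar (t + 1) ≤ P.errVar t + P.noiseSq t := by
  refine le_trans (le_of_eq ?_) (P.integral_nodeVar_newErr_le t)
  simp only [errVar, P.nodeVar_err_succ t _ h]

theorem errVar_succ_of_dvd (t : ℕ) (h : P.τ ∣ t + 1) :
    P.errVar (t + 1) ≤ P.β ^ 2 * P.iterVar t := by
  rw [errVar, iterVar, ← integral_const_mul]
  exact integral_mono (P.integrable_errVar _) ((P.integrable_iterVar t).const_mul _)
    fun ω => P.nodeVar_err_succ_of_dvd t ω h

theorem momVar_le (t : ℕ) :
    P.momVar t ≤ 2 * (P.errVar t + P.noiseSq t) + 2 * P.β ^ 2 * P.iterVar t := by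
  have i1 : Integrable (fun ω => nodeVar fun k => (1 - P.α t) • P.err t k ω + P.noise t k ω) P.Pr :=
    P.integrable_of_bdd (BddMeasurable.nodeVar fun k =>
      (((P.bdd_err t k).mono (P.past_mono t)).const_smul _).add (P.bdd_noise' t k))
  have h1 := integral_mono (P.integrable_momVar t)
    ((i1.const_mul 2).add ((P.integrable_iterVar t).const_mul (2 * P.β ^ 2)))
    fun ω => P.nodeVar_newM_le t ω
  have h2 := integral_add (i1.const_mul 2) ((P.integrable_iterVar t).const_mul (2 * P.β ^ 2))
  rw [integral_const_mul, integral_const_mul] at h2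
  have h3 := P.integral_nodeVar_newErr_le t
  have h4 := h1.trans h2.le
  simp only [momVar, iterVar] at h4 ⊢
  linarith

theorem noiseSq_le (t : ℕ) :
    P.noiseSq t ≤ 2 * P.α t ^ 2 * P.σ ^ 2 + 2 * P.L ^ 2 * P.moveSq t := by
  have hK : (K : ℝ) ≠ 0 := by have := P.K_pos; positivity
  simp only [noiseSq, moveSq, nodeSq]
  rw [integral_const_mul, integral_const_mul, integral_finsetSum _ fun k _ =>
    P.integrable_of_bdd (P.bdd_noise' t k).norm_sq, integral_finsetSum _ fun k _ =>
    P.integrable_of_bdd ((P.bdd_x t k).sub (P.bdd_xPrev t k)).norm_sq]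
  have h1 := Finset.sum_le_sum fun k (_ : k ∈ Finset.univ) => P.integral_noise_sq_le t k
  rw [Finset.sum_add_distrib, Finset.sum_const, Finset.card_univ, Fintype.card_fin, nsmul_eq_mul,
    ← Finset.mul_sum] at h1
  have h2 := mul_le_mul_of_nonneg_left h1 (by positivity : 0 ≤ 1 / (K : ℝ))
  refine h2.trans (le_of_eq ?_)
  field_simp

theorem moveSq_succ (t : ℕ) (h : ¬ P.τ ∣ t + 1) :
    P.moveSq (t + 1) ≤ P.η t ^ 2 * P.dirSq t + (P.η t / P.ρ) ^ 2 * P.momVar t := by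
  rw [moveSq, dirSq, momVar, ← integral_const_mul, ← integral_const_mul,
    ← integral_add ((P.integrable_dirSq t).const_mul _) ((P.integrable_momVar t).const_mul _)]
  exact integral_mono (P.integrable_moveSq _)
    (((P.integrable_dirSq t).const_mul _).add ((P.integrable_momVar t).const_mul _))
    fun ω => P.nodeSq_move_succ_le t ω h

theorem moveSq_succ_of_dvd (t : ℕ) (h : P.τ ∣ t + 1) :
    P.moveSq (t + 1) ≤ P.η t ^ 2 * P.dirSq t + P.iterVar t := by
  rw [moveSq, dirSq, iterVar, ← integral_const_mul,
    ← integral_add ((P.integrable_dirSq t).const_mul _) (P.integrable_iterVar t)]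
  exact integral_mono (P.integrable_moveSq _)
    (((P.integrable_dirSq t).const_mul _).add (P.integrable_iterVar t))
    fun ω => P.nodeSq_move_succ_le_of_dvd t ω h

theorem iterVar_of_dvd (t : ℕ) (h : P.τ ∣ t) : P.iterVar t = 0 := by
  simp [iterVar, P.nodeVar_x_of_dvd t _ h]

theorem iterVar_succ (t : ℕ) (h : ¬ P.τ ∣ t + 1) {l : ℝ} (hl : 0 < l) :
    P.iterVar (t + 1) ≤ (1 + l) * P.iterVar t
      + (1 + 1 / l) * ((P.η t / P.ρ) ^ 2 * P.momVar t) := by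
  rw [iterVar, iterVar, momVar, ← integral_const_mul, ← integral_const_mul, ← integral_const_mul,
    ← integral_add ((P.integrable_iterVar t).const_mul _)
      (((P.integrable_momVar t).const_mul _).const_mul _)]
  exact integral_mono (P.integrable_iterVar _) (((P.integrable_iterVar t).const_mul _).add
    (((P.integrable_momVar t).const_mul _).const_mul _))
    fun ω => P.nodeVar_x_succ_le t ω h hl

theorem integral_F_succ_le (t : ℕ) (hη : 4 * P.β * P.η t ≤ P.ρ) :
    ∫ ω, P.F (P.w (t + 1) ω) ∂P.Pr ≤ ∫ ω, P.F (P.w t ω) ∂P.Pr - P.η t / 2 * P.gradForm t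
      - P.η t * P.ρ / 4 * P.dirSq t
      + P.η t / P.ρ * (P.errSq (t + 1) + P.β ^ 2 * P.iterVar t) := by
  have i1 := P.integrable_F t
  have i2 := (P.integrable_gradForm t).const_mul (P.η t / 2)
  have i3 := (P.integrable_dirSq t).const_mul (P.η t * P.ρ / 4)
  have i4 := (P.integrable_iterVar t).const_mul (P.β ^ 2)
  have i12 : Integrable (fun ω => P.F (P.w t ω)
      - P.η t / 2 * precondForm P.ρ (P.a t ω) (P.F' (P.w t ω))) P.Pr := i1.sub i2
  have i123 : Integrable (fun ω => P.F (P.w t ω)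
      - P.η t / 2 * precondForm P.ρ (P.a t ω) (P.F' (P.w t ω))
      - P.η t * P.ρ / 4 * ‖P.dir t ω‖ ^ 2) P.Pr := i12.sub i3
  have i5 : Integrable (fun ω => P.η t / P.ρ * (‖nodeMean fun k => P.err (t + 1) k ω‖ ^ 2
      + P.β ^ 2 * nodeVar fun k => P.x t k ω)) P.Pr :=
    ((P.integrable_errSq (t + 1)).add i4).const_mul (P.η t / P.ρ)
  rw [gradForm, dirSq, errSq, iterVar, ← integral_const_mul, ← integral_const_mul,
    ← integral_const_mul, ← integral_add (P.integrable_errSq (t + 1)) i4, ← integral_const_mul,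
    ← integral_sub i1 i2, ← integral_sub i12 i3, ← integral_add i123 i5]
  exact integral_mono (P.integrable_F (t + 1)) (i123.add i5)
    fun ω => P.F_w_succ_le t ω hη

theorem integral_gradient_succ_le (t : ℕ) :
    ∫ ω, ‖P.F' (P.w (t + 1) ω)‖ ∂P.Pr
      ≤ ∫ ω, ‖P.F' (P.w t ω)‖ ∂P.Pr + P.β * P.η t * ∫ ω, ‖P.dir t ω‖ ∂P.Pr := by
  rw [← integral_const_mul, ← integral_add (P.integrable_gradient t)
    ((P.integrable_dir t).const_mul _)]
  exact integral_mono (P.integrable_gradient _)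
    ((P.integrable_gradient t).add ((P.integrable_dir t).const_mul _))
    fun ω => P.norm_gradient_succ_le t ω

theorem integral_dir_le (t : ℕ) {δ : ℝ} (hδ : 0 < δ) :
    ∫ ω, ‖P.dir t ω‖ ∂P.Pr ≤ 1 / 2 * (δ + P.dirSq t / δ) := by
  have i1 : Integrable (fun ω => 1 / 2 * (δ + ‖P.dir t ω‖ ^ 2 / δ)) P.Pr :=
    ((integrable_const _).add ((P.integrable_dirSq t).div_const _)).const_mul _
  refine (integral_mono (P.integrable_dir t) i1 fun ω => ?_).trans (le_of_eq ?_)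
  · have h1 : δ + ‖P.dir t ω‖ ^ 2 / δ - 2 * ‖P.dir t ω‖ = (δ - ‖P.dir t ω‖) ^ 2 / δ := by
      field_simp; ring
    have h2 : 0 ≤ (δ - ‖P.dir t ω‖) ^ 2 / δ := by positivity
    show ‖P.dir t ω‖ ≤ 1 / 2 * (δ + ‖P.dir t ω‖ ^ 2 / δ)
    linarith
  · rw [integral_const_mul, integral_add (integrable_const _) ((P.integrable_dirSq t).div_const _),
      integral_div]
    simp [dirSq]

theorem integrable_sum_v (t : ℕ) (k : Fin K) : Integrable (fun ω => ∑ i, P.v t k ω i) P.Pr :=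
  P.integrable_of_bdd ((P.bdd_v t k).comp (φ := fun v : Fin d → ℝ => ∑ i, v i) (by fun_prop))

theorem integrable_sum_newV (t : ℕ) (k : Fin K) :
    Integrable (fun ω => ∑ i, P.newV t k ω i) P.Pr :=
  P.integrable_of_bdd
    ((P.bdd_new t k).2.2.comp (φ := fun v : Fin d → ℝ => ∑ i, v i) (by fun_prop))

theorem integrable_sum_a (t : ℕ) : Integrable (fun ω => ∑ i, P.a t ω i) P.Pr :=
  P.integrable_of_bdd ((P.bdd_a t).comp (φ := fun v : Fin d → ℝ => ∑ i, v i) (by fun_prop))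

theorem integral_average_newV_le (t : ℕ)
    (h : ∀ k, ∫ ω, ∑ i, P.newV t k ω i ∂P.Pr ≤ P.σ ^ 2 + P.G ^ 2) :
    ∫ ω, ∑ i, (1 / (K : ℝ)) * ∑ j, P.newV t j ω i ∂P.Pr ≤ P.σ ^ 2 + P.G ^ 2 := by
  have hK : (0 : ℝ) < K := by exact_mod_cast P.K_pos
  have h1 : ∀ ω, ∑ i, (1 / (K : ℝ)) * ∑ j, P.newV t j ω i
      = (1 / (K : ℝ)) * ∑ j, ∑ i, P.newV t j ω i := fun ω => by
    rw [← Finset.mul_sum, Finset.sum_comm]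
  simp only [h1]
  rw [integral_const_mul, integral_finsetSum _ fun j _ => P.integrable_sum_newV t j]
  have h2 := Finset.sum_le_sum fun k (_ : k ∈ Finset.univ) => h k
  rw [Finset.sum_const, Finset.card_univ, Fintype.card_fin, nsmul_eq_mul] at h2
  refine (mul_le_mul_of_nonneg_left h2 (by positivity)).trans (le_of_eq ?_)
  field_simp

theorem integral_sum_newV_le (t : ℕ) (k : Fin K)
    (h : ∫ ω, ∑ i, P.v t k ω i ∂P.Pr ≤ P.σ ^ 2 + P.G ^ 2) :
    ∫ ω, ∑ i, P.newV t k ω i ∂P.Pr ≤ P.σ ^ 2 + P.G ^ 2 := by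
  simp only [sum_newV]
  rw [integral_add ((P.integrable_sum_v t k).const_mul _)
    ((P.integrable_of_bdd (P.bdd_new t k).1.norm_sq).const_mul _), integral_const_mul,
    integral_const_mul]
  have h1 := mul_le_mul_of_nonneg_left h (P.β₂_mem t).1
  have h2 := mul_le_mul_of_nonneg_left (P.integral_grad_sq_le t k)
    (by linarith [(P.β₂_mem t).2] : 0 ≤ 1 - P.β₂ t)
  linarith

theorem integral_sum_v_le (t : ℕ) :
    ∀ k, ∫ ω, ∑ i, P.v t k ω i ∂P.Pr ≤ P.σ ^ 2 + P.G ^ 2 := by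
  induction t with
  | zero => intro k; simp only [v_zero]; simp; positivity
  | succ t ih =>
    have hnew := fun k => P.integral_sum_newV_le t k (ih k)
    intro k
    by_cases h : P.τ ∣ t + 1
    · simp only [P.v_succ_of_dvd t k _ h]
      exact P.integral_average_newV_le t hnew
    · simp only [P.v_succ t k _ h]
      exact hnew k

/-- The trace of `v` is updated by convex combinations with squared gradient norms and by averaging
over nodes; neither can exceed the second-moment bound, whatever the values of `β₂`. -/
theorem integral_sum_a_le (t : ℕ) : ∫ ω, ∑ i, P.a t ω i ∂P.Pr ≤ P.σ ^ 2 + P.G ^ 2 := by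
  induction t with
  | zero => simp only [a_zero]; simp; positivity
  | succ t ih =>
    by_cases h : P.τ ∣ t + 1
    · simp only [P.a_succ_of_dvd t _ h]
      exact P.integral_average_newV_le t fun k => P.integral_sum_newV_le t k
        (P.integral_sum_v_le t k)
    · simp only [P.a_succ t _ h]
      exact ih

/-- Because the pathwise bound is affine in the trace of `a`, its expectation replaces the random
matrix by a constant depending only on `ρ`, `σ` and `G`. -/
theorem integral_gradient_le (t : ℕ) {δ : ℝ} (hδ : 0 < δ) :
    ∫ ω, ‖P.F' (P.w t ω)‖ ∂P.Pr
      ≤ 1 / 2 * (δ * (P.ρ + (1 + (P.σ ^ 2 + P.G ^ 2)) / 2) + P.gradForm t / δ) := by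
  have i1 : Integrable (fun ω => (1 + ∑ i, P.a t ω i) / 2) P.Pr :=
    ((integrable_const _).add (P.integrable_sum_a t)).div_const _
  have ia : Integrable (fun ω => δ * (P.ρ + (1 + ∑ i, P.a t ω i) / 2)) P.Pr :=
    ((integrable_const _).add i1).const_mul _
  have ib := (P.integrable_gradForm t).div_const δ
  refine (integral_mono (P.integrable_gradient t) ((ia.add ib).const_mul (1 / 2)) fun ω =>
    norm_le_precondForm P.ρ_pos _ (P.a_nonneg t ω) _ hδ).trans ?_
  have h1 := integral_add ia ib
  have h2 : ∫ ω, δ * (P.ρ + (1 + ∑ i, P.a t ω i) / 2) ∂P.Pr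
      = δ * (P.ρ + (1 + ∫ ω, ∑ i, P.a t ω i ∂P.Pr) / 2) := by
    rw [integral_const_mul, integral_add (integrable_const _) i1, integral_div,
      integral_add (integrable_const _) (P.integrable_sum_a t)]
    simp
  rw [integral_const_mul]
  refine mul_le_mul_of_nonneg_left (h1.le.trans ?_) (by norm_num)
  rw [h2, integral_div]
  refine add_le_add (mul_le_mul_of_nonneg_left ?_ hδ.le) le_rfl
  linarith [P.integral_sum_a_le t]

end FedProcess

/-! ### The phase at rest and convergence of the process -/

namespace FedProcess

variable {K d : ℕ} {𝒵 Ω : Type*} [MeasurableSpace 𝒵] [mΩ : MeasurableSpace Ω]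
  (P : FedProcess K d 𝒵 Ω)

section InitialPhase

variable {T : ℕ}

theorem x_initial (hη : ∀ t, t < T → P.η t = 0) :
    ∀ t, t ≤ T → ∀ k ω, P.x t k ω = P.w₀ ∧ P.xPrev t k ω = P.w₀ := by
  intro t
  induction t with
  | zero => exact fun _ k ω => ⟨P.x_zero k ω, P.xPrev_zero k ω⟩
  | succ t ih =>
    intro ht k ω
    have ih' := ih (by omega)
    have h0 := hη t (by omega)
    refine ⟨?_, (P.xPrev_succ t k ω).trans (ih' k ω).1⟩
    by_cases h : P.τ ∣ t + 1
    · rw [P.x_succ_of_dvd t k ω h]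
      simp only [h0, zero_smul, sub_zero, fun k => (ih' k ω).1]
      exact nodeMean_const P.K_pos _
    · rw [P.x_succ t k ω h, h0, zero_smul, sub_zero, (ih' k ω).1]

theorem w_initial (hη : ∀ t, t < T → P.η t = 0) {t : ℕ} (ht : t ≤ T) (ω : Ω) :
    P.w t ω = P.w₀ := by
  rw [w]
  simp only [fun k => (P.x_initial hη t ht k ω).1]
  exact nodeMean_const P.K_pos _

theorem moveSq_initial (hη : ∀ t, t < T → P.η t = 0) {t : ℕ} (ht : t ≤ T) : P.moveSq t = 0 := by
  simp [moveSq, (P.x_initial hη t ht _ _).1, (P.x_initial hη t ht _ _).2, nodeSq]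

theorem errVar_initial (hη : ∀ t, t < T → P.η t = 0) (hT : 0 < T) (hdvd : P.τ ∣ T) :
    P.errVar T ≤ 0 := by
  obtain ⟨t, rfl⟩ : ∃ t, T = t + 1 := ⟨T - 1, by omega⟩
  -- The phase at rest ends with a communication and all iterates still agree, so the momentum
  -- errors have no spread left.
  refine (P.errVar_succ_of_dvd t hdvd).trans (le_of_eq ?_)
  simp [iterVar, (P.x_initial hη t (Nat.le_succ t) _ _).1, nodeVar_const P.K_pos]

/-- At a fixed point the averaged momentum with `α t = 1 / (t + 1)` is the sample mean. -/
theorem errSq_initial (hη : ∀ t, t < T → P.η t = 0)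
    (hα : ∀ t, t < T → P.α t = 1 / ((t : ℝ) + 1)) :
    ∀ t, t ≤ T → K * t * P.errSq t ≤ 2 * P.σ ^ 2 := by
  have hK : (0 : ℝ) < K := by exact_mod_cast P.K_pos
  intro t
  induction t with
  | zero => intro _; simp; positivity
  | succ t ih =>
    intro ht
    have h1 := ih (by omega)
    have h2 := P.noiseSq_le t
    rw [P.moveSq_initial hη (by omega : t ≤ T), hα t (by omega)] at h2
    rw [P.errSq_succ, hα t (by omega)]
    have ht' : (0 : ℝ) < t + 1 := by positivity
    have h3 : P.noiseSq t / K ≤ (2 * (1 / ((t : ℝ) + 1)) ^ 2 * P.σ ^ 2) / K := by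
      gcongr; linarith
    -- With `α t = 1 / (t + 1)` the new value of `K * t * errSq` is at most a weighted mean of the
    -- old value and `2 * σ ^ 2`, so that level is preserved. The factor 2 comes from the general
    -- noise bound.
    have h4 : (K : ℝ) * ((t + 1 : ℕ) : ℝ) * ((1 - 1 / ((t : ℝ) + 1)) ^ 2 * P.errSq t
        + (2 * (1 / ((t : ℝ) + 1)) ^ 2 * P.σ ^ 2) / K)
        = (t * (K * t * P.errSq t) + 2 * P.σ ^ 2) / (t + 1) := by
      push_cast
      field_simp
      ring
    calc (K : ℝ) * ((t + 1 : ℕ) : ℝ) * ((1 - 1 / ((t : ℝ) + 1)) ^ 2 * P.errSq t + P.noiseSq t / K)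
        ≤ (K : ℝ) * ((t + 1 : ℕ) : ℝ) * ((1 - 1 / ((t : ℝ) + 1)) ^ 2 * P.errSq t
        + (2 * (1 / ((t : ℝ) + 1)) ^ 2 * P.σ ^ 2) / K) := by gcongr
      _ = (t * (K * t * P.errSq t) + 2 * P.σ ^ 2) / (t + 1) := h4
      _ ≤ (t * (2 * P.σ ^ 2) + 2 * P.σ ^ 2) / (t + 1) := by gcongr
      _ = 2 * P.σ ^ 2 := by field_simp

end InitialPhase

/-- After an initial phase at rest the error quantities satisfy the recursion for constant
parameters. -/
theorem roundRecursion {R₀ : ℕ} (hτ : 0 < P.τ) (hR₀ : 0 < R₀) {η α : ℝ}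
    (hη0 : ∀ t, t < P.τ * R₀ → P.η t = 0) (hη : ∀ t, P.η (P.τ * R₀ + t) = η)
    (hα : ∀ t, P.α (P.τ * R₀ + t) = α) :
    RoundRecursion P.τ K P.β P.L P.σ P.ρ η α (fun t => P.errSq (P.τ * R₀ + t))
      (fun t => P.errVar (P.τ * R₀ + t)) (fun t => P.noiseSq (P.τ * R₀ + t))
      (fun t => P.iterVar (P.τ * R₀ + t)) (fun t => P.momVar (P.τ * R₀ + t))
      (fun t => P.dirSq (P.τ * R₀ + t)) (fun t => P.moveSq (P.τ * R₀ + t)) := by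
  -- The phase at rest consists of whole rounds, so restarting the clock preserves the communication
  -- times.
  have hdvd : ∀ t, P.τ ∣ P.τ * R₀ + t ↔ P.τ ∣ t := fun t =>
    Nat.dvd_add_right (dvd_mul_right _ _)
  exact {
    E_nonneg := fun t => integral_nonneg fun ω => sq_nonneg _
    V_nonneg := fun t => integral_nonneg fun ω => nodeSq_nonneg _
    S_nonneg := fun t => integral_nonneg fun ω => nodeVar_nonneg _
    D_nonneg := fun t => integral_nonneg fun ω => nodeVar_nonneg _
    U_nonneg := fun t => integral_nonneg fun ω => sq_nonneg _
    W_nonneg := fun t => integral_nonneg fun ω => nodeSq_nonneg _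
    E_succ := fun t => by
      have := P.errSq_succ (P.τ * R₀ + t)
      rw [hα] at this
      exact this.le
    Q_succ := fun t ht => P.errVar_succ (P.τ * R₀ + t) (by rwa [add_assoc, hdvd])
    Q_succ_of_dvd := fun t ht => P.errVar_succ_of_dvd (P.τ * R₀ + t) (by rwa [add_assoc, hdvd])
    D_le := fun t => P.momVar_le _
    V_le := fun t => by
      have := P.noiseSq_le (P.τ * R₀ + t)
      rwa [hα] at this
    W_succ := fun t ht => by
      have := P.moveSq_succ (P.τ * R₀ + t) (by rwa [add_assoc, hdvd])
      rwa [hη] at this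
    W_succ_of_dvd := fun t ht => by
      have := P.moveSq_succ_of_dvd (P.τ * R₀ + t) (by rwa [add_assoc, hdvd])
      rw [hη] at this
      have h0 : 0 ≤ (η / P.ρ) ^ 2 * P.momVar (P.τ * R₀ + t) :=
        mul_nonneg (sq_nonneg _) (integral_nonneg fun ω => nodeVar_nonneg _)
      refine this.trans ?_
      linarith
    S_of_dvd := fun t ht => P.iterVar_of_dvd _ ((hdvd t).2 ht)
    S_succ := fun t ht l hl => by
      have := P.iterVar_succ (P.τ * R₀ + t) (by rwa [add_assoc, hdvd]) hl
      rwa [hη] at this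
    Q_zero := P.errVar_initial hη0 (Nat.mul_pos hτ hR₀) (dvd_mul_right _ _)
    W_zero := (P.moveSq_initial hη0 le_rfl).le }

/-- Convergence of the adaptive federated method with the stated tuning. -/
theorem sum_integral_gradient_le {R₀ R : ℕ} (hτ : 0 < P.τ) (hR₀ : 0 < R₀) (hR : 0 < R)
    (hL : 0 < P.L) (hβL : P.β ≤ P.L)
    (hη0 : ∀ t, t < P.τ * R₀ → P.η t = 0)
    (hη : ∀ t, P.η (P.τ * R₀ + t) = P.ρ / (8 * P.L * P.τ))
    (hα0 : ∀ t, t < P.τ * R₀ → P.α t = 1 / ((t : ℝ) + 1))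
    (hα : ∀ t, P.α (P.τ * R₀ + t) = 1 / (K * (P.τ : ℝ) ^ 2)) {Δ x ε : ℝ} (hε : 0 < ε)
    (hΔ : ∀ w, P.F P.w₀ - P.F w ≤ Δ)
    (hxτ : 1 / (K * (P.τ : ℝ)) ≤ x) (hx0 : 1 / (R₀ : ℝ) ≤ x) (hxR : 1 / (R : ℝ) ≤ x)
    (hsmall : 16 * P.L * Δ / (P.ρ * R) + 14 * P.σ ^ 2 * x ^ 2 / P.ρ
      ≤ 1 / (16 * (P.ρ + (1 + (P.σ ^ 2 + P.G ^ 2)) / 2)) * ε ^ 2) :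
    ∑ j ∈ Finset.Icc 1 (R₀ + R), ∫ ω, ‖P.F' (P.w (P.τ * j) ω)‖ ∂P.Pr
      ≤ R₀ * P.G + R * (ε / 2) := by
  have hK : (1 : ℝ) ≤ K := by exact_mod_cast P.K_pos
  have hτ1 : (1 : ℝ) ≤ P.τ := by exact_mod_cast hτ
  have hρ := P.ρ_pos
  have hrec := P.roundRecursion hτ hR₀ hη0 hη hα
  have hη4 : 4 * P.β * (P.ρ / (8 * P.L * P.τ)) ≤ P.ρ := by
    rw [← mul_div_assoc, div_le_iff₀ (by positivity)]
    have : P.β * P.ρ ≤ P.L * P.ρ := by gcongr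
    have h2 : P.L * P.ρ ≤ P.L * P.ρ * P.τ := le_mul_of_one_le_right (by positivity) hτ1
    nlinarith [mul_pos hL hρ]
  have hdesc : ∀ t, ∫ ω, P.F (P.w (P.τ * R₀ + (t + 1)) ω) ∂P.Pr
      ≤ ∫ ω, P.F (P.w (P.τ * R₀ + t) ω) ∂P.Pr
        - P.ρ / (8 * P.L * P.τ) / 2 * P.gradForm (P.τ * R₀ + t)
        - P.ρ / (8 * P.L * P.τ) * P.ρ / 4 * P.dirSq (P.τ * R₀ + t)
        + P.ρ / (8 * P.L * P.τ) / P.ρ * (P.errSq (P.τ * R₀ + (t + 1))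
          + P.β ^ 2 * P.iterVar (P.τ * R₀ + t)) := fun t => by
    have h := P.integral_F_succ_le (P.τ * R₀ + t) (by rw [hη]; exact hη4)
    rw [hη] at h
    exact h
  have hΔ' : ∀ t, ∫ ω, P.F (P.w (P.τ * R₀ + 0) ω) ∂P.Pr - ∫ ω, P.F (P.w (P.τ * R₀ + t) ω) ∂P.Pr
      ≤ Δ := fun t => by
    rw [← integral_sub (P.integrable_F _) (P.integrable_F _)]
    refine (integral_mono ((P.integrable_F _).sub (P.integrable_F _)) (integrable_const Δ)
      fun ω => ?_).trans (by simp)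
    have := P.w_initial hη0 (t := P.τ * R₀ + 0) le_rfl ω
    simp only [Pi.sub_apply, this]
    exact hΔ _
  have hE0 : P.errSq (P.τ * R₀ + 0) ≤ 2 * P.σ ^ 2 / (K * ((P.τ * R₀ : ℕ) : ℝ)) := by
    have hpos : (0 : ℝ) < ((P.τ * R₀ : ℕ) : ℝ) := by exact_mod_cast Nat.mul_pos hτ hR₀
    rw [le_div_iff₀ (by positivity), mul_comm]
    exact P.errSq_initial hη0 hα0 _ le_rfl
  have h1 := hrec.sum_precond_gradient_le hτ P.β_nonneg hβL hL hρ hK rfl rfl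
    (H := fun t => P.gradForm (P.τ * R₀ + t))
    (Φ := fun t => ∫ ω, P.F (P.w (P.τ * R₀ + t) ω) ∂P.Pr) hdesc hΔ' hR₀ hR hE0 hxτ hx0 hxR
  have hη' : 0 ≤ P.ρ / (8 * P.L * P.τ) := by positivity
  have hΛ : P.ρ ≤ P.ρ + (1 + (P.σ ^ 2 + P.G ^ 2)) / 2 := by
    have : 0 ≤ (1 + (P.σ ^ 2 + P.G ^ 2)) / 2 := by positivity
    linarith
  have hβη : P.β * (P.ρ / (8 * P.L * P.τ)) * P.τ ≤ P.ρ / 8 := by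
    have h : P.β * (P.ρ / (8 * P.L * P.τ)) * P.τ = P.β / P.L * (P.ρ / 8) := by field_simp
    rw [h]
    exact mul_le_of_le_one_left (by positivity) ((div_le_one hL).2 hβL)
  have h2 := sum_gradient_le hτ P.β_nonneg hη' hρ hε hΛ hβη
    (B := fun t => ∫ ω, ‖P.F' (P.w (P.τ * R₀ + t) ω)‖ ∂P.Pr)
    (Z := fun t => ∫ ω, ‖P.dir (P.τ * R₀ + t) ω‖ ∂P.Pr)
    (H := fun t => P.gradForm (P.τ * R₀ + t)) (U := fun t => P.dirSq (P.τ * R₀ + t))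
    (fun t => integral_nonneg fun ω => norm_nonneg _)
    (fun t => integral_nonneg fun ω => sq_nonneg _)
    (fun t => by
      have := P.integral_gradient_succ_le (P.τ * R₀ + t)
      rwa [hη] at this)
    (fun t δ hδ => P.integral_gradient_le _ hδ) (fun t δ hδ => P.integral_dir_le _ hδ) R
    (h1.trans (mul_le_mul_of_nonneg_left hsmall (Nat.cast_nonneg _)))
  -- No progress is made at rest; these rounds are charged at the trivial bound and outnumbered by
  -- the main phase later.
  have h3 : ∑ j ∈ Finset.range R₀, ∫ ω, ‖P.F' (P.w (P.τ * (j + 1)) ω)‖ ∂P.Pr ≤ R₀ * P.G := by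
    have := Finset.sum_le_sum fun j (_ : j ∈ Finset.range R₀) =>
      (integral_mono (P.integrable_gradient (P.τ * (j + 1))) (integrable_const P.G)
        fun ω => P.norm_gradient_le _).trans (le_of_eq (by simp : _ = P.G))
    simpa using this
  have h4 : ∑ j ∈ Finset.Icc 1 (R₀ + R), ∫ ω, ‖P.F' (P.w (P.τ * j) ω)‖ ∂P.Pr
      = ∑ j ∈ Finset.range (R₀ + R), ∫ ω, ‖P.F' (P.w (P.τ * (j + 1)) ω)‖ ∂P.Pr := by
    rw [← Finset.Ico_add_one_right_eq_Icc, Finset.sum_Ico_eq_sum_range]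
    simp only [Nat.add_sub_cancel, add_comm 1]
  rw [h4, Finset.sum_range_add]
  refine add_le_add h3 (le_trans (le_of_eq ?_) h2)
  refine Finset.sum_congr rfl fun r _ => ?_
  rw [show P.τ * (R₀ + r + 1) = P.τ * R₀ + P.τ * (r + 1) by ring]

end FedProcess

/-! ### Measurable dependence of gradients on the sample -/

/-- The gradient of a function depending measurably on a parameter is measurable. -/
theorem measurable_gradient_of_measurable {d : ℕ} {𝒵 : Type*} [MeasurableSpace 𝒵]
    {f : 𝒵 → Vec d → ℝ} (hf : ∀ w, Measurable fun z => f z w) (hd : ∀ z, Differentiable ℝ (f z))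
    (w : Vec d) : Measurable fun z => gradient (f z) w := by
  have hcoord : ∀ i, Measurable fun z => gradient (f z) w i := by
    intro i
    set e : Vec d := EuclideanSpace.single i 1
    -- Each coordinate is a limit of difference quotients along the countable sequence `1 / (n +
    -- 1)`, hence a limit of measurable functions.
    have hlim : ∀ z, Filter.Tendsto
        (fun n : ℕ => (1 / ((n : ℝ) + 1))⁻¹ • (f z (w + (1 / ((n : ℝ) + 1)) • e) - f z w))
        Filter.atTop (nhds (gradient (f z) w i)) := by
      intro z
      have h1 := ((hd z w).hasGradientAt.hasFDerivAt.hasLineDerivAt e).tendsto_slope_zero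
      have h2 : (InnerProductSpace.toDual ℝ (Vec d)) (gradient (f z) w) e = gradient (f z) w i := by
        rw [InnerProductSpace.toDual_apply_apply, EuclideanSpace.inner_single_right]; simp
      rw [h2] at h1
      refine h1.comp (tendsto_nhdsWithin_iff.2
        ⟨tendsto_one_div_add_atTop_nhds_zero_nat, Filter.Eventually.of_forall fun n => ?_⟩)
      have : (1 / ((n : ℝ) + 1)) ≠ 0 := by positivity
      exact this
    have hmeas : ∀ n : ℕ, Measurable fun z =>
        (1 / ((n : ℝ) + 1))⁻¹ • (f z (w + (1 / ((n : ℝ) + 1)) • e) - f z w) := fun n =>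
      ((hf _).sub (hf _)).const_mul _
    exact measurable_of_tendsto_metrizable hmeas (tendsto_pi_nhds.2 hlim)
  exact (PiLp.continuous_toLp 2 _).measurable.comp (measurable_pi_iff.2 hcoord)

/-! ### Aggregated ratios and the IW-ERM objective -/

namespace LabelShiftProblem

variable {K d : ℕ} {X Y O Θ : Type*} [Fintype Y] [MeasurableSpace X] [MeasurableSpace Y]
  (P : LabelShiftProblem K d X Y O Θ)

instance (k : Fin K) : IsProbabilityMeasure (P.trainDist k) := P.trainDist_prob k

theorem trainMarginal_pos (k : Fin K) (y : Y) : 0 < P.trainMarginal k y := P.label_pos k y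

variable {P} {r : Fin K → Y → ℝ}

theorem aggregatedRatio_nonneg (hr : ∀ j, r j ∈ P.feasibleRatios j) (k : Fin K) (y : Y) :
    0 ≤ P.aggregatedRatio r k y :=
  div_nonneg (mul_nonneg (by positivity) (Finset.sum_nonneg fun j _ =>
    mul_nonneg (P.trainMarginal_pos j y).le ((hr j).1 y))) (P.trainMarginal_pos k y).le

/-- Each `p_j r_j` is a probability vector, so its entries are at most one. This crude bound shows
that the supremum in `rMax` is over a bounded set; otherwise `sSup` would give a default value. -/
theorem aggregatedRatio_le (hr : ∀ j, r j ∈ P.feasibleRatios j) (k : Fin K) (y : Y) :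
    P.aggregatedRatio r k y ≤ 1 / P.trainMarginal k y := by
  have hK : (K : ℝ) ≠ 0 := by have := k.pos; positivity
  refine div_le_div_of_nonneg_right ?_ (P.trainMarginal_pos k y).le
  have h1 : ∀ j, P.trainMarginal j y * r j y ≤ 1 := fun j => by
    rw [← (hr j).2]
    exact Finset.single_le_sum (f := fun y => P.trainMarginal j y * r j y)
      (fun y _ => mul_nonneg (P.trainMarginal_pos j y).le ((hr j).1 y)) (Finset.mem_univ y)
  have h2 := mul_le_mul_of_nonneg_left
    (Finset.sum_le_sum fun j (_ : j ∈ Finset.univ) => h1 j) (by positivity : 0 ≤ 1 / (K : ℝ))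
  simpa [hK] using h2

theorem aggregatedRatio_le_rMax {θ : Fin K → Θ} (hr : ∀ j, P.IsVRLSRatio j (θ j) (r j))
    (k : Fin K) (y : Y) : P.aggregatedRatio r k y ≤ P.rMax := by
  refine le_csSup ⟨∑ k, ∑ y, 1 / P.trainMarginal k y, ?_⟩ ⟨θ, r, k, y, hr, rfl⟩
  rintro a ⟨θ', r', k', y', hr', rfl⟩
  refine (aggregatedRatio_le (fun j => (hr' j).1) k' y').trans ?_
  have h0 : ∀ k y, 0 ≤ 1 / P.trainMarginal k y := fun k y =>
    one_div_nonneg.2 (P.trainMarginal_pos k y).le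
  exact (Finset.single_le_sum (f := fun y => 1 / P.trainMarginal k' y) (fun y _ => h0 k' y)
    (Finset.mem_univ y')).trans (Finset.single_le_sum
      (f := fun k => ∑ y, 1 / P.trainMarginal k y)
      (fun k _ => Finset.sum_nonneg fun y _ => h0 k y) (Finset.mem_univ k'))

theorem norm_stochGrad_le {β G σ : ℝ} (h : P.SmoothBoundedNoise r β G σ)
    (hr : ∀ j, r j ∈ P.feasibleRatios j) (k : Fin K) (z : X × Y) (w : Vec d) :
    ‖P.stochGrad r k z w‖ ≤ P.aggregatedRatio r k z.2 * G := by
  have h0 := aggregatedRatio_nonneg hr k z.2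
  rw [stochGrad, norm_smul, Real.norm_eq_abs, abs_of_nonneg h0]
  exact mul_le_mul_of_nonneg_left (h.bounded_gradient z w) h0

theorem norm_stochGrad_sub_le {β G σ : ℝ} (h : P.SmoothBoundedNoise r β G σ)
    (hr : ∀ j, r j ∈ P.feasibleRatios j) (k : Fin K) (z : X × Y) (u v : Vec d) :
    ‖P.stochGrad r k z u - P.stochGrad r k z v‖
      ≤ P.aggregatedRatio r k z.2 * (β * ‖u - v‖) := by
  have h0 := aggregatedRatio_nonneg hr k z.2
  rw [stochGrad, stochGrad, ← smul_sub, norm_smul, Real.norm_eq_abs, abs_of_nonneg h0]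
  exact mul_le_mul_of_nonneg_left (h.smooth z u v) h0

variable [MeasurableSingletonClass Y]

theorem measurable_label {f : Y → ℝ} : Measurable fun z : X × Y => f z.2 :=
  (measurable_of_finite f).comp measurable_snd

theorem integrable_label (P : LabelShiftProblem K d X Y O Θ) (k : Fin K) (f : Y → ℝ) :
    Integrable (fun z : X × Y => f z.2) (P.trainDist k) := by
  refine Integrable.of_bound measurable_label.aestronglyMeasurable (∑ y, ‖f y‖)
    (Filter.Eventually.of_forall fun z => ?_)
  exact Finset.single_le_sum (f := fun y => ‖f y‖) (fun y _ => norm_nonneg _) (Finset.mem_univ z.2)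

theorem integral_label (P : LabelShiftProblem K d X Y O Θ) (k : Fin K) (f : Y → ℝ) :
    ∫ z, f z.2 ∂P.trainDist k = ∑ y, P.trainMarginal k y * f y := by
  have h1 := integral_map (μ := P.trainDist k) measurable_snd.aemeasurable (f := f)
    (measurable_of_finite f).aestronglyMeasurable
  have := Measure.isProbabilityMeasure_map (μ := P.trainDist k)
    (measurable_snd (α := X) (β := Y)).aemeasurable
  rw [← h1, integral_fintype .of_finite]
  refine Finset.sum_congr rfl fun y _ => ?_
  rw [map_measureReal_apply measurable_snd (measurableSet_singleton y)]
  rfl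

/-- The factor `p_k` cancels, leaving the average of the estimated test marginals, each of total
mass one. -/
theorem integral_aggregatedRatio (hr : ∀ j, r j ∈ P.feasibleRatios j) (k : Fin K) :
    ∫ z, P.aggregatedRatio r k z.2 ∂P.trainDist k = 1 := by
  have hK : (K : ℝ) ≠ 0 := by have := k.pos; positivity
  rw [P.integral_label k]
  have h1 : ∀ y, P.trainMarginal k y * P.aggregatedRatio r k y
      = (1 / (K : ℝ)) * ∑ j, P.trainMarginal j y * r j y := fun y =>
    mul_div_cancel₀ _ (P.trainMarginal_pos k y).ne'
  simp only [h1]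
  rw [← Finset.mul_sum, Finset.sum_comm, Finset.sum_congr rfl fun j _ => (hr j).2]
  simp [hK]

theorem one_le_rMax (hK : 0 < K) {θ : Fin K → Θ} (hr : ∀ j, P.IsVRLSRatio j (θ j) (r j)) :
    1 ≤ P.rMax := by
  rw [← integral_aggregatedRatio (fun j => (hr j).1) ⟨0, hK⟩]
  refine (integral_mono (P.integrable_label _ _) (integrable_const P.rMax) fun z =>
    aggregatedRatio_le_rMax hr _ z.2).trans (by simp)

section Gradient

variable {β G σ : ℝ}

/-- A Carathéodory function, measurable in the sample and continuous in the parameter, is jointly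
measurable. -/
theorem measurable_stochGrad (h : P.SmoothBoundedNoise r β G σ) (k : Fin K) :
    Measurable fun p : (X × Y) × Vec d => P.stochGrad r k p.1 p.2 := by
  have h1 : ∀ w, Measurable fun z => P.stochGrad r k z w := fun w => by
    have ha : Measurable fun z : X × Y => P.aggregatedRatio r k z.2 := measurable_label
    have hg : Measurable fun z : X × Y => gradient (P.sampleLoss z) w :=
      measurable_gradient_of_measurable P.loss_measurable h.differentiable w
    exact ha.smul hg
  have h2 : ∀ z, Continuous fun w => P.stochGrad r k z w := fun z => by
    have hlip : LipschitzWith (Real.toNNReal β) (gradient (P.sampleLoss z)) :=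
      LipschitzWith.of_dist_le' fun u v => by
        rw [dist_eq_norm, dist_eq_norm]
        exact h.smooth z u v
    exact hlip.continuous.const_smul (P.aggregatedRatio r k z.2)
  have h3 : Measurable (Function.uncurry fun w z => P.stochGrad r k z w) :=
    measurable_uncurry_of_continuous_of_measurable h2 h1
  have h4 : Measurable (Prod.swap : (X × Y) × Vec d → Vec d × (X × Y)) := measurable_swap
  have h5 : Function.uncurry (fun w z => P.stochGrad r k z w) ∘ Prod.swap
      = fun p : (X × Y) × Vec d => P.stochGrad r k p.1 p.2 := by
    funext p
    rfl
  rw [← h5]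
  exact h3.comp h4

theorem integrable_stochGrad (h : P.SmoothBoundedNoise r β G σ)
    (hr : ∀ j, r j ∈ P.feasibleRatios j) (k : Fin K) (w : Vec d) :
    Integrable (fun z => P.stochGrad r k z w) (P.trainDist k) :=
  ((P.integrable_label k (P.aggregatedRatio r k)).mul_const G).mono'
    ((measurable_stochGrad h k).comp
      (measurable_id.prodMk measurable_const)).aestronglyMeasurable
    (Filter.Eventually.of_forall fun z => norm_stochGrad_le h hr k z w)

/-- The ratio integrates to one, so it acts as a probability density. This is why the bounds `β` and
`G` pass to the objective without a factor `rMax`. -/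
theorem norm_integral_le_of_ratio {E : Type*} [NormedAddCommGroup E] [NormedSpace ℝ E]
    (hr : ∀ j, r j ∈ P.feasibleRatios j) {k : Fin K} {f : X × Y → E} {c : ℝ}
    (hf : ∀ z, ‖f z‖ ≤ P.aggregatedRatio r k z.2 * c) : ‖∫ z, f z ∂P.trainDist k‖ ≤ c := by
  have h1 := norm_integral_le_of_norm_le
    ((P.integrable_label k (P.aggregatedRatio r k)).mul_const c)
    (Filter.Eventually.of_forall hf)
  rwa [integral_mul_const, integral_aggregatedRatio hr, one_mul] at h1

/-- Differentiation under the integral with dominating function the ratio times `G`. It is needed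
because `gradient` is zero by default at points without a derivative, while descent requires a true
gradient. -/
theorem differentiable_iwRisk (h : P.SmoothBoundedNoise r β G σ)
    (hr : ∀ j, r j ∈ P.feasibleRatios j) : Differentiable ℝ (P.iwRisk r) := by
  intro w
  have hk : ∀ k, DifferentiableAt ℝ
      (fun w => ∫ z, P.aggregatedRatio r k z.2 * P.sampleLoss z w ∂P.trainDist k) w := by
    intro k
    refine (hasFDerivAt_integral_of_dominated_of_fderiv_le (s := Set.univ) (𝕜 := ℝ)
      (F := fun w z => P.aggregatedRatio r k z.2 * P.sampleLoss z w)
      (F' := fun w z => InnerProductSpace.toDual ℝ (Vec d) (P.stochGrad r k z w))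
      (bound := fun z => P.aggregatedRatio r k z.2 * G)
      Filter.univ_mem ?_ ?_ ?_ ?_ ?_ ?_).differentiableAt
    · exact Filter.Eventually.of_forall fun w =>
        (measurable_label.mul (P.loss_measurable w)).aestronglyMeasurable
    · refine (P.loss_integrable w k).bdd_mul (c := ∑ y, ‖P.aggregatedRatio r k y‖)
        measurable_label.aestronglyMeasurable (Filter.Eventually.of_forall fun z => ?_)
      exact Finset.single_le_sum (f := fun y => ‖P.aggregatedRatio r k y‖)
        (fun y _ => norm_nonneg _) (Finset.mem_univ z.2)
    · exact (InnerProductSpace.toDual ℝ (Vec d)).continuous.comp_aestronglyMeasurable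
        (integrable_stochGrad h hr k w).aestronglyMeasurable
    · refine Filter.Eventually.of_forall fun z w _ => ?_
      rw [LinearIsometryEquiv.norm_map]
      exact norm_stochGrad_le h hr k z w
    · exact (P.integrable_label k (P.aggregatedRatio r k)).mul_const G
    · refine Filter.Eventually.of_forall fun z w _ => ?_
      have h1 := (h.differentiable z w).hasGradientAt.hasFDerivAt.const_mul
        (P.aggregatedRatio r k z.2)
      simpa [stochGrad] using h1
  exact (DifferentiableAt.fun_sum fun k _ => hk k).const_mul _

end Gradient

/-- The run of the method on a label-shift problem. -/
noncomputable def fedProcess {Ω : Type*} [MeasurableSpace Ω] {β G σ ρ : ℝ} (hβ : 0 < β)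
    (hρ : 0 < ρ) (hK : 0 < K) (τ : ℕ) {η α β₂ : ℕ → ℝ} (hη : ∀ t, 0 ≤ η t)
    (hα : ∀ t, α t ∈ Set.Icc (0 : ℝ) 1) (hβ₂ : ∀ t, β₂ t ∈ Set.Icc (0 : ℝ) 1)
    (w₀ : Vec d) (Pr : Measure Ω) [IsProbabilityMeasure Pr] {ξ : ℕ → Fin K → Ω → X × Y}
    {θ : Fin K → Θ} (hr : ∀ k, P.IsVRLSRatio k (θ k) (r k)) (h : P.SmoothBoundedNoise r β G σ)
    (hξ : IsSampleStream P Pr ξ) : FedProcess K d (X × Y) Ω where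
  ρ := ρ
  τ := τ
  η := η
  α := α
  β₂ := β₂
  w₀ := w₀
  g := P.stochGrad r
  F := P.iwRisk r
  F' := gradient (P.iwRisk r)
  μ := P.trainDist
  Pr := Pr
  ξ := ξ
  β := β
  G := G
  σ := σ
  L := β * √P.rMax
  K_pos := hK
  ρ_pos := hρ
  η_nonneg := hη
  α_mem := hα
  β₂_mem := hβ₂
  β_nonneg := hβ.le
  prob := inferInstance
  prob_node := P.trainDist_prob
  measurable_sample := hξ.measurable
  law := hξ.law
  indep := hξ.indep
  measurable_g := measurable_stochGrad h
  bounded_g := ⟨P.rMax * |G|, fun k z w => (norm_stochGrad_le h (fun j => (hr j).1) k z w).trans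
    (mul_le_mul (aggregatedRatio_le_rMax hr k z.2) (le_abs_self G)
      ((norm_nonneg _).trans (h.bounded_gradient z w)) (zero_le_one.trans (one_le_rMax hK hr)))⟩
  hasGradient := fun w => (differentiable_iwRisk h (fun j => (hr j).1) w).hasGradientAt
  lipschitz := fun u v => by
    have hr' := fun j => (hr j).1
    rw [← h.unbiased ⟨0, hK⟩ u, ← h.unbiased ⟨0, hK⟩ v,
      ← integral_sub (integrable_stochGrad h hr' _ u) (integrable_stochGrad h hr' _ v)]
    exact norm_integral_le_of_ratio hr' fun z => norm_stochGrad_sub_le h hr' _ z u v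
  norm_gradient_le := fun w => by
    rw [← h.unbiased ⟨0, hK⟩ w]
    exact norm_integral_le_of_ratio (fun j => (hr j).1)
      fun z => norm_stochGrad_le h (fun j => (hr j).1) _ z w
  unbiased := h.unbiased
  variance := h.variance
  -- One of the two factors of the squared ratio is bounded by `rMax`, the other integrates to one;
  -- the constant is therefore `β * √rMax` and not `β * rMax`.
  meanSquareLipschitz := fun k u v => by
    have hr' := fun j => (hr j).1
    have h1 : ∀ z, ‖P.stochGrad r k z u - P.stochGrad r k z v‖ ^ 2
        ≤ P.aggregatedRatio r k z.2 * (P.rMax * (β * ‖u - v‖) ^ 2) := fun z => by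
      have h0 := aggregatedRatio_nonneg hr' k z.2
      have h2 := aggregatedRatio_le_rMax hr k z.2
      refine (pow_le_pow_left₀ (norm_nonneg _) (norm_stochGrad_sub_le h hr' k z u v) 2).trans ?_
      rw [mul_pow, ← mul_assoc]
      refine mul_le_mul_of_nonneg_right ?_ (sq_nonneg _)
      nlinarith
    refine (integral_mono_of_nonneg (Filter.Eventually.of_forall fun z => sq_nonneg _)
      ((P.integrable_label k (P.aggregatedRatio r k)).mul_const _)
      (Filter.Eventually.of_forall h1)).trans (le_of_eq ?_)
    rw [integral_mul_const, integral_aggregatedRatio hr', mul_pow, mul_pow,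
      Real.sq_sqrt (zero_le_one.trans (one_le_rMax hK hr))]
    ring

end LabelShiftProblem

/-! ### Choice of the parameters and the theorem -/

/-- The number `τ` of local steps, and the numbers of rounds of the initial and of the main phase. -/
theorem exists_round_numbers {β G σ Δ ρ μ : ℝ} (hβ : 0 < β) (hG : 0 ≤ G) (hΔ : 0 ≤ Δ) (hρ : 0 < ρ)
    (hμ : 0 < μ) :
    ∃ C : ℝ, 0 < C ∧ ∀ (K : ℕ) (ε rmax : ℝ), 0 < K → 0 < ε → (K : ℝ) * ε ≤ 1 → 1 ≤ rmax →
      ∃ (τ R₀ R : ℕ) (x : ℝ), 0 < τ ∧ 0 < R₀ ∧ 0 < R ∧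
        ((τ * (R₀ + R) : ℕ) : ℝ) ≤ C * (rmax / (K * ε ^ 3)) ∧
        ((R₀ + R : ℕ) : ℝ) ≤ C * (rmax / ε ^ 2) ∧
        1 / (K * (τ : ℝ)) ≤ x ∧ 1 / (R₀ : ℝ) ≤ x ∧ 1 / (R : ℝ) ≤ x ∧
        16 * (β * √rmax) * Δ / (ρ * R) + 14 * σ ^ 2 * x ^ 2 / ρ ≤ μ * ε ^ 2 ∧
        R₀ * G ≤ R * (ε / 2) := by
  -- The constant `a` sets `x = ε / a`, `τ ≈ a / (K * ε)` and `R₀ ≈ a / ε`; its size brings the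
  -- variance term below half of `μ * ε ^ 2`.
  obtain ⟨a, ha1, ha⟩ : ∃ a : ℝ, 1 ≤ a ∧ 28 * σ ^ 2 ≤ a * (ρ * μ) := by
    refine ⟨1 + 28 * σ ^ 2 / (ρ * μ), ?_, ?_⟩
    · have : 0 ≤ 28 * σ ^ 2 / (ρ * μ) := by positivity
      linarith
    · rw [add_mul, div_mul_cancel₀ _ (by positivity)]
      nlinarith [mul_pos hρ hμ]
  -- The constant `b` sets `R ≈ b * √rmax / ε ^ 2`. The three conditions give respectively `1 / R ≤
  -- x`, a main phase outweighing the rounds at rest, and the other half of `μ * ε ^ 2` for the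
  -- initial gap.
  obtain ⟨b, hab, hbG, hbΔ⟩ : ∃ b : ℝ, a ≤ b ∧ 4 * a * G ≤ b ∧ 32 * β * Δ ≤ b * (ρ * μ) := by
    have h1 : 0 ≤ 32 * β * Δ / (ρ * μ) := by positivity
    have h2 : 0 ≤ 4 * a * G := by positivity
    refine ⟨a + 4 * a * G + 32 * β * Δ / (ρ * μ), by linarith, by linarith, ?_⟩
    rw [add_mul, div_mul_cancel₀ _ (by positivity)]
    have : 0 ≤ (a + 4 * a * G) * (ρ * μ) := by positivity
    linarith
  have ha0 : 0 < a := by linarith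
  have hb0 : 0 < b := by linarith
  refine ⟨8 * a * b, by positivity, fun K ε rmax hK hε hKε hr => ?_⟩
  have hK1 : (1 : ℝ) ≤ K := by exact_mod_cast hK
  have hK0 : (0 : ℝ) < K := by linarith
  have hε1 : ε ≤ 1 := le_trans (le_mul_of_one_le_left hε.le hK1) hKε
  have hs1 : 1 ≤ √rmax := Real.one_le_sqrt.2 hr
  -- The parameters themselves need only `√rmax`; the bound by `rmax` follows because the ratio is
  -- at least one.
  have hs : √rmax ≤ rmax := by
    nlinarith [Real.sq_sqrt (by linarith : 0 ≤ rmax)]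
  have hr0 : 0 < rmax := by linarith
  set s := √rmax
  have hs0 : 0 < s := by linarith
  have ceil_le : ∀ y : ℝ, 1 ≤ y → ((⌈y⌉₊ : ℕ) : ℝ) ≤ 2 * y := fun y hy => by
    linarith [Nat.ceil_lt_add_one (by linarith : 0 ≤ y)]
  -- Here `K * ε ≤ 1` is used: the real number to be rounded up is at least one, so rounding at most
  -- doubles it and linear speed-up in `K` is kept.
  have hτ1 : 1 ≤ a / (K * ε) := by
    rw [one_le_div (by positivity)]; linarith
  have hR₀1 : 1 ≤ a / ε := by
    rw [one_le_div hε]; linarith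
  have hεi : 1 ≤ 1 / ε := by rw [one_le_div hε]; exact hε1
  have haR : a / ε ≤ b * s / ε ^ 2 := by
    have h1 : a / ε ≤ b * s * (1 / ε) := by
      rw [div_eq_mul_one_div]
      gcongr
      nlinarith
    have h2 : b * s / ε ^ 2 = b * s * (1 / ε) * (1 / ε) := by field_simp
    rw [h2]
    exact h1.trans (le_mul_of_one_le_right (by positivity) hεi)
  have hR1 : 1 ≤ b * s / ε ^ 2 := hR₀1.trans haR
  have hτl := Nat.le_ceil (a / (K * ε))
  have hR₀l := Nat.le_ceil (a / ε)
  have hRl := Nat.le_ceil (b * s / ε ^ 2)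
  have hτu := ceil_le _ hτ1
  have hR₀u := ceil_le _ hR₀1
  have hRu := ceil_le _ hR1
  set τ := ⌈a / (K * ε)⌉₊
  set R₀ := ⌈a / ε⌉₊
  set R := ⌈b * s / ε ^ 2⌉₊
  have hτ0 : (0 : ℝ) < τ := by linarith
  have hR₀0 : (0 : ℝ) < R₀ := by linarith
  have hR0 : (0 : ℝ) < R := by linarith
  have hRR : (R₀ : ℝ) + R ≤ 4 * b * (rmax / ε ^ 2) := by
    have h1 : b * s / ε ^ 2 ≤ b * (rmax / ε ^ 2) := by
      rw [← mul_div_assoc]; gcongr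
    linarith
  have hone : ∀ y : ℝ, a / ε ≤ y → 1 / y ≤ ε / a := fun y hy => by
    have h0 : 0 < a / ε := by positivity
    calc 1 / y ≤ 1 / (a / ε) := one_div_le_one_div_of_le h0 hy
      _ = ε / a := one_div_div _ _
  refine ⟨τ, R₀, R, ε / a, by exact_mod_cast hτ0, by exact_mod_cast hR₀0, by exact_mod_cast hR0,
    ?_, ?_, ?_, hone _ hR₀l, hone _ (haR.trans hRl), ?_, ?_⟩
  · push_cast
    calc (τ : ℝ) * (R₀ + R) ≤ 2 * (a / (K * ε)) * (4 * b * (rmax / ε ^ 2)) := by gcongr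
      _ = 8 * a * b * (rmax / (K * ε ^ 3)) := by field_simp; ring
  · push_cast
    refine hRR.trans ?_
    have : 0 ≤ rmax / ε ^ 2 := by positivity
    gcongr
    nlinarith
  · refine hone _ ?_
    have h1 : a / ε = K * (a / (K * ε)) := by field_simp
    rw [h1]
    gcongr
  · have h1 : 16 * (β * s) * Δ / (ρ * R) ≤ μ / 2 * ε ^ 2 := by
      rw [div_le_iff₀ (by positivity)]
      have h2 : b * s ≤ R * ε ^ 2 := by rwa [div_le_iff₀ (by positivity)] at hRl
      have h3 : 32 * β * Δ * s ≤ b * (ρ * μ) * s := by gcongr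
      have h4 : (ρ * μ) * (b * s) ≤ (ρ * μ) * (R * ε ^ 2) := by gcongr
      linarith
    have h2 : 14 * σ ^ 2 * (ε / a) ^ 2 / ρ ≤ μ / 2 * ε ^ 2 := by
      rw [div_le_iff₀ hρ, div_pow, mul_div_assoc', div_le_iff₀ (by positivity)]
      have h3 : 28 * σ ^ 2 ≤ a ^ 2 * (ρ * μ) := ha.trans (by
        have : a ≤ a ^ 2 := by nlinarith
        gcongr)
      have h4 := mul_le_mul_of_nonneg_right h3 (sq_nonneg ε)
      linarith
    linarith
  · have h1 : (R₀ : ℝ) * G ≤ 2 * (a / ε) * G := by gcongr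
    have h2 : b * s / ε ^ 2 * (ε / 2) ≤ R * (ε / 2) := by gcongr
    have h3 : b * s / ε ^ 2 * (ε / 2) = b * s / (2 * ε) := by field_simp
    have h4 : 2 * (a / ε) * G = 4 * a * G * 1 / (2 * ε) := by field_simp; ring
    rw [h3] at h2
    rw [h4] at h1
    refine h1.trans (le_trans ?_ h2)
    gcongr

theorem mainTheorem8 (β G σ Δ ρ : ℝ) (hβ : 0 < β) (hG : 0 ≤ G) (hσ : 0 ≤ σ) (hΔ : 0 ≤ Δ)
    (hρ : 0 < ρ) :
    ∃ C : ℝ, 0 < C ∧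
      ∀ (K : ℕ) (ε rmax : ℝ), 0 < K → 0 < ε → (K : ℝ) * ε ≤ 1 →
      -- the tuning depends only on the constants, on `K`, `ε` and `rmax`
      ∃ (τ R : ℕ) (η α : ℕ → ℝ),
        0 < τ ∧ 0 < R ∧ (∀ t, 0 ≤ η t) ∧ (∀ t, α t ∈ Set.Icc (0 : ℝ) 1) ∧ α 0 = 1 ∧
        ∀ (d : ℕ) (X Y O Θ Ω : Type*) [Fintype Y] [MeasurableSpace X] [MeasurableSpace Y]
          [MeasurableSingletonClass Y] [MeasurableSpace Ω]
          (P : LabelShiftProblem K d X Y O Θ) (θ : Fin K → Θ) (r : Fin K → Y → ℝ)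
          (w₀ : Vec d) (β₂ : ℕ → ℝ) (Pr : Measure Ω) [IsProbabilityMeasure Pr]
          (ξ : ℕ → Fin K → Ω → X × Y),
          P.rMax = rmax →
          (∀ k, P.IsVRLSRatio k (θ k) (r k)) →
          P.SmoothBoundedNoise r β G σ →
          (∀ w, P.iwRisk r w₀ - P.iwRisk r w ≤ Δ) →
          (∀ t, β₂ t ∈ Set.Icc (0 : ℝ) 1) →
          IsSampleStream P Pr ξ →
          ((τ * R : ℕ) : ℝ) ≤ C * (rmax / (K * ε ^ 3)) ∧
          (R : ℝ) ≤ C * (rmax / ε ^ 2) ∧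
          -- average over the communicated models
          (1 / (R : ℝ)) * ∑ j ∈ Finset.Icc 1 R,
            ∫ ω, ‖gradient (P.iwRisk r)
              (P.iwModel r ρ τ η α β₂ w₀ (fun t k => ξ t k ω) (τ * j))‖ ∂Pr ≤ ε ∧
          -- last model of a run with `R'` rounds
          ∃ R' ∈ Finset.Icc 1 R,
            ∫ ω, ‖gradient (P.iwRisk r)
              (P.iwModel r ρ τ η α β₂ w₀ (fun t k => ξ t k ω) (τ * R'))‖ ∂Pr ≤ ε := by
  have hΛ : 0 < ρ + (1 + (σ ^ 2 + G ^ 2)) / 2 := by positivity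
  obtain ⟨C, hC, hnum⟩ := exists_round_numbers (σ := σ) hβ hG hΔ hρ
    (by positivity : 0 < 1 / (16 * (ρ + (1 + (σ ^ 2 + G ^ 2)) / 2)))
  refine ⟨C, hC, fun K ε rmax hK hε hKε => ?_⟩
  -- The tuning is chosen before the problem, so impossible values of `rmax` also need one. Below
  -- one any tuning will do, since a ratio of mean one has maximum at least one.
  rcases lt_or_ge rmax 1 with hlt | hr1
  · refine ⟨1, 1, fun _ => 0, fun _ => 1, one_pos, one_pos, fun _ => le_rfl, fun _ => by simp, rfl,
      ?_⟩
    intro d X Y O Θ Ω _ _ _ _ _ P θ r w₀ β₂ Pr _ ξ hP hr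
    exact absurd (LabelShiftProblem.one_le_rMax hK hr) (by rw [hP]; exact not_le.2 hlt)
  obtain ⟨τ, R₀, R, x, hτ, hR₀, hR, hT, hRR, hxτ, hx0, hxR, hsmall, hinit⟩ :=
    hnum K ε rmax hK hε hKε hr1
  have hs0 : 0 < √rmax := Real.sqrt_pos.2 (by linarith)
  have hL : 0 < β * √rmax := by positivity
  have hτ1 : (1 : ℝ) ≤ τ := by exact_mod_cast hτ
  have hK1 : (1 : ℝ) ≤ K := by exact_mod_cast hK
  have hη : ∀ t : ℕ, 0 ≤ if t < τ * R₀ then (0 : ℝ) else ρ / (8 * (β * √rmax) * τ) := fun t => by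
    split_ifs <;> positivity
  have hα : ∀ t : ℕ, (if t < τ * R₀ then 1 / ((t : ℝ) + 1) else 1 / (K * (τ : ℝ) ^ 2))
      ∈ Set.Icc (0 : ℝ) 1 := fun t => by
    split_ifs
    · refine ⟨by positivity, ?_⟩
      rw [div_le_one (by positivity)]
      linarith [(Nat.cast_nonneg t : (0 : ℝ) ≤ t)]
    · refine ⟨by positivity, ?_⟩
      rw [div_le_one (by positivity)]
      nlinarith
  -- The rounds at rest count towards the total. The condition on `α 0` holds because there is at
  -- least one step at rest and its parameter is `1 / (0 + 1)`.
  refine ⟨τ, R₀ + R, _, _, hτ, by omega, hη, hα, ?_, ?_⟩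
  · simp [Nat.mul_pos hτ hR₀]
  intro d X Y O Θ Ω _ _ _ _ _ P θ r w₀ β₂ Pr _ ξ hP hr hsmooth hgap hβ₂ hξ
  set Q := LabelShiftProblem.fedProcess hβ hρ hK τ hη hα hβ₂ w₀ Pr hr hsmooth hξ
  have hmain := Q.sum_integral_gradient_le (Δ := Δ) (x := x) (ε := ε) hτ hR₀ hR
    (by show 0 < β * √P.rMax; rw [hP]; exact hL)
    (by show β ≤ β * √P.rMax
        rw [hP]; exact le_mul_of_one_le_right hβ.le (Real.one_le_sqrt.2 hr1))
    (fun t ht => if_pos ht)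
    (fun t => by
      show (if τ * R₀ + t < τ * R₀ then (0 : ℝ) else ρ / (8 * (β * √rmax) * τ))
        = ρ / (8 * (β * √P.rMax) * τ)
      rw [hP, if_neg (by omega)])
    (fun t ht => if_pos ht) (fun t => if_neg (not_lt.2 (Nat.le_add_right _ _))) hε hgap hxτ hx0 hxR
    (by show 16 * (β * √P.rMax) * Δ / (ρ * R) + 14 * σ ^ 2 * x ^ 2 / ρ ≤ _
        rw [hP]; exact hsmall)
  have hR' : (0 : ℝ) < ((R₀ + R : ℕ) : ℝ) := by exact_mod_cast (by omega : 0 < R₀ + R)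
  have hsum : ∑ j ∈ Finset.Icc 1 (R₀ + R), ∫ ω, ‖gradient (P.iwRisk r) (P.iwModel r ρ τ
      (fun t => if t < τ * R₀ then (0 : ℝ) else ρ / (8 * (β * √rmax) * τ))
      (fun t => if t < τ * R₀ then 1 / ((t : ℝ) + 1) else 1 / (K * (τ : ℝ) ^ 2))
      β₂ w₀ (fun t k => ξ t k ω) (τ * j))‖ ∂Pr ≤ ((R₀ + R : ℕ) : ℝ) * ε := by
    refine (le_of_eq ?_).trans (hmain.trans ?_)
    · rfl
    · push_cast
      have h1 : (R₀ : ℝ) * Q.G ≤ R * (ε / 2) := hinit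
      have h2 : (0 : ℝ) ≤ R₀ * ε := by positivity
      linarith
  refine ⟨hT, hRR, ?_, ?_⟩
  · rw [one_div, inv_mul_le_iff₀ hR']
    exact hsum
  -- The tuning does not depend on where the run is stopped, so a shorter run is a prefix of the
  -- long one, and some term is at most the average.
  · refine Finset.exists_le_of_sum_le ⟨1, Finset.mem_Icc.2 ⟨le_rfl, by omega⟩⟩
      (hsum.trans (le_of_eq ?_))
    simp
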